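/- Let $F$ be an algebraically closed field of characteristic different from $2$ and let $G$ be a finite abelian group. \textbf{Conventions.} For a tuple $\gamma=(\gamma_1,\dots,\gamma_m)\in G^m$, the elementary grading defined by $\gamma$ on $C=M_m(F)$ gives the matrix unit $E_{ij}$ the degree $\gamma_i^{-1}\gamma_j$. A \emph{fine component} with support $T$ is an algebra $D=M_d(F)$ with a $G$-grading $D=\bigoplus_{t\in T}D_t$, where $T$ is an elementary abelian $2$-subgroup of $G$ and $\dim D_t=1$ for all $t\in T$, realized so that each homogeneous matrix is symmetric or skew-symmetric (for example, a tensor product of algebras $M_2(F)$, each graded by the lines spanned by $I$, $X_a=\mathrm{diag}(-1,1)$, $X_b=\begin{pmatrix}0&1\\1&0\end{pmatrix}$ and $X_aX_b$). The algebra $C\otimes D$ is a matrix algebra by the Kronecker product, with $\deg(E_{ij}\otimes Y)=\gamma_i^{-1}t\gamma_j$ for $Y\in D_t$. An involution $\varphi(X)=\Phi^{-1}\,{}^tX\,\Phi$, with $\Phi$ nondegenerate, is \emph{graded} if it maps each component of the grading onto itself; it is a \emph{transpose} involution if $\Phi$ is symmetric and a \emph{symplectic} one if $\Phi$ is skew-symmetric.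 Conjugation by an invertible $P$ sends $X$ to $P^{-1}XP$ and replaces $\Phi$ by ${}^tP\Phi P$. \textbf{Theorem.} Let $R=M_n(F)$ be graded by $G$ and let $\varphi(X)=\Phi^{-1}\,{}^tX\,\Phi$ be a graded involution of $R$. Then some conjugation identifies $R$, as a graded algebra, with $C\otimes D$, where $C$ has an elementary grading, $D$ is a fine component with support an elementary abelian $2$-subgroup $T$, and $\mathrm{Supp}\,C\cap T\subseteq\{e\}$. For every such identification, with defining tuple $\gamma$ of $C$, the entries of $\gamma$ can be permuted to the form $$\left(g_1^{(p_1)},\dots,g_l^{(p_l)},(g'_{l+1})^{(p_{l+1})},(g''_{l+1})^{(p_{l+1})},\dots,(g'_k)^{(p_k)},(g''_k)^{(p_k)}\right),\qquad p_i\ge 1,$$ where $g^{(p)}$ means $g$ repeated $p$ times and $g_1,\dots,g_l,g'_{l+1},g''_{l+1},\dots,g'_k,g''_k$ are pairwise distinct, and there is a conjugation that identifies the graded algebra $R$ with $C\otimes D$ for the permuted tuple and the same $D$ and brings $\Phi$ to the form $$S_1\otimes X_{t_1}+\dots+S_k\otimes X_{t_k},\qquad(\ast)$$ where $t_i\in T$,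 $X_{t_i}$ spans $D_{t_i}$, and $S_i$ sits in the $i$-th diagonal block of $C$, of size $p_i$ for $i\le l$ and $2p_i$ for $i>l$. Here $S_i$ is one of the matrices $I$, $\begin{pmatrix}0&I\\I&0\end{pmatrix}$, $\begin{pmatrix}0&I\\-I&0\end{pmatrix}$; more precisely, $S_i$ is the first or the third for $i\le l$, and the second or the third for $i>l$. Moreover, $$g_1^2t_1=\dots=g_l^2t_l=g'_{l+1}g''_{l+1}t_{l+1}=\dots=g'_kg''_kt_k .\qquad(\ast\ast)$$ If $\varphi$ is a transpose involution, then each $S_i$ is symmetric (skew-symmetric) at the same time as $X_{t_i}$. If $\varphi$ is a symplectic involution, then each $S_i$ is symmetric (skew-symmetric) if and only if $X_{t_i}$ is skew-symmetric (symmetric). One of the two cases holds. Conversely, let $C$ have the elementary grading defined by a tuple of the above form (its entries need not be distinct), let $D$ be a fine component with support an elementary abelian $2$-subgroup $T$, let $t_i\in T$, and let $X_{t_i}$ span $D_{t_i}$. Let $S_i$ be one of the three matrices above, of the block's size, with $S_i\ne I$ for $i>l$. Suppose that $(\ast\ast)$ holds and that either for all $i$ the symmetry of $S_i$ is that of $X_{t_i}$,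 or for all $i$ it is opposite to that of $X_{t_i}$. Then $C\otimes D$ is $G$-graded and $(\ast)$ defines a graded involution on it, which is a transpose involution in the first case and a symplectic one in the second. -/

import Mathlib

open scoped Kronecker

namespace GradedMatrix

/-- A grading `A = ⨁ A_g` of an `F`-algebra by a group `G`: a direct sum decomposition into
subspaces such that `A_g A_h ⊆ A_{gh}`. -/
structure IsGrading {F G A : Type*} [Field F] [CommGroup G] [Ring A] [Algebra F A]
    (𝒜 : G → Submodule F A) : Prop where
  indep : iSupIndep 𝒜
  iSup_eq_top : iSup 𝒜 = ⊤
  mul_mem : ∀ g h : G, ∀ a ∈ 𝒜 g, ∀ b ∈ 𝒜 h, a * b ∈ 𝒜 (g * h)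

/-- The map `X ↦ Φ⁻¹ ᵗX Φ`. -/
noncomputable def adj {F ν : Type*} [Field F] [Fintype ν] [DecidableEq ν]
    (Φ X : Matrix ν ν F) : Matrix ν ν F :=
  Φ⁻¹ * X.transpose * Φ

/-- `X ↦ Φ⁻¹ ᵗX Φ`, with `Φ` nondegenerate, is an involution which preserves each component
of the grading `𝒜`. -/
structure IsGradedInvolution {F G ν : Type*} [Field F] [Fintype ν] [DecidableEq ν]
    (𝒜 : G → Submodule F (Matrix ν ν F)) (Φ : Matrix ν ν F) : Prop where
  isUnit : IsUnit Φ
  involutive : Function.Involutive (adj Φ)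
  graded : ∀ g : G, adj Φ '' (𝒜 g : Set (Matrix ν ν F)) = 𝒜 g

/-- The elementary grading defined by a tuple `γ`: the matrix unit `E_ij` has degree
`γ_i⁻¹ γ_j`. -/
def elementary (F : Type*) {G ι : Type*} [Field F] [CommGroup G] [DecidableEq ι]
    (γ : ι → G) (g : G) : Submodule F (Matrix ι ι F) :=
  Submodule.span F {A | ∃ i j : ι, (γ i)⁻¹ * γ j = g ∧ A = Matrix.single i j 1}

/-- The grading of the tensor product `C ⊗ D`, where `C` is the matrix algebra with the
elementary grading defined by `γ` and `D` is a matrix algebra graded by `𝒟`. The tensor product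
is realized as a matrix algebra by the Kronecker product. -/
def tensorGrading {F G ι δ : Type*} [Field F] [CommGroup G] [DecidableEq ι]
    (γ : ι → G) (𝒟 : G → Submodule F (Matrix δ δ F)) (g : G) :
    Submodule F (Matrix (ι × δ) (ι × δ) F) :=
  Submodule.span F {M | ∃ a b : G, a * b = g ∧
    ∃ A ∈ elementary F γ a, ∃ Y ∈ 𝒟 b, M = A ⊗ₖ Y}

/-- `𝒟` is a fine grading on `D = M_d(F)` whose support is the elementary abelian 2-subgroup
`T` of `G`, in a matrix realization in which every homogeneous matrix is symmetric or
skew-symmetric (as in a tensor product of `2 × 2` matrix algebras, each graded by the lines of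
`I`, `diag(-1, 1)`, the permutation matrix of the transposition, and the product of the last
two). -/
structure IsFineComponent {F G : Type*} [Field F] [CommGroup G] {d : ℕ}
    (T : Subgroup G) (𝒟 : G → Submodule F (Matrix (Fin d) (Fin d) F)) : Prop where
  isGrading : IsGrading 𝒟
  support : ∀ g : G, 𝒟 g ≠ ⊥ ↔ g ∈ T
  fine : ∀ g ∈ T, Module.finrank F (𝒟 g) = 1
  elementaryAbelian : ∀ t ∈ T, t * t = 1
  symm_or_skew : ∀ t ∈ T, ∀ Y ∈ 𝒟 t, Y.transpose = Y ∨ Y.transpose = -Y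

/-- The support of the elementary grading defined by `γ` meets `T` only in the identity. -/
def MeetsTrivially {G ι : Type*} [CommGroup G] (γ : ι → G) (T : Subgroup G) : Prop :=
  ∀ i j : ι, (γ i)⁻¹ * γ j ∈ T → (γ i)⁻¹ * γ j = 1

/-- The conjugation `X ↦ P⁻¹ X P` (where `Q = P⁻¹`) identifies the algebra `M_ν(F)` graded by
`𝒜` with the graded algebra `C ⊗ D`, where `C` has the elementary grading defined by `γ` and
`D` has the grading `𝒟`. The rows of `P` and its columns are indexed by different sets of the
same size. -/
structure IsGradedConj {F G ν ι : Type*} [Field F] [CommGroup G] [Fintype ν] [DecidableEq ν]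
    [Fintype ι] [DecidableEq ι] {d : ℕ}
    (𝒜 : G → Submodule F (Matrix ν ν F)) (γ : ι → G)
    (𝒟 : G → Submodule F (Matrix (Fin d) (Fin d) F))
    (P : Matrix ν (ι × Fin d) F) (Q : Matrix (ι × Fin d) ν F) : Prop where
  mul_eq_one : P * Q = 1
  mul_eq_one' : Q * P = 1
  mem_iff : ∀ (g : G) (X : Matrix ν ν F), X ∈ 𝒜 g ↔ Q * X * P ∈ tensorGrading γ 𝒟 g

/-- The data of a tuple
`(g_1^(p_1), …, g_l^(p_l), g'_{l+1}^(p_{l+1}), g''_{l+1}^(p_{l+1}), …, g'_k^(p_k), g''_k^(p_k))`,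
where `k = l + m`. The first `l` blocks are indexed by `Sum.inl`, the other `m` by `Sum.inr`. -/
structure BlockTuple (G : Type*) where
  l : ℕ
  m : ℕ
  p : Fin l ⊕ Fin m → ℕ
  p_pos : ∀ b, 0 < p b
  g : Fin l → G
  g' : Fin m → G
  g'' : Fin m → G

namespace BlockTuple

/-- The indices of the blocks. -/
abbrev Block {G : Type*} (B : BlockTuple G) : Type := Fin B.l ⊕ Fin B.m

/-- The matrix size of a block: `p_i` for one of the first `l`, and `2 p_j` for the others. -/
def size {G : Type*} (B : BlockTuple G) : B.Block → ℕ
  | Sum.inl i => B.p (Sum.inl i)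
  | Sum.inr j => B.p (Sum.inr j) + B.p (Sum.inr j)

/-- The positions of the tuple. -/
abbrev Index {G : Type*} (B : BlockTuple G) : Type := Σ b : B.Block, Fin (B.size b)

/-- The tuple itself. -/
def tuple {G : Type*} (B : BlockTuple G) : B.Index → G
  | ⟨Sum.inl i, _⟩ => B.g i
  | ⟨Sum.inr j, a⟩ => if a.val < B.p (Sum.inr j) then B.g' j else B.g'' j

/-- `g_i² t_i` for the first `l` blocks, `g'_j g''_j t_j` for the others. -/
def weight {G : Type*} [CommGroup G] (B : BlockTuple G) (t : B.Block → G) : B.Block → G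
  | Sum.inl i => B.g i ^ 2 * t (Sum.inl i)
  | Sum.inr j => B.g' j * B.g'' j * t (Sum.inr j)

/-- The elements `g_1, …, g_l, g'_{l+1}, …, g'_k, g''_{l+1}, …, g''_k` are pairwise distinct.
Then the identity component of the elementary grading is the direct sum of `l` algebras
`M_{p_i}(F)` and of `m` algebras `M_{p_j}(F) ⊕ M_{p_j}(F)`. -/
def Distinct {G : Type*} (B : BlockTuple G) : Prop :=
  Function.Injective (Sum.elim B.g (Sum.elim B.g' B.g''))

/-- The block matrix `S_1 ⊗ X_1 + ⋯ + S_k ⊗ X_k`, where `S_b` is placed in the `b`-th diagonal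
block. -/
def form {F G : Type*} [Field F] (B : BlockTuple G) {d : ℕ}
    (S : (b : B.Block) → Matrix (Fin (B.size b)) (Fin (B.size b)) F)
    (X : B.Block → Matrix (Fin d) (Fin d) F) :
    Matrix (B.Index × Fin d) (B.Index × Fin d) F :=
  ∑ b : B.Block, Matrix.blockDiagonal' (Pi.single b (S b)) ⊗ₖ X b

end BlockTuple

/-- `S = [[0, I], [ε I, 0]]` with four blocks of the same size. -/
def IsOffDiag {F : Type*} [Field F] (ε : F) {N : ℕ} (S : Matrix (Fin N) (Fin N) F) : Prop :=
  ∃ (h : ℕ) (e : h + h = N),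
    S = Matrix.reindex (finSumFinEquiv.trans (finCongr e)) (finSumFinEquiv.trans (finCongr e))
      (Matrix.fromBlocks 0 1 (ε • 1) 0)

/-- The conditions on the elements `t_b`, the matrices `S_b` and the matrices `X_b`: `t_b ∈ T`,
`X_b` spans `𝒟 (t_b)`, `S_b` is `I` (only if `b` is one of the first `l` blocks),
`[[0, I], [I, 0]]` or `[[0, I], [-I, 0]]`, and
`g_1² t_1 = ⋯ = g_l² t_l = g'_{l+1} g''_{l+1} t_{l+1} = ⋯ = g'_k g''_k t_k`. -/
structure IsCanonical {F G : Type*} [Field F] [CommGroup G] {d : ℕ} (T : Subgroup G)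
    (𝒟 : G → Submodule F (Matrix (Fin d) (Fin d) F)) (B : BlockTuple G) (t : B.Block → G)
    (S : (b : B.Block) → Matrix (Fin (B.size b)) (Fin (B.size b)) F)
    (X : B.Block → Matrix (Fin d) (Fin d) F) : Prop where
  t_mem : ∀ b, t b ∈ T
  span_eq : ∀ b, 𝒟 (t b) = Submodule.span F {X b}
  left_form : ∀ i : Fin B.l, S (Sum.inl i) = 1 ∨ IsOffDiag 1 (S (Sum.inl i)) ∨
    IsOffDiag (-1) (S (Sum.inl i))
  right_form : ∀ j : Fin B.m, IsOffDiag 1 (S (Sum.inr j)) ∨ IsOffDiag (-1) (S (Sum.inr j))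
  weight_eq : ∀ b b', B.weight t b = B.weight t b'

/-- `S` is symmetric (skew-symmetric) at the same time as `X`. -/
def SameSymmetry {F α β : Type*} [Field F] (S : Matrix α α F) (X : Matrix β β F) : Prop :=
  (S.transpose = S ↔ X.transpose = X) ∧ (S.transpose = -S ↔ X.transpose = -X)

/-- `S` is symmetric (skew-symmetric) if and only if `X` is skew-symmetric (symmetric). -/
def OppositeSymmetry {F α β : Type*} [Field F] (S : Matrix α α F) (X : Matrix β β F) : Prop :=
  (S.transpose = S ↔ X.transpose = -X) ∧ (S.transpose = -S ↔ X.transpose = X)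

end GradedMatrix

/-!
Let `R = M_n(F)` be graded by the finite abelian group `G`, with a graded involution
`φ(X) = Φ⁻¹ ᵗX Φ`.

**The decomposition `R ≅ C ⊗ D`.** The trace form of `M_n(F)` is nondegenerate, so every nonzero
homogeneous `x` has a homogeneous `y` for which `xy` is not nilpotent. A power of `xy` lies in the
identity component `R_e`, and a polynomial in this power is a nonzero idempotent of `R_e`. Hence a
nonzero homogeneous element of `ε R ε'`, where `ε, ε' ∈ R_e` are primitive idempotents, is
invertible with respect to `ε` and `ε'` (`IsPrimitive.exists_inverse`). No assumption on the
characteristic is needed here. Thus `D = ε R ε` is a graded division algebra, its components are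
lines because `F` is algebraically closed (`IsPrimitive.isDivisionGrading_corner`), and a
decomposition of `1` into primitive idempotents of `R_e` gives the matrix units of `C`
(`exists_isGradedConj`). The involution induces a degree-preserving antiautomorphism of `D`. It
forces the commutation factors of homogeneous elements to be signs and the support `T` to be an
elementary abelian 2-group. It is of the form `Y ↦ Ψ⁻¹ ᵗY Ψ`, where `Ψ` can be chosen symmetric, and
in a basis orthonormal for `Ψ` all homogeneous matrices are symmetric or skew-symmetric
(`IsDivisionGrading.exists_symmetric`, `exists_isFineComponent_corner`).

**The canonical form.** Give the bilinear form with matrix `E_ij ⊗ Y`, `Y ∈ D_t`, the degree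
`γ_i t γ_j`. Each homogeneous component of `Φ` satisfies the same equations `ᵗX Φ = Φ φ(X)` as `Φ`, so
it is a multiple of `Φ` (`exists_mem_blockGrading`): the form `Φ` is homogeneous, of degree `k`
say. So `Φ` pairs the position `i` only with positions `j` such that `γ_i⁻¹ k γ_j⁻¹ ∈ T`. As the
support of `C` meets `T` trivially, this determines the group element `γ_j`. The resulting involution
on the entries of the tuple gives the blocks of `Φ`: its fixed points the first `l`, its orbits of two
elements the other ones (`exists_partner`, `exists_blockTuple`, `exists_eq_form`). The equations for
the degrees say that the common value of `g_i² t_i` and `g'_j g''_j t_j` is `k`. Within a block a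
congruence from `R_e` brings a symmetric or skew-symmetric `S_i` to its normal form
(`exists_block_congruence`).

**The converse.** The equations for the degrees say that `S_1 ⊗ X_1 + ⋯ + S_k ⊗ X_k` is homogeneous
as a form. Comparing degrees in `Φ φ(X) = ᵗX Φ` shows that `φ` preserves degrees
(`isGradedInvolution_of_mem_blockGrading`).
-/

namespace GradedMatrix

/-! ### Symmetric and skew-symmetric matrices up to congruence -/

theorem card_le_of_mul_eq_smul_one {F α β : Type*} [Field F] [Fintype α] [Fintype β]
    [DecidableEq α] {A : Matrix α β F} {B : Matrix β α F} {c : F} (hc : c ≠ 0)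
    (h : A * B = c • 1) : Fintype.card α ≤ Fintype.card β := by
  have h1 : A * (c⁻¹ • B) = 1 := by
    rw [Matrix.mul_smul, h, smul_smul, inv_mul_cancel₀ hc, one_smul]
  have h2 := Matrix.rank_mul_le_left A (c⁻¹ • B)
  rw [h1, Matrix.rank_one] at h2
  exact h2.trans (Matrix.rank_le_card_width A)

theorem exists_transpose_mul_mul_eq_one {F : Type*} [Field F] [IsAlgClosed F]
    (h2 : (2 : F) ≠ 0) {N : ℕ} {S : Matrix (Fin N) (Fin N) F} (hS : IsUnit S)
    (hsymm : S.transpose = S) :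
    ∃ A : Matrix (Fin N) (Fin N) F, IsUnit A ∧ A.transpose * S * A = 1 := by
  have : Invertible (2 : F) := invertibleOfNonzero h2
  obtain ⟨v, hv⟩ := LinearMap.BilinForm.exists_orthogonal_basis (K := F) (V := Fin N → F)
    (B := Matrix.toBilin' S) (by
      refine ⟨fun x y => ?_⟩
      rw [Matrix.toBilin'_apply', Matrix.toBilin'_apply', Matrix.dotProduct_mulVec,
        ← Matrix.mulVec_transpose, hsymm, dotProduct_comm]
      rfl)
  let e : Fin (Module.finrank F (Fin N → F)) ≃ Fin N := finCongr (by simp)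
  let b := v.reindex e
  let P : Matrix (Fin N) (Fin N) F := (Pi.basisFun F (Fin N)).toMatrix b
  have hP : IsUnit P := IsUnit.of_mul_eq_one _ ((Pi.basisFun F (Fin N)).toMatrix_mul_toMatrix_flip b)
  have hPT : IsUnit P.transpose := (Matrix.isUnit_transpose P).2 hP
  have hent : ∀ i j, (P.transpose * S * P) i j = dotProduct (b i) (S.mulVec (b j)) := by
    intro i j
    rw [Matrix.mul_assoc, Matrix.mul_apply]
    rfl
  let d : Fin N → F := fun i => dotProduct (b i) (S.mulVec (b i))
  have hD : P.transpose * S * P = Matrix.diagonal d := by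
    ext i j
    rw [hent]
    rcases eq_or_ne i j with rfl | hij
    · rw [Matrix.diagonal_apply_eq]
    · rw [Matrix.diagonal_apply_ne _ hij]
      have := hv (i := e.symm i) (j := e.symm j) (by simpa using hij)
      simpa [Matrix.toBilin'_apply', b] using this
  have hDu : IsUnit (Matrix.diagonal d) := hD ▸ (hPT.mul hS).mul hP
  have hd : ∀ i, d i ≠ 0 := fun i => (Pi.isUnit_iff.1 (Matrix.isUnit_diagonal.1 hDu) i).ne_zero
  choose c hc using fun i => IsAlgClosed.exists_eq_mul_self (d i)
  have hc0 : ∀ i, c i ≠ 0 := fun i h => hd i (by rw [hc, h, mul_zero])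
  refine ⟨P * Matrix.diagonal fun i => (c i)⁻¹, hP.mul ?_, ?_⟩
  · exact Matrix.isUnit_diagonal.2 (Pi.isUnit_iff.2 fun i => (inv_ne_zero (hc0 i)).isUnit)
  · rw [Matrix.transpose_mul, Matrix.diagonal_transpose]
    calc _ = Matrix.diagonal (fun i => (c i)⁻¹) * (P.transpose * S * P) *
          Matrix.diagonal (fun i => (c i)⁻¹) := by simp only [Matrix.mul_assoc]
      _ = 1 := by
        rw [hD, Matrix.diagonal_mul_diagonal, Matrix.diagonal_mul_diagonal,
          ← Matrix.diagonal_one]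
        congr 1
        funext i
        rw [hc i]
        field_simp [hc0 i]

theorem bilin_swap {F : Type*} [Field F] {ν : Type*} [Fintype ν] {S : Matrix ν ν F}
    (hskew : S.transpose = -S) (v w : ν → F) :
    dotProduct w (S.mulVec v) = - dotProduct v (S.mulVec w) := by
  rw [Matrix.dotProduct_mulVec, ← Matrix.mulVec_transpose, hskew, Matrix.neg_mulVec,
    neg_dotProduct, dotProduct_comm]

/-- A family of `h` mutually orthogonal hyperbolic pairs for the form with matrix `S`. -/
structure IsHyperbolic {F ν : Type*} [Field F] [Fintype ν] (S : Matrix ν ν F) {h : ℕ}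
    (x y : Fin h → ν → F) : Prop where
  xx : ∀ i j, dotProduct (x i) (S.mulVec (x j)) = 0
  yy : ∀ i j, dotProduct (y i) (S.mulVec (y j)) = 0
  xy : ∀ i j, dotProduct (x i) (S.mulVec (y j)) = if i = j then 1 else 0

theorem IsHyperbolic.cons {F ν : Type*} [Field F] [Fintype ν]
    (h2 : (2 : F) ≠ 0) {S : Matrix ν ν F}
    (hskew : S.transpose = -S) {h : ℕ} {x y : Fin h → ν → F} (H : IsHyperbolic S x y)
    {v w : ν → F} (hvx : ∀ i, dotProduct v (S.mulVec (x i)) = 0)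
    (hvy : ∀ i, dotProduct v (S.mulVec (y i)) = 0)
    (hwx : ∀ i, dotProduct w (S.mulVec (x i)) = 0)
    (hwy : ∀ i, dotProduct w (S.mulVec (y i)) = 0)
    (hvw : dotProduct v (S.mulVec w) = 1) :
    IsHyperbolic S (Fin.cons v x : Fin (h + 1) → ν → F) (Fin.cons w y : Fin (h + 1) → ν → F) := by
  have hself : ∀ u : ν → F, dotProduct u (S.mulVec u) = 0 := fun u => by
    have := bilin_swap hskew u u
    have : (2 : F) * dotProduct u (S.mulVec u) = 0 := by linear_combination this
    exact (mul_eq_zero.1 this).resolve_left h2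
  refine ⟨fun i j => ?_, fun i j => ?_, fun i j => ?_⟩ <;>
  refine Fin.cases ?_ (fun i => ?_) i <;> refine Fin.cases ?_ (fun j => ?_) j <;>
  simp only [Fin.cons_zero, Fin.cons_succ, hself, H.xx, H.yy, H.xy, hvx, hvy, hvw,
    bilin_swap hskew v, bilin_swap hskew w, hwx, hwy, neg_zero, if_true, Fin.succ_inj,
    (Fin.succ_ne_zero _).symm, Fin.succ_ne_zero, if_false]

theorem IsHyperbolic.le {F ν : Type*} [Field F] [Fintype ν] {S : Matrix ν ν F} {h : ℕ}
    {x y : Fin h → ν → F} (H : IsHyperbolic S x y) : h ≤ Fintype.card ν := by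
  classical
  have := card_le_of_mul_eq_smul_one (F := F) (α := Fin h) (β := ν) (A := Matrix.of x)
    (B := S * (Matrix.of y).transpose) (c := 1) one_ne_zero (by
      ext i j
      rw [one_smul, Matrix.one_apply, ← H.xy i j]
      rfl)
  simpa using this

/-- A nondegenerate alternating form has a symplectic basis: a vector orthogonal to a maximal family
of hyperbolic pairs could be completed to a further pair. -/
theorem exists_transpose_mul_mul_isOffDiag {F : Type*} [Field F] (h2 : (2 : F) ≠ 0) {N : ℕ}
    {S : Matrix (Fin N) (Fin N) F} (hS : IsUnit S) (hskew : S.transpose = -S) :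
    ∃ A : Matrix (Fin N) (Fin N) F, IsUnit A ∧ IsOffDiag (-1) (A.transpose * S * A) := by
  classical
  let p : ℕ → Prop := fun h => ∃ x y : Fin h → Fin N → F, IsHyperbolic S x y
  have hp0 : p 0 := ⟨Fin.elim0, Fin.elim0, fun i => i.elim0, fun i => i.elim0, fun i => i.elim0⟩
  obtain ⟨x, y, H⟩ : p (Nat.findGreatest p N) := Nat.findGreatest_spec (Nat.zero_le _) hp0
  have hmax : ¬ p (Nat.findGreatest p N + 1) := fun hp => by
    have hle : Nat.findGreatest p N + 1 ≤ N := by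
      obtain ⟨x, y, H⟩ := hp
      simpa using H.le
    exact absurd (Nat.le_findGreatest hle hp) (by omega)
  generalize Nat.findGreatest p N = h at x y H hmax
  have hyx : ∀ i j, dotProduct (y i) (S.mulVec (x j)) = if i = j then -1 else 0 := by
    intro i j
    rw [bilin_swap hskew, H.xy]
    by_cases hij : i = j
    · simp [hij]
    · simp [hij, Ne.symm hij]
  -- the orthogonal projection away from the span of the pairs
  let π : (Fin N → F) → Fin N → F := fun w =>
    w - ∑ i, dotProduct w (S.mulVec (y i)) • x i + ∑ i, dotProduct w (S.mulVec (x i)) • y i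
  have hπx : ∀ w j, dotProduct (π w) (S.mulVec (x j)) = 0 := by
    intro w j
    simp only [π, add_dotProduct, sub_dotProduct, sum_dotProduct, smul_dotProduct, H.xx, hyx,
      smul_eq_mul, mul_zero, Finset.sum_const_zero, sub_zero, mul_ite, mul_neg, mul_one,
      Finset.sum_ite_eq', Finset.mem_univ, if_true]
    ring
  have hπy : ∀ w j, dotProduct (π w) (S.mulVec (y j)) = 0 := by
    intro w j
    simp only [π, add_dotProduct, sub_dotProduct, sum_dotProduct, smul_dotProduct, H.yy, H.xy,
      smul_eq_mul, mul_zero, Finset.sum_const_zero, add_zero, mul_ite, mul_one,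
      Finset.sum_ite_eq', Finset.mem_univ, if_true]
    ring
  have hperp : ∀ v, (∀ i, dotProduct v (S.mulVec (x i)) = 0) →
      (∀ i, dotProduct v (S.mulVec (y i)) = 0) → v = 0 := by
    intro v hvx hvy
    by_contra hv
    obtain ⟨w, hw⟩ : ∃ w, dotProduct v (S.mulVec w) ≠ 0 := by
      by_contra hcon
      push Not at hcon
      apply hv
      refine dotProduct_eq_zero v fun u => ?_
      have := hcon (S⁻¹.mulVec u)
      rwa [Matrix.mulVec_mulVec, Matrix.mul_nonsing_inv _ ((Matrix.isUnit_iff_isUnit_det S).1 hS),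
        Matrix.one_mulVec] at this
    refine hmax ⟨_, _, H.cons h2 hskew (v := v)
      (w := (dotProduct v (S.mulVec w))⁻¹ • π w) hvx hvy (fun i => ?_) (fun i => ?_) ?_⟩
    · rw [smul_dotProduct, hπx, smul_zero]
    · rw [smul_dotProduct, hπy, smul_zero]
    · have h1 : dotProduct v (S.mulVec (π w)) = dotProduct v (S.mulVec w) := by
        have hxv : ∀ i, dotProduct (x i) (S.mulVec v) = 0 := fun i => by
          rw [bilin_swap hskew, hvx, neg_zero]
        have hyv : ∀ i, dotProduct (y i) (S.mulVec v) = 0 := fun i => by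
          rw [bilin_swap hskew, hvy, neg_zero]
        rw [bilin_swap hskew (π w) v, bilin_swap hskew w v]
        simp only [π, add_dotProduct, sub_dotProduct, sum_dotProduct, smul_dotProduct, hxv, hyv,
          smul_zero, Finset.sum_const_zero, sub_zero, add_zero]
      rw [Matrix.mulVec_smul, dotProduct_smul, h1, smul_eq_mul, inv_mul_cancel₀ hw]
  let P : Matrix (Fin N) (Fin h ⊕ Fin h) F := (Matrix.of (Sum.elim x y)).transpose
  have hPSP : P.transpose * S * P = Matrix.fromBlocks 0 1 ((-1 : F) • 1) 0 := by
    have hent : ∀ i j, (P.transpose * S * P) i j =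
        dotProduct (Sum.elim x y i) (S.mulVec (Sum.elim x y j)) := by
      intro i j
      rw [Matrix.mul_assoc, Matrix.mul_apply]
      rfl
    ext (i | i) (j | j) <;> rw [hent]
    · simpa using H.xx i j
    · simpa [Matrix.one_apply] using H.xy i j
    · rw [Sum.elim_inr, Sum.elim_inl, hyx]
      simp only [Matrix.fromBlocks_apply₂₁, Matrix.smul_apply, Matrix.one_apply, smul_eq_mul]
      split_ifs <;> simp
    · simpa using H.yy i j
  let J : Matrix (Fin h ⊕ Fin h) (Fin h ⊕ Fin h) F := Matrix.fromBlocks 0 ((-1 : F) • 1) 1 0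
  have hJJ : Matrix.fromBlocks 0 1 ((-1 : F) • 1) 0 * J = 1 := by
    simp [J, Matrix.fromBlocks_multiply]
  have hinj : h + h ≤ N := by
    have := card_le_of_mul_eq_smul_one (F := F) (A := P.transpose * S)
      (B := P * J) (c := 1) one_ne_zero (by
        rw [← Matrix.mul_assoc, hPSP, hJJ, one_smul])
    simpa using this
  have hsurj : P * (J * (P.transpose * S)) = 1 := by
    refine Matrix.mulVec_injective (funext fun w => ?_)
    have hw : π w = 0 := hperp _ (hπx w) (hπy w)
    have hPS : (P.transpose * S).mulVec w =
        Sum.elim (fun i => dotProduct (x i) (S.mulVec w)) fun i =>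
          dotProduct (y i) (S.mulVec w) := by
      rw [← Matrix.mulVec_mulVec]
      ext (i | i) <;> rfl
    have hPm : ∀ a b : Fin h → F, P.mulVec (Sum.elim a b) =
        ∑ i, a i • x i + ∑ i, b i • y i := by
      intro a b
      ext k
      simp only [Matrix.mulVec, dotProduct, Fintype.sum_sum_type, P, Matrix.transpose_apply,
        Matrix.of_apply, Sum.elim_inl, Sum.elim_inr, Pi.add_apply, Finset.sum_apply,
        Pi.smul_apply, smul_eq_mul, mul_comm]
    rw [← Matrix.mulVec_mulVec, ← Matrix.mulVec_mulVec, hPS, Matrix.fromBlocks_mulVec,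
      Matrix.one_mulVec, hPm]
    simp only [Sum.elim_comp_inl, Sum.elim_comp_inr, Matrix.zero_mulVec, zero_add, add_zero,
      Matrix.smul_mulVec, Matrix.one_mulVec]
    rw [← sub_eq_zero, ← neg_eq_zero, ← hw]
    simp only [π, bilin_swap hskew w, Pi.smul_apply, smul_eq_mul, neg_mul, one_mul, neg_smul,
      Finset.sum_neg_distrib]
    abel
  have hN : h + h = N := le_antisymm hinj (by
    have := card_le_of_mul_eq_smul_one (F := F) (c := 1) one_ne_zero
      (hsurj.trans (one_smul F _).symm)
    simpa using this)
  let e : Fin h ⊕ Fin h ≃ Fin N := finSumFinEquiv.trans (finCongr hN)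
  refine ⟨P.submatrix id e.symm, ?_, h, hN, ?_⟩
  · refine IsUnit.of_mul_eq_one (Matrix.submatrix
      (J * (P.transpose * S)) e.symm id) ?_
    rw [Matrix.submatrix_mul_equiv, hsurj, Matrix.submatrix_id_id]
  · rw [← hPSP, Matrix.reindex_apply]
    rfl

/-! ### Homogeneous components -/

section Grading

variable {F G A : Type*} [Field F] [CommGroup G] [Ring A] [Algebra F A] {𝒜 : G → Submodule F A}

theorem isGrading_of_unique_decomposition [Fintype G]
    (hsum : ∀ x : A, ∃ f : G → A, (∀ g, f g ∈ 𝒜 g) ∧ ∑ g, f g = x)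
    (hzero : ∀ f : G → A, (∀ g, f g ∈ 𝒜 g) → ∑ g, f g = 0 → ∀ g, f g = 0)
    (hmul : ∀ g h : G, ∀ a ∈ 𝒜 g, ∀ b ∈ 𝒜 h, a * b ∈ 𝒜 (g * h)) : IsGrading 𝒜 where
  indep := by
    classical
    rw [iSupIndep_iff_finsetSum_eq_zero_imp_eq_zero]
    intro s v hv hv0 i hi
    have := hzero (fun g => if g ∈ s then v g else 0) (fun g => ?_) ?_ i
    · simpa [hi] using this
    · split_ifs with hg
      · exact hv g hg
      · exact Submodule.zero_mem _
    · simpa [Finset.sum_ite_mem] using hv0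
  iSup_eq_top := by
    rw [eq_top_iff]
    rintro x -
    obtain ⟨f, hf, rfl⟩ := hsum x
    exact Submodule.sum_mem _ fun g _ => Submodule.mem_iSup_of_mem g (hf g)
  mul_mem := hmul

theorem IsGrading.exists_sum_eq [Fintype G] (h : IsGrading 𝒜) (x : A) :
    ∃ f : G → A, (∀ g, f g ∈ 𝒜 g) ∧ ∑ g, f g = x := by
  have hx : x ∈ iSup 𝒜 := h.iSup_eq_top ▸ Submodule.mem_top
  obtain ⟨f, hf, hfx⟩ := (Submodule.mem_iSup_iff_exists_finsupp _ _).1 hx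
  rw [Finsupp.sum_fintype _ _ fun _ => rfl] at hfx
  exact ⟨f, hf, hfx⟩

theorem IsGrading.eq_zero_of_sum_eq_zero [Fintype G] (h : IsGrading 𝒜) {f : G → A}
    (hf : ∀ g, f g ∈ 𝒜 g) (hsum : ∑ g, f g = 0) (g : G) : f g = 0 := by
  exact (iSupIndep_iff_finsetSum_eq_zero_imp_eq_zero 𝒜).1 h.indep Finset.univ f (fun g _ => hf g)
    hsum g (Finset.mem_univ g)

omit [CommGroup G] in
theorem apply_eq_zero_of_sum_mem {M : Type*} [AddCommGroup M] [Module F M] {ℳ : G → Submodule F M}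
    [Fintype G] (hzero : ∀ f : G → M, (∀ g, f g ∈ ℳ g) → ∑ g, f g = 0 → ∀ g, f g = 0) {f : G → M}
    (hf : ∀ g, f g ∈ ℳ g) {k : G} (hsum : ∑ g, f g ∈ ℳ k) {g : G} (hg : g ≠ k) : f g = 0 := by
  classical
  have := hzero (f - Pi.single k (∑ g, f g)) (fun g => ?_) ?_ g
  · simpa [hg] using this
  · rw [Pi.sub_apply]
    refine Submodule.sub_mem _ (hf g) ?_
    rcases eq_or_ne g k with rfl | hgk
    · simpa using hsum
    · simp [hgk]
  · simp

theorem IsGrading.apply_eq_zero_of_sum_mem [Fintype G] (h : IsGrading 𝒜) {f : G → A}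
    (hf : ∀ g, f g ∈ 𝒜 g) {k : G} (hsum : ∑ g, f g ∈ 𝒜 k) {g : G} (hg : g ≠ k) : f g = 0 :=
  GradedMatrix.apply_eq_zero_of_sum_mem (fun _ hf => h.eq_zero_of_sum_eq_zero hf) hf hsum hg

theorem IsGrading.eq_of_mem_of_mem [Fintype G] (h : IsGrading 𝒜) {x : A} {g k : G} (hg : x ∈ 𝒜 g)
    (hk : x ∈ 𝒜 k) (hx : x ≠ 0) : g = k := by
  classical
  by_contra hgk
  apply hx
  have := h.apply_eq_zero_of_sum_mem (f := Pi.single g x) (k := k) (fun k' => ?_) ?_ hgk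
  · simpa using this
  · rcases eq_or_ne k' g with rfl | hk'
    · simpa using hg
    · simp [hk']
  · simpa using hk

theorem IsGrading.one_mem [Fintype G] (h : IsGrading 𝒜) : (1 : A) ∈ 𝒜 1 := by
  classical
  obtain ⟨f, hf, hsum⟩ := h.exists_sum_eq 1
  -- the identity component `f 1` of `1` is a left identity on homogeneous elements
  have hleft : ∀ k, ∀ x ∈ 𝒜 k, f 1 * x = x := by
    intro k x hx
    have hsum' : ∑ g, f (g * k⁻¹) * x = x := by
      rw [← Finset.sum_mul, Fintype.sum_equiv (Equiv.mulRight k⁻¹) (fun g => f (g * k⁻¹)) f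
        fun g => rfl, hsum, one_mul]
    have hmem : ∀ g, f (g * k⁻¹) * x ∈ 𝒜 g := fun g => by
      simpa using h.mul_mem _ _ _ (hf (g * k⁻¹)) _ hx
    have hz := fun g => h.apply_eq_zero_of_sum_mem hmem (k := k) (g := g) (by rwa [hsum'])
    rw [Finset.sum_eq_single k (fun g _ hg => hz g hg) (by simp)] at hsum'
    simpa using hsum'
  obtain ⟨f', hf', hsum'⟩ := h.exists_sum_eq 1
  have : f 1 * 1 = 1 := by
    rw [← hsum', Finset.mul_sum]
    exact Finset.sum_congr rfl fun g _ => hleft g _ (hf' g)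
  rw [← this, mul_one]
  exact hf 1

theorem IsGrading.pow_mem [Fintype G] (h : IsGrading 𝒜) {x : A} {g : G} (hx : x ∈ 𝒜 g) (n : ℕ) :
    x ^ n ∈ 𝒜 (g ^ n) := by
  induction n with
  | zero => simpa using h.one_mem
  | succ n ih => rw [pow_succ, pow_succ]; exact h.mul_mem _ _ _ ih _ hx

theorem IsGrading.aeval_mem [Fintype G] (h : IsGrading 𝒜) {x : A} (hx : x ∈ 𝒜 1)
    (p : Polynomial F) : Polynomial.aeval x p ∈ 𝒜 1 := by
  rw [Polynomial.aeval_eq_sum_range]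
  exact Submodule.sum_mem _ fun i _ => Submodule.smul_mem _ _ (by simpa using h.pow_mem hx i)

theorem IsGrading.linearMap_eq_zero {M : Type*} [AddCommGroup M] [Module F M]
    (h : IsGrading 𝒜) (f : A →ₗ[F] M) (hf : ∀ g, ∀ x ∈ 𝒜 g, f x = 0) : f = 0 := by
  rw [← LinearMap.ker_eq_top, eq_top_iff, ← h.iSup_eq_top]
  exact iSup_le fun g x hx => hf g x hx

end Grading

/-! ### Primitive idempotents of the identity component -/

section Primitive

/-- Some polynomial multiple `z q(z)` of a matrix that is not nilpotent is a nonzero idempotent: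
the projection onto the sum of the generalized eigenspaces for the nonzero eigenvalues. -/
theorem exists_polynomial_idempotent {F ν : Type*} [Field F] [Fintype ν] [DecidableEq ν]
    {z : Matrix ν ν F} (hz : ¬ IsNilpotent z) : ∃ q : Polynomial F,
      (z * Polynomial.aeval z q) * (z * Polynomial.aeval z q) = z * Polynomial.aeval z q ∧
        z * Polynomial.aeval z q ≠ 0 := by
  obtain ⟨p, hp, hpd⟩ := Polynomial.exists_eq_pow_rootMultiplicity_mul_and_not_dvd z.charpoly
    z.charpoly_monic.ne_zero 0
  set k := Polynomial.rootMultiplicity 0 z.charpoly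
  rw [Polynomial.C_0, sub_zero] at hp hpd
  -- the exponent `k + 1` makes the idempotent a multiple of `z` also when `k = 0`
  obtain ⟨a, b, hab⟩ : IsCoprime ((Polynomial.X : Polynomial F) ^ (k + 1)) p :=
    ((Polynomial.irreducible_X.coprime_iff_not_dvd).2 hpd).pow_left
  set φ := Polynomial.aeval (R := F) z
  have hkill : φ (Polynomial.X ^ k * p) = 0 := hp ▸ z.aeval_self_charpoly
  have hf : z * φ (a * Polynomial.X ^ k) = φ (a * Polynomial.X ^ (k + 1)) := by
    rw [pow_succ, ← mul_assoc, mul_comm _ Polynomial.X, map_mul φ Polynomial.X,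
      Polynomial.aeval_X]
  refine ⟨a * Polynomial.X ^ k, ?_, ?_⟩
  · rw [hf, ← sub_eq_zero, ← map_mul, ← map_sub]
    have : a * Polynomial.X ^ (k + 1) * (a * Polynomial.X ^ (k + 1)) - a * Polynomial.X ^ (k + 1) =
        -(a * b * Polynomial.X) * (Polynomial.X ^ k * p) := by
      linear_combination (a * Polynomial.X ^ (k + 1)) * hab
    calc _ = φ (-(a * b * Polynomial.X) * (Polynomial.X ^ k * p)) := congrArg φ this
      _ = 0 := by rw [map_mul, hkill, mul_zero]
  · intro h0
    refine hz ⟨k, ?_⟩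
    rw [hf] at h0
    have : (Polynomial.X : Polynomial F) ^ k =
        Polynomial.X ^ k * (a * Polynomial.X ^ (k + 1)) + b * (Polynomial.X ^ k * p) := by
      linear_combination (-Polynomial.X ^ k) * hab
    calc z ^ k = φ (Polynomial.X ^ k) := by rw [map_pow, Polynomial.aeval_X]
      _ = φ (Polynomial.X ^ k * (a * Polynomial.X ^ (k + 1)) +
          b * (Polynomial.X ^ k * p)) := congrArg φ this
      _ = 0 := by rw [map_add, map_mul, map_mul φ b, h0, hkill, mul_zero, mul_zero, add_zero]

theorem rank_lt_of_idempotent {F ν : Type*} [Field F] [Fintype ν] {ε f : Matrix ν ν F}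
    (hf: f * f = f) (hl : ε * f = f)
    (hr : f * ε = f) (hne : f ≠ ε) : f.rank < ε.rank := by
  have hle : LinearMap.range f.mulVecLin ≤ LinearMap.range ε.mulVecLin := by
    rw [← hl, Matrix.mulVecLin_mul]
    exact LinearMap.range_comp_le_range _ _
  refine lt_of_le_of_ne (Submodule.finrank_mono hle) fun heq => hne ?_
  have hrange := Submodule.eq_of_le_of_finrank_eq hle heq
  rw [← hr]
  refine Matrix.mulVec_injective (funext fun v => ?_)
  obtain ⟨w, hw⟩ : ε.mulVecLin v ∈ LinearMap.range f.mulVecLin := hrange ▸ ⟨v, rfl⟩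
  simp only [Matrix.mulVecLin_apply] at hw
  rw [← Matrix.mulVec_mulVec, ← hw, Matrix.mulVec_mulVec, hf]

variable {F G ν : Type*} [Field F] [CommGroup G] [Fintype ν] [DecidableEq ν]
  {𝒜 : G → Submodule F (Matrix ν ν F)}

/-- `ε` is a primitive idempotent of the identity component of the grading `𝒜`. -/
structure IsPrimitive (𝒜 : G → Submodule F (Matrix ν ν F)) (ε : Matrix ν ν F) : Prop where
  mem : ε ∈ 𝒜 1
  mul_self : ε * ε = ε
  ne_zero : ε ≠ 0
  eq_zero_or_eq : ∀ f ∈ 𝒜 1, f * f = f → ε * f = f → f * ε = f → f = 0 ∨ f = ε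

theorem exists_homogeneous_trace_mul_ne_zero (h : IsGrading 𝒜) {x : Matrix ν ν F} (hx : x ≠ 0) :
    ∃ g, ∃ y ∈ 𝒜 g, Matrix.trace (x * y) ≠ 0 := by
  by_contra! hcon
  have h0 := h.linearMap_eq_zero ((Matrix.traceLinearMap ν F F).comp (LinearMap.mulLeft F x))
    fun g y hy => hcon g y hy
  apply hx
  ext i j
  have := LinearMap.congr_fun h0 (Matrix.single j i 1)
  simpa [Matrix.trace_mul_single] using this

/-- A matrix algebra is prime, also with respect to homogeneous factors. -/
theorem exists_homogeneous_mul_mul_ne_zero (h : IsGrading 𝒜) {x y : Matrix ν ν F} (hx : x ≠ 0)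
    (hy : y ≠ 0) : ∃ g, ∃ r ∈ 𝒜 g, x * r * y ≠ 0 := by
  by_contra! hcon
  have h0 := h.linearMap_eq_zero ((LinearMap.mulRight F y).comp (LinearMap.mulLeft F x))
    fun g r hr => hcon g r hr
  obtain ⟨i, j, hij⟩ : ∃ i j, x i j ≠ 0 := by
    by_contra! hc
    exact hx (Matrix.ext hc)
  obtain ⟨k, l, hkl⟩ : ∃ i j, y i j ≠ 0 := by
    by_contra! hc
    exact hy (Matrix.ext hc)
  have := congrFun (congrFun (LinearMap.congr_fun h0 (Matrix.single j k 1)) i) l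
  simp [Matrix.mul_apply, Matrix.single_apply, ite_and] at this
  tauto

/-- A nonzero homogeneous element of a Peirce component `ε R ε'` with `ε` primitive has a
homogeneous right inverse in `ε' R ε`. -/
theorem IsPrimitive.exists_right_inverse [Fintype G] (h : IsGrading 𝒜) {ε ε' : Matrix ν ν F}
    (hε : IsPrimitive 𝒜 ε) (hmem : ε' ∈ 𝒜 1) (hid : ε' * ε' = ε') {g : G} {x : Matrix ν ν F}
    (hx : x ∈ 𝒜 g) (hx0 : x ≠ 0) (hl : ε * x = x) (hr : x * ε' = x) :
    ∃ y ∈ 𝒜 g⁻¹, ε' * y = y ∧ y * ε = y ∧ x * y = ε := by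
  obtain ⟨k, y, hy, hxy⟩ := exists_homogeneous_trace_mul_ne_zero h hx0
  have hnil : ¬ IsNilpotent (x * y) := fun hn =>
    hxy (Matrix.isNilpotent_trace_of_isNilpotent hn).eq_zero
  have hz := h.pow_mem (h.mul_mem _ _ _ hx _ hy) (Fintype.card G)
  rw [pow_card_eq_one] at hz
  have hnil' : ¬ IsNilpotent ((x * y) ^ Fintype.card G) := fun hn =>
    hnil (IsNilpotent.of_pow hn)
  obtain ⟨q, hff, hf0⟩ := exists_polynomial_idempotent hnil'
  set q' := Polynomial.aeval ((x * y) ^ Fintype.card G) q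
  have hq' : q' ∈ 𝒜 1 := h.aeval_mem hz q
  obtain ⟨N, hN⟩ : ∃ N, Fintype.card G = N + 1 :=
    Nat.exists_eq_succ_of_ne_zero Fintype.card_ne_zero
  have hdeg : k * (g * k) ^ N = g⁻¹ := by
    have : (g * k) ^ (N + 1) = 1 := hN ▸ pow_card_eq_one
    rw [pow_succ'] at this
    rw [eq_inv_iff_mul_eq_one, ← this]
    ac_rfl
  set f := (x * y) ^ Fintype.card G * q'
  -- `f = x y₁` with `y₁` homogeneous of degree `g⁻¹`
  set y₁ := y * (x * y) ^ N * q'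
  have hf : f = x * y₁ := by
    simp only [f, y₁, hN, pow_succ']
    noncomm_ring
  have hy₁ : y₁ ∈ 𝒜 g⁻¹ := by
    have := h.mul_mem _ _ _ (h.mul_mem _ _ _ hy _ (h.pow_mem (h.mul_mem _ _ _ hx _ hy) N)) _ hq'
    rwa [mul_one, hdeg] at this
  have hεf : ε * f = f := by rw [hf, ← mul_assoc, hl]
  refine ⟨ε' * y₁ * ε, ?_, ?_, ?_, ?_⟩
  · simpa using h.mul_mem _ _ _ (h.mul_mem _ _ _ hmem _ hy₁) _ hε.mem
  · rw [← mul_assoc, ← mul_assoc, hid]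
  · rw [mul_assoc, hε.mul_self]
  have hxy₁ : x * (ε' * y₁ * ε) = f * ε := by rw [← mul_assoc, ← mul_assoc, hr, hf]
  rw [hxy₁]
  refine (hε.eq_zero_or_eq (f * ε) ?_ ?_ ?_ ?_).resolve_left ?_
  · have := h.mul_mem _ _ _ (h.mul_mem _ _ _ hz _ hq') _ hε.mem
    simpa using this
  · rw [mul_assoc, ← mul_assoc ε, hεf, ← mul_assoc, hff]
  · rw [← mul_assoc, hεf]
  · rw [mul_assoc, hε.mul_self]
  · intro h0
    apply hf0
    rw [← hff]
    calc f * f = f * (ε * f) := by rw [hεf]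
      _ = 0 := by rw [← mul_assoc, h0, zero_mul]

theorem IsPrimitive.exists_inverse [Fintype G] (h : IsGrading 𝒜) {ε ε' : Matrix ν ν F}
    (hε : IsPrimitive 𝒜 ε) (hε' : IsPrimitive 𝒜 ε') {g : G} {x : Matrix ν ν F}
    (hx : x ∈ 𝒜 g) (hx0 : x ≠ 0) (hl : ε * x = x) (hr : x * ε' = x) :
    ∃ y ∈ 𝒜 g⁻¹, ε' * y = y ∧ y * ε = y ∧ x * y = ε ∧ y * x = ε' := by
  obtain ⟨y, hy, hyl, hyr, hxy⟩ := hε.exists_right_inverse h hε'.mem hε'.mul_self hx hx0 hl hr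
  refine ⟨y, hy, hyl, hyr, hxy, ?_⟩
  refine (hε'.eq_zero_or_eq (y * x) ?_ ?_ ?_ ?_).resolve_left ?_
  · simpa using h.mul_mem _ _ _ hy _ hx
  · rw [mul_assoc, ← mul_assoc x, hxy, hl]
  · rw [← mul_assoc, hyl]
  · rw [mul_assoc, hr]
  · intro h0
    apply hx0
    rw [← hl, ← hxy, mul_assoc, h0, mul_zero]

theorem IsPrimitive.exists_homogeneous (h : IsGrading 𝒜) {ε ε' : Matrix ν ν F}
    (hε : IsPrimitive 𝒜 ε) (hε' : IsPrimitive 𝒜 ε') :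
    ∃ g, ∃ x ∈ 𝒜 g, x ≠ 0 ∧ ε * x = x ∧ x * ε' = x := by
  obtain ⟨g, r, hr, hr0⟩ := exists_homogeneous_mul_mul_ne_zero h hε.ne_zero hε'.ne_zero
  refine ⟨g, ε * r * ε', ?_, hr0, ?_, ?_⟩
  · simpa using h.mul_mem _ _ _ (h.mul_mem _ _ _ hε.mem _ hr) _ hε'.mem
  · rw [← mul_assoc, ← mul_assoc, hε.mul_self]
  · rw [mul_assoc, hε'.mul_self]

/-- An idempotent of the identity component is a sum of orthogonal primitive ones, by induction on the
rank. -/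
theorem exists_sum_primitive (𝒜 : G → Submodule F (Matrix ν ν F)) (ε : Matrix ν ν F) (hmem : ε ∈ 𝒜 1)
    (hid : ε * ε = ε) : ∃ s : Finset (Matrix ν ν F), (∀ e ∈ s, IsPrimitive 𝒜 e) ∧
      (∀ e ∈ s, ∀ e' ∈ s, e ≠ e' → e * e' = 0) ∧ ∑ e ∈ s, e = ε ∧
      ∀ e ∈ s, ε * e = e ∧ e * ε = e := by
  classical
  induction hn : ε.rank using Nat.strong_induction_on generalizing ε with
  | _ n ih =>
  by_cases h0 : ε = 0
  · exact ⟨∅, by simp, by simp, by simp [h0], by simp⟩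
  by_cases hp : IsPrimitive 𝒜 ε
  · exact ⟨{ε}, by simpa using hp, by simp, by simp, by simpa using hid⟩
  obtain ⟨f, hf, hff, hl, hr, hf0, hfε⟩ : ∃ f ∈ 𝒜 1, f * f = f ∧ ε * f = f ∧ f * ε = f ∧
      f ≠ 0 ∧ f ≠ ε := by
    by_contra! hcon
    refine hp ⟨hmem, hid, h0, fun f hf hff hl hr => ?_⟩
    by_contra! h'
    exact h'.2 (hcon f hf hff hl hr h'.1)
  have hff' : (ε - f) * (ε - f) = ε - f := by
    rw [mul_sub, sub_mul, sub_mul, hid, hl, hr, hff]; abel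
  have hl' : ε * (ε - f) = ε - f := by rw [mul_sub, hid, hl]
  have hr' : (ε - f) * ε = ε - f := by rw [sub_mul, hid, hr]
  have hne' : ε - f ≠ ε := by simpa using hf0
  obtain ⟨s, hs, hso, hss, hsl⟩ := ih _ (hn ▸ rank_lt_of_idempotent hff hl hr hfε) f hf hff rfl
  obtain ⟨t, ht, hto, hts, htl⟩ := ih _ (hn ▸ rank_lt_of_idempotent hff' hl' hr' hne') (ε - f)
    (Submodule.sub_mem _ hmem hf) hff' rfl
  have hst : ∀ e ∈ s, ∀ e' ∈ t, e * e' = 0 ∧ e' * e = 0 := by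
    intro e he e' he'
    constructor
    · rw [← (hsl e he).2, ← (htl e' he').1, mul_assoc, ← mul_assoc f, mul_sub, hr, hff, sub_self,
        zero_mul, mul_zero]
    · rw [← (hsl e he).1, ← (htl e' he').2, mul_assoc, ← mul_assoc (ε - f), sub_mul, hl, hff,
        sub_self, zero_mul, mul_zero]
  have hdisj : Disjoint s t := by
    rw [Finset.disjoint_left]
    intro e he he'
    exact (hs e he).ne_zero ((hs e he).mul_self ▸ (hst e he e he').1)
  refine ⟨s ∪ t, ?_, ?_, ?_, ?_⟩
  · intro e he
    exact (Finset.mem_union.1 he).elim (hs e) (ht e)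
  · intro e he e' he' hne
    rcases Finset.mem_union.1 he with he | he <;> rcases Finset.mem_union.1 he' with he' | he'
    · exact hso e he e' he' hne
    · exact (hst e he e' he').1
    · exact (hst e' he' e he).2
    · exact hto e he e' he' hne
  · rw [Finset.sum_union hdisj, hss, hts, add_sub_cancel]
  · intro e he
    rcases Finset.mem_union.1 he with he | he
    · obtain ⟨h1, h2⟩ := hsl e he
      constructor
      · rw [← h1, ← mul_assoc, hl]
      · rw [← h2, mul_assoc, hr]
    · obtain ⟨h1, h2⟩ := htl e he
      constructor
      · rw [← h1, ← mul_assoc, hl']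
      · rw [← h2, mul_assoc, hr']

end Primitive

/-! ### Graded division algebras -/

theorem exists_eq_smul_one_of_commute {F ν : Type*} [Field F] [Fintype ν] [DecidableEq ν]
    {M : Matrix ν ν F} (h : ∀ X : Matrix ν ν F, X * M = M * X) : ∃ c : F, M = c • 1 := by
  obtain ⟨c, hc⟩ := Matrix.mem_range_scalar_of_commute_single (M := M) fun i j _ => h _
  exact ⟨c, by rw [← hc, Matrix.scalar_apply, Matrix.smul_one_eq_diagonal]⟩

/-- If `Ψ⁻¹ ᵗΨ` is central, it is a scalar `c` with `c² = 1`. -/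
theorem transpose_eq_or_eq_neg {F ν : Type*} [Field F] [Fintype ν] [DecidableEq ν]
    {Ψ : Matrix ν ν F} (hΨ : IsUnit Ψ)
    (h : ∀ X, X * (Ψ⁻¹ * Ψ.transpose) = Ψ⁻¹ * Ψ.transpose * X) :
    Ψ.transpose = Ψ ∨ Ψ.transpose = -Ψ := by
  obtain ⟨c, hc⟩ := exists_eq_smul_one_of_commute h
  have h1 : Ψ.transpose = c • Ψ := by
    rw [← mul_one (c • Ψ), Matrix.smul_mul, ← Matrix.mul_smul, ← hc, ← Matrix.mul_assoc,
      Matrix.mul_nonsing_inv _ ((Matrix.isUnit_iff_isUnit_det Ψ).1 hΨ), Matrix.one_mul]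
  by_cases h0 : Ψ = 0
  · left; simp [h0]
  have h2 : (c * c - 1) • Ψ = 0 := by
    have := congrArg Matrix.transpose h1
    rw [Matrix.transpose_transpose, Matrix.transpose_smul, h1, smul_smul] at this
    rw [sub_smul, one_smul, ← this, sub_self]
  have h3 : c * c = 1 := sub_eq_zero.1 ((smul_eq_zero.1 h2).resolve_right h0)
  rcases mul_self_eq_one_iff.1 h3 with rfl | rfl
  · left; rw [h1, one_smul]
  · right; rw [h1, neg_smul, one_smul]

/-- A grading of `M_d(F)` with support the subgroup `T` and one-dimensional components; then
every nonzero homogeneous element is invertible. -/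
structure IsDivisionGrading {F G : Type*} [Field F] [CommGroup G] {d : ℕ}
    (T : Subgroup G) (𝒟 : G → Submodule F (Matrix (Fin d) (Fin d) F)) : Prop where
  isGrading : IsGrading 𝒟
  support : ∀ g : G, 𝒟 g ≠ ⊥ ↔ g ∈ T
  fine : ∀ g ∈ T, Module.finrank F (𝒟 g) = 1

theorem IsFineComponent.isDivisionGrading {F G : Type*} [Field F] [CommGroup G] {d : ℕ}
    {T : Subgroup G} {𝒟 : G → Submodule F (Matrix (Fin d) (Fin d) F)}
    (h : IsFineComponent T 𝒟) : IsDivisionGrading T 𝒟 :=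
  ⟨h.isGrading, h.support, h.fine⟩

namespace IsDivisionGrading

variable {F G : Type*} [Field F] [CommGroup G] [Fintype G] {d : ℕ} {T : Subgroup G}
  {𝒟 : G → Submodule F (Matrix (Fin d) (Fin d) F)}

omit [Fintype G] in
theorem mem_of_ne_zero (h : IsDivisionGrading T 𝒟) {g : G} {Y : Matrix (Fin d) (Fin d) F}
    (hY : Y ∈ 𝒟 g) (hY0 : Y ≠ 0) : g ∈ T :=
  (h.support g).1 fun h0 => hY0 (by simpa [h0] using hY)

omit [Fintype G] in
theorem eq_zero_of_notMem (h : IsDivisionGrading T 𝒟) {g : G} {Y : Matrix (Fin d) (Fin d) F}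
    (hY : Y ∈ 𝒟 g) (hg : g ∉ T) : Y = 0 := by
  by_contra hY0
  exact hg (h.mem_of_ne_zero hY hY0)

omit [Fintype G] in
theorem eq_span (h : IsDivisionGrading T 𝒟) {g : G} {Y : Matrix (Fin d) (Fin d) F}
    (hY : Y ∈ 𝒟 g) (hY0 : Y ≠ 0) : 𝒟 g = Submodule.span F {Y} := by
  have h1 := h.fine g (h.mem_of_ne_zero hY hY0)
  refine le_antisymm (fun Z hZ => ?_) ((Submodule.span_singleton_le_iff_mem _ _).2 hY)
  obtain ⟨c, hc⟩ := (finrank_eq_one_iff_of_nonzero' (⟨Y, hY⟩ : 𝒟 g) (by simpa using hY0)).1 h1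
    ⟨Z, hZ⟩
  exact Submodule.mem_span_singleton.2 ⟨c, congrArg Subtype.val hc⟩

omit [Fintype G] in
theorem exists_ne_zero (h : IsDivisionGrading T 𝒟) {g : G} (hg : g ∈ T) :
    ∃ Y ∈ 𝒟 g, Y ≠ 0 :=
  (Submodule.ne_bot_iff _).1 ((h.support g).2 hg)

omit [Fintype G] in
theorem nonempty (h : IsDivisionGrading T 𝒟) : Nonempty (Fin d) := by
  obtain ⟨Y, -, hY⟩ := h.exists_ne_zero T.one_mem
  by_contra hd
  rw [not_nonempty_iff] at hd
  exact hY (Subsingleton.elim _ _)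

theorem isPrimitive_one (h : IsDivisionGrading T 𝒟) :
    IsPrimitive 𝒟 (1 : Matrix (Fin d) (Fin d) F) := by
  have := h.nonempty
  refine ⟨h.isGrading.one_mem, one_mul 1, one_ne_zero, fun f hf hff _ _ => ?_⟩
  rw [h.eq_span h.isGrading.one_mem one_ne_zero] at hf
  obtain ⟨c, rfl⟩ := Submodule.mem_span_singleton.1 hf
  have hc : c * c = c := by
    rw [smul_one_mul, smul_smul] at hff
    simpa using congrFun (congrFun hff this.some) this.some
  by_cases hc0 : c = 0
  · left; rw [hc0, zero_smul]
  · right; rw [mul_left_cancel₀ hc0 (hc.trans (mul_one c).symm), one_smul]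

theorem exists_inverse (h : IsDivisionGrading T 𝒟) {g : G} {Y : Matrix (Fin d) (Fin d) F}
    (hY : Y ∈ 𝒟 g) (hY0 : Y ≠ 0) : ∃ Z ∈ 𝒟 g⁻¹, Y * Z = 1 ∧ Z * Y = 1 := by
  obtain ⟨Z, hZ, -, -, h1, h2⟩ := h.isPrimitive_one.exists_inverse h.isGrading h.isPrimitive_one
    hY hY0 (one_mul Y) (mul_one Y)
  exact ⟨Z, hZ, h1, h2⟩

theorem isUnit (h : IsDivisionGrading T 𝒟) {g : G} {Y : Matrix (Fin d) (Fin d) F}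
    (hY : Y ∈ 𝒟 g) (hY0 : Y ≠ 0) : IsUnit Y := by
  obtain ⟨Z, -, h1, -⟩ := h.exists_inverse hY hY0
  exact IsUnit.of_mul_eq_one _ h1

/-- A degree-preserving antiautomorphism `Y ↦ Ψ⁻¹ ᵗY Ψ` acts on each component by a scalar `χ`,
so that homogeneous elements commute up to the factor `χ(s) χ(t) / χ(st)`. This factor is
symmetric in `s` and `t`, hence a sign, squares of homogeneous elements are central, and the
support is an elementary abelian 2-group. If `Ψ` is skew-symmetric, it becomes symmetric after
multiplication by a homogeneous element on which `χ = -1`. -/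
theorem exists_symmetric (h : IsDivisionGrading T 𝒟) (h2 : (2 : F) ≠ 0)
    {Ψ : Matrix (Fin d) (Fin d) F} (hΨ : IsUnit Ψ)
    (hgr : ∀ t, ∀ Y ∈ 𝒟 t, Ψ⁻¹ * Y.transpose * Ψ ∈ 𝒟 t) :
    (∀ t ∈ T, t * t = 1) ∧ ∃ Ψ' : Matrix (Fin d) (Fin d) F, IsUnit Ψ' ∧ Ψ'.transpose = Ψ' ∧
      ∀ t, ∀ Y ∈ 𝒟 t, Y.transpose * Ψ' = Ψ' * Y ∨ Y.transpose * Ψ' = -(Ψ' * Y) := by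
  have hne := h.nonempty
  have hdet := (Matrix.isUnit_iff_isUnit_det Ψ).1 hΨ
  have hχ : ∀ t, ∃ c : F, ∀ Y ∈ 𝒟 t, Y.transpose * Ψ = c • (Ψ * Y) := by
    intro t
    by_cases ht : t ∈ T
    · obtain ⟨X, hX, hX0⟩ := h.exists_ne_zero ht
      have hsp := h.eq_span hX hX0
      obtain ⟨c, hc⟩ := Submodule.mem_span_singleton.1 (hsp ▸ hgr t X hX)
      have hcX : X.transpose * Ψ = c • (Ψ * X) := by
        rw [← Matrix.mul_smul, hc, Matrix.mul_assoc, ← Matrix.mul_assoc Ψ,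
          Matrix.mul_nonsing_inv _ hdet, Matrix.one_mul]
      refine ⟨c, fun Y hY => ?_⟩
      obtain ⟨a, rfl⟩ := Submodule.mem_span_singleton.1 (hsp ▸ hY)
      rw [Matrix.transpose_smul, Matrix.smul_mul, hcX, Matrix.mul_smul, smul_comm]
    · refine ⟨0, fun Y hY => ?_⟩
      rw [h.eq_zero_of_notMem hY ht]
      simp
  choose χ hχ using hχ
  have hcancel : ∀ {A B : Matrix (Fin d) (Fin d) F}, Ψ * A = Ψ * B → A = B := fun hAB =>
    hΨ.mul_left_cancel hAB
  have hcomm : ∀ {t s Y Z}, Y ∈ 𝒟 t → Z ∈ 𝒟 s → χ (t * s) • (Y * Z) = (χ t * χ s) • (Z * Y) := by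
    intro t s Y Z hY hZ
    apply hcancel
    have h1 := hχ _ _ (h.isGrading.mul_mem _ _ _ hY _ hZ)
    rw [Matrix.transpose_mul, Matrix.mul_assoc, hχ _ _ hY, Matrix.mul_smul, ← Matrix.mul_assoc,
      hχ _ _ hZ, Matrix.smul_mul, smul_smul, Matrix.mul_assoc] at h1
    rw [Matrix.mul_smul, Matrix.mul_smul, h1]
  have hχ0 : ∀ t ∈ T, χ t ≠ 0 := by
    intro t ht h0
    obtain ⟨X, hX, hX0⟩ := h.exists_ne_zero ht
    have h1 := hχ t X hX
    rw [h0, zero_smul] at h1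
    apply hX0
    rw [← Matrix.transpose_eq_zero]
    exact hΨ.mul_right_cancel (h1.trans (Matrix.zero_mul _).symm)
  have hsign : ∀ {t s Y Z}, Y ∈ 𝒟 t → Z ∈ 𝒟 s → Y * Z = Z * Y ∨ Y * Z = -(Z * Y) := by
    intro t s Y Z hY hZ
    by_cases h0 : Y * Z = 0
    · by_cases hY0 : Y = 0
      · left; simp [hY0]
      · have : Z = 0 := (h.isUnit hY hY0).mul_left_cancel (h0.trans (mul_zero _).symm)
        left; simp [this]
    have h1 := hcomm hY hZ
    have h3 := hcomm hZ hY
    rw [mul_comm s, mul_comm (χ s)] at h3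
    have hc0 : χ (t * s) ≠ 0 := hχ0 _ (h.mem_of_ne_zero (h.isGrading.mul_mem _ _ _ hY _ hZ) h0)
    have h4 : (χ (t * s) * χ (t * s) - (χ t * χ s) * (χ t * χ s)) • (Y * Z) = 0 := by
      rw [sub_smul, mul_smul, h1, smul_comm, h3, ← mul_smul, sub_self]
    rcases mul_self_eq_mul_self_iff.1 (sub_eq_zero.1 ((smul_eq_zero.1 h4).resolve_right h0))
      with h5 | h5
    · left
      rw [← h5] at h1
      exact smul_right_injective _ hc0 h1
    · right
      rw [← neg_eq_iff_eq_neg.2 h5, neg_smul, ← smul_neg] at h1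
      exact smul_right_injective _ hc0 h1
  have hcentral : ∀ M : Matrix (Fin d) (Fin d) F, (∀ t, ∀ Y ∈ 𝒟 t, Y * M = M * Y) →
      ∀ X, X * M = M * X := by
    intro M hM X
    have := h.isGrading.linearMap_eq_zero (LinearMap.mulRight F M - LinearMap.mulLeft F M)
      fun g x hx => by simpa [sub_eq_zero] using hM g x hx
    simpa [sub_eq_zero] using LinearMap.congr_fun this X
  have hT : ∀ t ∈ T, t * t = 1 := by
    intro t ht
    obtain ⟨X, hX, hX0⟩ := h.exists_ne_zero ht
    have hXX := h.isGrading.mul_mem _ _ _ hX _ hX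
    have hXX0 : X * X ≠ 0 := ((h.isUnit hX hX0).mul (h.isUnit hX hX0)).ne_zero
    obtain ⟨c, hc⟩ := exists_eq_smul_one_of_commute (hcentral (X * X) fun s Y hY => by
      rcases hsign hX hY with hs | hs
      · rw [← mul_assoc, ← hs, mul_assoc, ← hs, mul_assoc]
      · rw [mul_assoc, hs, mul_neg, ← mul_assoc X, hs, neg_mul, neg_neg, mul_assoc])
    exact h.isGrading.eq_of_mem_of_mem hXX (hc ▸ Submodule.smul_mem _ c h.isGrading.one_mem) hXX0
  refine ⟨hT, ?_⟩
  have hχ1 : χ 1 = 1 := by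
    have h1 := hχ 1 1 h.isGrading.one_mem
    rw [Matrix.transpose_one, one_mul, mul_one] at h1
    have h3 : (χ 1 - 1) • Ψ = 0 := by rw [sub_smul, one_smul, ← h1, sub_self]
    exact sub_eq_zero.1 ((smul_eq_zero.1 h3).resolve_right hΨ.ne_zero)
  have hχsq : ∀ t ∈ T, χ t * χ t = 1 := by
    intro t ht
    obtain ⟨X, hX, hX0⟩ := h.exists_ne_zero ht
    have hXX0 : X * X ≠ 0 := ((h.isUnit hX hX0).mul (h.isUnit hX hX0)).ne_zero
    have h1 := hcomm hX hX
    rw [hT t ht, hχ1] at h1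
    have h3 : (1 - χ t * χ t) • (X * X) = 0 := by rw [sub_smul, h1, sub_self]
    exact (sub_eq_zero.1 ((smul_eq_zero.1 h3).resolve_right hXX0)).symm
  have hpm : ∀ t, ∀ Y ∈ 𝒟 t, Y.transpose * Ψ = Ψ * Y ∨ Y.transpose * Ψ = -(Ψ * Y) := by
    intro t Y hY
    by_cases hY0 : Y = 0
    · left; simp [hY0]
    rw [hχ t Y hY]
    rcases mul_self_eq_one_iff.1 (hχsq t (h.mem_of_ne_zero hY hY0)) with hc | hc <;> simp [hc]
  have hpmT : ∀ t, ∀ Y ∈ 𝒟 t, Y * (Ψ⁻¹ * Ψ.transpose) = Ψ⁻¹ * Ψ.transpose * Y := by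
    intro t Y hY
    apply hcancel
    have hinv : Ψ * Ψ⁻¹ = 1 := Matrix.mul_nonsing_inv _ hdet
    have hr : Ψ * (Ψ⁻¹ * Ψ.transpose * Y) = Ψ.transpose * Y := by
      rw [← mul_assoc, ← mul_assoc, hinv, one_mul]
    rw [hr, ← mul_assoc]
    rcases hpm t Y hY with hs | hs
    · have hs' := congrArg Matrix.transpose hs
      simp only [Matrix.transpose_mul, Matrix.transpose_transpose] at hs'
      rw [← hs, hs', mul_assoc, ← mul_assoc Ψ, hinv, one_mul]
    · have hs' := congrArg Matrix.transpose hs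
      simp only [Matrix.transpose_mul, Matrix.transpose_transpose, Matrix.transpose_neg] at hs'
      rw [← neg_eq_iff_eq_neg.2 hs, hs', neg_mul, mul_assoc, ← mul_assoc Ψ, hinv, one_mul]
  rcases transpose_eq_or_eq_neg hΨ (hcentral _ hpmT) with hsymm | hskew
  · exact ⟨Ψ, hΨ, hsymm, hpm⟩
  obtain ⟨t, X, hX, hX1⟩ : ∃ t, ∃ X ∈ 𝒟 t, X.transpose * Ψ ≠ Ψ * X := by
    -- otherwise every matrix of the form `Ψ Y`, hence every matrix, is skew-symmetric
    by_contra! hcon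
    have hall : ∀ Y : Matrix (Fin d) (Fin d) F, (Ψ * Y).transpose = -(Ψ * Y) := by
      intro Y
      have := h.isGrading.linearMap_eq_zero
        ((LinearMap.mulRight F Ψ).comp (Matrix.transposeLinearEquiv (Fin d) (Fin d) F F).toLinearMap
          - LinearMap.mulLeft F Ψ) fun g x hx => by simpa [sub_eq_zero] using hcon g x hx
      have hY : Y.transpose * Ψ = Ψ * Y := by
        simpa [sub_eq_zero] using LinearMap.congr_fun this Y
      rw [Matrix.transpose_mul, hskew, mul_neg, hY]
    have h1 := hall Ψ⁻¹
    rw [Matrix.mul_nonsing_inv _ hdet, Matrix.transpose_one] at h1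
    have h3 := congrFun (congrFun h1 hne.some) hne.some
    simp only [Matrix.one_apply_eq, Matrix.neg_apply] at h3
    exact h2 (by linear_combination h3)
  have hX0 : X ≠ 0 := by
    rintro rfl
    simp at hX1
  have hXs := (hpm t X hX).resolve_left hX1
  refine ⟨Ψ * X, hΨ.mul (h.isUnit hX hX0), ?_, fun s Y hY => ?_⟩
  · rw [Matrix.transpose_mul, hskew, mul_neg, hXs, neg_neg]
  · rw [← mul_assoc]
    rcases hpm s Y hY with h3 | h3 <;> rw [h3] <;> rcases hsign hX hY with h4 | h4 <;>
      simp [mul_assoc, h4]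

end IsDivisionGrading

/-! ### The graded division algebra of a primitive idempotent -/

theorem exists_factorization_of_idempotent {F ν : Type*} [Field F] [Fintype ν] [DecidableEq ν]
    {ε : Matrix ν ν F} (hε : ε * ε = ε) :
    ∃ (d : ℕ) (J : Matrix ν (Fin d) F) (K : Matrix (Fin d) ν F), K * J = 1 ∧ J * K = ε := by
  let b := Module.finBasis F (LinearMap.range ε.mulVecLin)
  let J : Matrix ν (Fin _) F := Matrix.of fun a i => (b i : ν → F) a
  let K : Matrix (Fin _) ν F := Matrix.of fun i a => b.repr ⟨ε.mulVecLin (Pi.single a 1), _, rfl⟩ i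
  have hJ : ∀ c, J.mulVec c = ((∑ i, c i • b i : LinearMap.range ε.mulVecLin) : ν → F) := by
    intro c
    ext a
    simp [J, Matrix.mulVec, dotProduct, mul_comm]
  have hJK : J * K = ε := by
    ext a c
    have h1 := congrFun (hJ (fun i => K i c)) a
    have h3 : ∑ i, K i c • b i = ⟨ε.mulVecLin (Pi.single c 1), _, rfl⟩ := b.sum_repr _
    rw [h3] at h1
    rw [Matrix.mul_apply]
    simpa [Matrix.mulVec, dotProduct, Pi.single_apply] using h1
  have hεJ : ε * J = J := by
    ext a i
    obtain ⟨w, hw⟩ := (b i).2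
    have h1 : ε.mulVec (b i : ν → F) = b i := by
      rw [← hw, Matrix.mulVecLin_apply, Matrix.mulVec_mulVec, hε]
    exact congrFun h1 a
  refine ⟨_, J, K, ?_, hJK⟩
  refine Matrix.mulVec_injective (funext fun c => ?_)
  have hinj : Function.Injective J.mulVec := by
    intro c c' hcc
    rw [hJ, hJ] at hcc
    refine b.equivFun.symm.injective ?_
    rw [b.equivFun_symm_apply, b.equivFun_symm_apply]
    exact Subtype.ext hcc
  apply hinj
  rw [Matrix.mulVec_mulVec, ← Matrix.mul_assoc, hJK, hεJ, Matrix.one_mulVec]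

section Corner

variable {F G ν : Type*} [Field F] [CommGroup G] [Fintype ν]
  {𝒜 : G → Submodule F (Matrix ν ν F)} {ε : Matrix ν ν F} {d : ℕ} {J : Matrix ν (Fin d) F}
  {K : Matrix (Fin d) ν F}

/-- The grading of the algebra `ε R ε`, where `ε = J K` is an idempotent with `K J = 1`; it is
identified with `M_d(F)` by `Y ↦ J Y K`. -/
def corner (𝒜 : G → Submodule F (Matrix ν ν F)) (J : Matrix ν (Fin d) F)
    (K : Matrix (Fin d) ν F) (g : G) : Submodule F (Matrix (Fin d) (Fin d) F) where
  carrier := {Y | J * Y * K ∈ 𝒜 g}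
  add_mem' {Y Z} hY hZ := by
    rw [Set.mem_ofPred_eq, Matrix.mul_add, Matrix.add_mul]
    exact Submodule.add_mem _ hY hZ
  zero_mem' := by
    rw [Set.mem_ofPred_eq, Matrix.mul_zero, Matrix.zero_mul]
    exact Submodule.zero_mem _
  smul_mem' c Y hY := by
    rw [Set.mem_ofPred_eq, Matrix.mul_smul, Matrix.smul_mul]
    exact Submodule.smul_mem _ c hY

omit [CommGroup G] [Fintype ν] in
theorem mem_corner {g : G} {Y : Matrix (Fin d) (Fin d) F} :
    Y ∈ corner 𝒜 J K g ↔ J * Y * K ∈ 𝒜 g := Iff.rfl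

variable [DecidableEq ν]

theorem isGrading_corner [Fintype G] (h : IsGrading 𝒜) (hε : ε ∈ 𝒜 1) (hKJ : K * J = 1)
    (hJK : J * K = ε) : IsGrading (corner 𝒜 J K) := by
  have hcan : ∀ Y : Matrix (Fin d) (Fin d) F, K * (J * Y * K) * J = Y := by
    intro Y
    rw [Matrix.mul_assoc J, ← Matrix.mul_assoc K, hKJ, Matrix.one_mul, Matrix.mul_assoc, hKJ,
      Matrix.mul_one]
  refine isGrading_of_unique_decomposition (fun Y => ?_) (fun f hf hsum g => ?_) ?_
  · obtain ⟨f, hf, hsum⟩ := h.exists_sum_eq (J * Y * K)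
    refine ⟨fun g => K * f g * J, fun g => ?_, ?_⟩
    · have : J * (K * f g * J) * K = ε * f g * ε := by
        simp only [← hJK, Matrix.mul_assoc]
      rw [mem_corner, this]
      simpa using h.mul_mem _ _ _ (h.mul_mem _ _ _ hε _ (hf g)) _ hε
    · rw [← Matrix.sum_mul, ← Matrix.mul_sum, hsum, hcan]
  · have := h.eq_zero_of_sum_eq_zero (f := fun g => J * f g * K) hf (by
      rw [← Matrix.sum_mul, ← Matrix.mul_sum, hsum, Matrix.mul_zero, Matrix.zero_mul]) g
    rw [← hcan (f g), this, Matrix.mul_zero, Matrix.zero_mul]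
  · intro g k Y hY Z hZ
    have : J * (Y * Z) * K = (J * Y * K) * (J * Z * K) := by
      calc _ = J * Y * (K * J) * Z * K := by rw [hKJ, Matrix.mul_one, Matrix.mul_assoc J Y Z]
        _ = _ := by simp only [Matrix.mul_assoc]
    rw [mem_corner, this]
    exact h.mul_mem _ _ _ hY _ hZ

/-- The support of the graded division algebra `ε R ε`. -/
def IsPrimitive.support [Fintype G] (hε : IsPrimitive 𝒜 ε) (h : IsGrading 𝒜) : Subgroup G where
  carrier := {t | ∃ x ∈ 𝒜 t, x ≠ 0 ∧ ε * x = x ∧ x * ε = x}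
  one_mem' := ⟨ε, hε.mem, hε.ne_zero, hε.mul_self, hε.mul_self⟩
  mul_mem' := by
    rintro s t ⟨x, hx, hx0, hxl, hxr⟩ ⟨y, hy, hy0, hyl, hyr⟩
    refine ⟨x * y, h.mul_mem _ _ _ hx _ hy, fun hxy => ?_, by rw [← mul_assoc, hxl],
      by rw [mul_assoc, hyr]⟩
    obtain ⟨z, -, -, -, -, hzx⟩ := hε.exists_inverse h hε hx hx0 hxl hxr
    apply hy0
    rw [← hyl, ← hzx, mul_assoc, hxy, mul_zero]
  inv_mem' := by
    rintro t ⟨x, hx, hx0, hxl, hxr⟩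
    obtain ⟨z, hz, hzl, hzr, hxz, -⟩ := hε.exists_inverse h hε hx hx0 hxl hxr
    refine ⟨z, hz, ?_, hzl, hzr⟩
    rintro rfl
    exact hε.ne_zero (by rw [← hxz, mul_zero])

theorem IsPrimitive.mem_support [Fintype G] (hε : IsPrimitive 𝒜 ε) (h : IsGrading 𝒜) {t : G} :
    t ∈ hε.support h ↔ ∃ x ∈ 𝒜 t, x ≠ 0 ∧ ε * x = x ∧ x * ε = x := Iff.rfl

theorem IsPrimitive.isDivisionGrading_corner [IsAlgClosed F] [Fintype G] (h : IsGrading 𝒜)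
    (hε : IsPrimitive 𝒜 ε) (hKJ : K * J = 1) (hJK : J * K = ε) :
    IsDivisionGrading (hε.support h) (corner 𝒜 J K) := by
  have hgr := isGrading_corner h hε.mem hKJ hJK
  have hcan : ∀ Y : Matrix (Fin d) (Fin d) F, K * (J * Y * K) * J = Y := by
    intro Y
    rw [Matrix.mul_assoc J, ← Matrix.mul_assoc K, hKJ, Matrix.one_mul, Matrix.mul_assoc, hKJ,
      Matrix.mul_one]
  have hl : ∀ Y : Matrix (Fin d) (Fin d) F, ε * (J * Y * K) = J * Y * K := by
    intro Y
    rw [← hJK, Matrix.mul_assoc J Y, Matrix.mul_assoc, ← Matrix.mul_assoc K, hKJ, Matrix.one_mul]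
  have hr : ∀ Y : Matrix (Fin d) (Fin d) F, J * Y * K * ε = J * Y * K := by
    intro Y
    rw [← hJK, ← Matrix.mul_assoc, Matrix.mul_assoc _ K J, hKJ, Matrix.mul_one]
  have hne : ∀ {Y : Matrix (Fin d) (Fin d) F}, Y ≠ 0 → J * Y * K ≠ 0 := by
    intro Y hY h0
    apply hY
    rw [← hcan Y, h0, Matrix.mul_zero, Matrix.zero_mul]
  have hinv : ∀ {g Y}, Y ∈ corner 𝒜 J K g → Y ≠ 0 →
      ∃ Z ∈ corner 𝒜 J K g⁻¹, Y * Z = 1 ∧ Z * Y = 1 := by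
    intro g Y hY hY0
    obtain ⟨y, hy, hyl, hyr, hxy, hyx⟩ := hε.exists_inverse h hε hY (hne hY0) (hl Y) (hr Y)
    have hJyK : J * (K * y * J) * K = y := by
      rw [← Matrix.mul_assoc, ← Matrix.mul_assoc, hJK, hyl, Matrix.mul_assoc, hJK, hyr]
    have hmul : ∀ A B : Matrix (Fin d) (Fin d) F,
        A * B = K * ((J * A * K) * (J * B * K)) * J := by
      intro A B
      rw [← Matrix.mul_assoc, ← Matrix.mul_assoc, Matrix.mul_assoc J A K, ← Matrix.mul_assoc K,
        hKJ, Matrix.one_mul, ← Matrix.mul_assoc, Matrix.mul_assoc A, hKJ, Matrix.mul_one,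
        Matrix.mul_assoc _ K, hKJ, Matrix.mul_one]
    have hone : K * ε * J = 1 := by
      rw [← hJK, ← Matrix.mul_assoc, hKJ, Matrix.one_mul, hKJ]
    refine ⟨K * y * J, ?_, ?_, ?_⟩
    · rwa [mem_corner, hJyK]
    · rw [hmul, hJyK, hxy, hone]
    · rw [hmul, hJyK, hyx, hone]
  have hd : Nonempty (Fin d) := by
    by_contra hd
    rw [not_nonempty_iff] at hd
    apply hε.ne_zero
    rw [← hJK]
    ext
    simp [Matrix.mul_apply]
  have hone : ∀ Y ∈ corner 𝒜 J K 1, ∃ c : F, Y = c • 1 := by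
    intro Y hY
    obtain ⟨c, hc⟩ := spectrum.nonempty_of_isAlgClosed_of_finiteDimensional F Y
    refine ⟨c, ?_⟩
    rw [spectrum.mem_iff, Algebra.algebraMap_eq_smul_one] at hc
    by_contra hne'
    obtain ⟨Z, -, hZ, -⟩ := hinv (Submodule.sub_mem _ (Submodule.smul_mem _ c hgr.one_mem) hY)
      (sub_ne_zero.2 (Ne.symm hne'))
    exact hc (IsUnit.of_mul_eq_one _ hZ)
  have hsupp : ∀ g, corner 𝒜 J K g ≠ ⊥ ↔ g ∈ hε.support h := by
    intro g
    rw [hε.mem_support, Submodule.ne_bot_iff]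
    constructor
    · rintro ⟨Y, hY, hY0⟩
      exact ⟨J * Y * K, hY, hne hY0, hl Y, hr Y⟩
    · rintro ⟨x, hx, hx0, hxl, hxr⟩
      have hJxK : J * (K * x * J) * K = x := by
        rw [← Matrix.mul_assoc, ← Matrix.mul_assoc, hJK, hxl, Matrix.mul_assoc, hJK, hxr]
      refine ⟨K * x * J, by rwa [mem_corner, hJxK], fun h0 => hx0 ?_⟩
      rw [← hJxK, h0, Matrix.mul_zero, Matrix.zero_mul]
  refine ⟨hgr, hsupp, fun g hg => ?_⟩
  obtain ⟨Y, hY, hY0⟩ := (Submodule.ne_bot_iff _).1 ((hsupp g).2 hg)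
  refine finrank_eq_one (⟨Y, hY⟩ : corner 𝒜 J K g) (by simpa using hY0) ?_
  rintro ⟨W, hW⟩
  obtain ⟨Z, hZ, hYZ, hZY⟩ := hinv hY hY0
  obtain ⟨c, hc⟩ := hone (W * Z) (by simpa using hgr.mul_mem _ _ _ hW _ hZ)
  refine ⟨c, Subtype.ext ?_⟩
  change c • Y = W
  rw [← mul_one W, ← hZY, ← mul_assoc, hc, smul_one_mul]

end Corner

/-! ### Block matrices with homogeneous blocks -/

section Block

variable {F G ι δ : Type*} [Field F] [CommGroup G]

/-- The block with index `(i, j)` of a matrix of `M_ι(F) ⊗ M_δ(F)`. -/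
def block (M : Matrix (ι × δ) (ι × δ) F) (i j : ι) : Matrix δ δ F :=
  M.submatrix (Prod.mk i) (Prod.mk j)

omit [Field F] [CommGroup G] in
theorem ext_block {M N : Matrix (ι × δ) (ι × δ) F} (h : ∀ i j, block M i j = block N i j) :
    M = N := by
  ext ⟨i, a⟩ ⟨j, b⟩
  exact congrFun (congrFun (h i j) a) b

theorem block_mul [Fintype ι] [Fintype δ] (M N : Matrix (ι × δ) (ι × δ) F) (i j : ι) :
    block (M * N) i j = ∑ k, block M i k * block N k j := by
  ext a b
  simp only [block, Matrix.submatrix_apply, Matrix.mul_apply, Fintype.sum_prod_type,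
    Matrix.sum_apply]

omit [Field F] in
theorem block_transpose (M : Matrix (ι × δ) (ι × δ) F) (i j : ι) :
    block M.transpose i j = (block M j i).transpose := rfl

theorem block_sum {κ : Type*} (s : Finset κ) (M : κ → Matrix (ι × δ) (ι × δ) F) (i j : ι) :
    block (∑ k ∈ s, M k) i j = ∑ k ∈ s, block (M k) i j := by
  ext a b
  simp only [block, Matrix.submatrix_apply, Matrix.sum_apply]

theorem block_kronecker (A : Matrix ι ι F) (Y : Matrix δ δ F) (i j : ι) :
    block (A ⊗ₖ Y) i j = A i j • Y := rfl

theorem block_one [DecidableEq ι] [DecidableEq δ] (i j : ι) :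
    block (1 : Matrix (ι × δ) (ι × δ) F) i j = if i = j then 1 else 0 := by
  ext a b
  by_cases hij : i = j
  · simp [block, Matrix.one_apply, hij]
  · simp [block, hij]

/-- The matrices whose block `(i, j)` has degree `α_i g β_j⁻¹`. For `α = β = γ` these are the
homogeneous elements of degree `g` of the algebra `C ⊗ D`. For `α = γ⁻¹` and `β = γ` they
form the component of degree `g` of the space of bilinear forms, where the form with the matrix
`E_ij ⊗ Y` has the degree `γ_i t γ_j` if `Y` has the degree `t`. -/
def blockGrading (α β : ι → G) (𝒟 : G → Submodule F (Matrix δ δ F)) (g : G) :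
    Submodule F (Matrix (ι × δ) (ι × δ) F) where
  carrier := {M | ∀ i j, block M i j ∈ 𝒟 (α i * g * (β j)⁻¹)}
  add_mem' hM hN i j := Submodule.add_mem _ (hM i j) (hN i j)
  zero_mem' _ _ := Submodule.zero_mem _
  smul_mem' c _ hM i j := Submodule.smul_mem _ c (hM i j)

variable {𝒟 : G → Submodule F (Matrix δ δ F)} {α β γ : ι → G}

theorem mem_blockGrading {g : G} {M : Matrix (ι × δ) (ι × δ) F} :
    M ∈ blockGrading α β 𝒟 g ↔ ∀ i j, block M i j ∈ 𝒟 (α i * g * (β j)⁻¹) := Iff.rfl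

theorem elementary_apply_eq_zero [DecidableEq ι] {a : G} {A : Matrix ι ι F}
    (hA : A ∈ elementary F γ a) {i j : ι} (hij : (γ i)⁻¹ * γ j ≠ a) : A i j = 0 := by
  refine Submodule.span_induction (p := fun A _ => A i j = 0) ?_ rfl ?_ ?_ hA
  · rintro _ ⟨k, l, hkl, rfl⟩
    rw [Matrix.single_apply, if_neg]
    rintro ⟨rfl, rfl⟩
    exact hij hkl
  · intro A B _ _ hA hB
    rw [Matrix.add_apply, hA, hB, add_zero]
  · intro c A _ hA
    rw [Matrix.smul_apply, hA, smul_zero]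

/-- The grading of `C ⊗ D` in coordinates: a matrix has degree `g` if and only if its block `(i, j)`
has degree `γ_i g γ_j⁻¹` for all `i` and `j`. -/
theorem tensorGrading_eq [Fintype ι] [DecidableEq ι] (g : G) :
    tensorGrading γ 𝒟 g = blockGrading γ γ 𝒟 g := by
  refine le_antisymm (Submodule.span_le.2 ?_) fun M hM => ?_
  · rintro _ ⟨a, b, rfl, A, hA, Y, hY, rfl⟩ i j
    rw [block_kronecker]
    by_cases hij : (γ i)⁻¹ * γ j = a
    · have : γ i * (a * b) * (γ j)⁻¹ = b := by rw [← hij]; group; simp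
      rw [this]
      exact Submodule.smul_mem _ _ hY
    · rw [elementary_apply_eq_zero hA hij, zero_smul]
      exact Submodule.zero_mem _
  · have hsum : M = ∑ i, ∑ j, Matrix.single i j (1 : F) ⊗ₖ block M i j := by
      refine ext_block fun k l => ?_
      simp only [block_sum, block_kronecker, Matrix.single_apply, ite_and, ite_smul, one_smul,
        zero_smul]
      simp
    rw [hsum]
    refine Submodule.sum_mem _ fun i _ => Submodule.sum_mem _ fun j _ => Submodule.subset_span ?_
    refine ⟨(γ i)⁻¹ * γ j, γ i * g * (γ j)⁻¹, ?_, _, Submodule.subset_span ⟨i, j, rfl, rfl⟩, _,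
      hM i j, rfl⟩
    rw [mul_assoc, mul_comm _ (γ j)⁻¹, mul_inv_cancel_left, inv_mul_cancel_left]

theorem blockGrading_transpose (hT : ∀ t, ∀ Y ∈ 𝒟 t, Y.transpose ∈ 𝒟 t) {g : G}
    {M : Matrix (ι × δ) (ι × δ) F} (hM : M ∈ blockGrading α β 𝒟 g) :
    M.transpose ∈ blockGrading (fun i => (β i)⁻¹) (fun i => (α i)⁻¹) 𝒟 g := by
  intro i j
  have : (β i)⁻¹ * g * ((α j)⁻¹)⁻¹ = α j * g * (β i)⁻¹ := by
    rw [inv_inv, mul_assoc, mul_comm]; ac_rfl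
  rw [this]
  exact hT _ _ (hM j i)

variable [Fintype δ] [DecidableEq δ]

theorem blockGrading_mul [Fintype ι] (h : IsGrading 𝒟) {g k : G}
    {M N : Matrix (ι × δ) (ι × δ) F} (hM : M ∈ blockGrading α β 𝒟 g)
    (hN : N ∈ blockGrading β γ 𝒟 k) : M * N ∈ blockGrading α γ 𝒟 (g * k) := by
  intro i j
  rw [block_mul]
  refine Submodule.sum_mem _ fun l _ => ?_
  have := h.mul_mem _ _ _ (hM i l) _ (hN l j)
  have he : α i * g * (β l)⁻¹ * (β l * k * (γ j)⁻¹) = α i * (g * k) * (γ j)⁻¹ := by group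
  rwa [he] at this

/-- The change of variables `g ↦ a g b⁻¹`. -/
def degreeEquiv (a b : G) : G ≃ G := (Equiv.mulLeft a).trans (Equiv.mulRight b⁻¹)

theorem blockGrading_exists_sum_eq [Fintype G] (h : IsGrading 𝒟) (M : Matrix (ι × δ) (ι × δ) F) :
    ∃ f : G → Matrix (ι × δ) (ι × δ) F,
      (∀ g, f g ∈ blockGrading α β 𝒟 g) ∧ ∑ g, f g = M := by
  choose f hf hsum using fun i j => h.exists_sum_eq (block M i j)
  refine ⟨fun g => Matrix.of fun p q => f p.1 q.1 (α p.1 * g * (β q.1)⁻¹) p.2 q.2,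
    fun g i j => hf i j _, ?_⟩
  refine ext_block fun i j => ?_
  refine (block_sum _ _ i j).trans ?_
  exact (Fintype.sum_equiv (degreeEquiv (α i) (β j)) _ (f i j) fun g => rfl).trans (hsum i j)

theorem blockGrading_eq_zero_of_sum_eq_zero [Fintype G] (h : IsGrading 𝒟)
    {f : G → Matrix (ι × δ) (ι × δ) F} (hf : ∀ g, f g ∈ blockGrading α β 𝒟 g)
    (hsum : ∑ g, f g = 0) (g : G) : f g = 0 := by
  refine ext_block fun i j => ?_
  have h1 : ∑ g, block (f ((degreeEquiv (α i) (β j)).symm g)) i j = 0 := by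
    have := congrArg (fun M => block M i j) hsum
    simp only [block_sum] at this
    exact (Fintype.sum_equiv (degreeEquiv (α i) (β j)).symm _ (fun g => block (f g) i j)
      fun g => rfl).trans this
  have h2 := h.eq_zero_of_sum_eq_zero (fun k => ?_) h1 (degreeEquiv (α i) (β j) g)
  · rw [Equiv.symm_apply_apply] at h2
    exact h2
  · have := hf ((degreeEquiv (α i) (β j)).symm k) i j
    have he : α i * (degreeEquiv (α i) (β j)).symm k * (β j)⁻¹ = k :=
      (degreeEquiv (α i) (β j)).apply_symm_apply k
    rwa [he] at this

theorem isGrading_tensorGrading [Finite G] [Fintype ι] [DecidableEq ι] (h : IsGrading 𝒟) :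
    IsGrading (tensorGrading γ 𝒟) := by
  have := Fintype.ofFinite G
  have he : tensorGrading γ 𝒟 = blockGrading γ γ 𝒟 := funext tensorGrading_eq
  rw [he]
  exact isGrading_of_unique_decomposition (blockGrading_exists_sum_eq h)
    (fun f hf => blockGrading_eq_zero_of_sum_eq_zero h hf)
    fun g k M hM N hN => blockGrading_mul h hM hN

end Block

/-! ### Graded involutions -/

section Adj

variable {F G ν : Type*} [Field F] [Fintype ν] [DecidableEq ν]
  {𝒜 : G → Submodule F (Matrix ν ν F)} {Φ : Matrix ν ν F}

theorem adj_mul (hΦ : IsUnit Φ) (X Y : Matrix ν ν F) : adj Φ (X * Y) = adj Φ Y * adj Φ X := by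
  have h : Φ * Φ⁻¹ = 1 := Matrix.mul_nonsing_inv _ ((Matrix.isUnit_iff_isUnit_det Φ).1 hΦ)
  calc adj Φ (X * Y) = Φ⁻¹ * Y.transpose * (Φ * Φ⁻¹) * X.transpose * Φ := by
        rw [h, adj, Matrix.transpose_mul, mul_one]
        simp only [mul_assoc]
    _ = _ := by simp only [adj, mul_assoc]

theorem mul_adj (hΦ : IsUnit Φ) (X : Matrix ν ν F) : Φ * adj Φ X = X.transpose * Φ := by
  have h : Φ * Φ⁻¹ = 1 := Matrix.mul_nonsing_inv _ ((Matrix.isUnit_iff_isUnit_det Φ).1 hΦ)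
  rw [adj, ← mul_assoc, ← mul_assoc, h, one_mul]

theorem adj_zero : adj Φ 0 = 0 := by simp [adj]

theorem IsGradedInvolution.adj_mem (h : IsGradedInvolution 𝒜 Φ) {g : G} {X : Matrix ν ν F}
    (hX : X ∈ 𝒜 g) : adj Φ X ∈ 𝒜 g := by
  have : adj Φ X ∈ (𝒜 g : Set (Matrix ν ν F)) := h.graded g ▸ ⟨X, hX, rfl⟩
  exact this

theorem IsGradedInvolution.transpose_eq (h : IsGradedInvolution 𝒜 Φ) :
    Φ.transpose = Φ ∨ Φ.transpose = -Φ := by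
  refine transpose_eq_or_eq_neg h.isUnit fun X => ?_
  have hu := (Matrix.isUnit_iff_isUnit_det Φ).1 h.isUnit
  have hi : Φ * Φ⁻¹ = 1 := Matrix.mul_nonsing_inv _ hu
  have h1 := h.involutive X
  refine h.isUnit.mul_left_cancel ?_
  have h3 := mul_adj h.isUnit (adj Φ X)
  rw [h1] at h3
  have h4 := congrArg Matrix.transpose (mul_adj h.isUnit X)
  rw [Matrix.transpose_mul, Matrix.transpose_mul, Matrix.transpose_transpose] at h4
  calc Φ * (X * (Φ⁻¹ * Φ.transpose)) = Φ * X * Φ⁻¹ * Φ.transpose := by simp only [mul_assoc]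
    _ = (adj Φ X).transpose * Φ.transpose := by
      rw [h3, mul_assoc _ Φ, hi, mul_one]
    _ = Φ * Φ⁻¹ * Φ.transpose * X := by rw [h4, hi, one_mul]
    _ = _ := by simp only [mul_assoc]

variable [CommGroup G]

theorem IsPrimitive.adj (h : IsGradedInvolution 𝒜 Φ) {ε : Matrix ν ν F} (hε : IsPrimitive 𝒜 ε) :
    IsPrimitive 𝒜 (adj Φ ε) := by
  refine ⟨h.adj_mem hε.mem, by rw [← adj_mul h.isUnit, hε.mul_self], fun h0 => ?_, ?_⟩
  · apply hε.ne_zero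
    rw [← h.involutive ε, h0, adj_zero]
  · intro f hf hff hl hr
    have h1 := hε.eq_zero_or_eq (GradedMatrix.adj Φ f) (h.adj_mem hf)
      (by rw [← adj_mul h.isUnit, hff])
      (by rw [← h.involutive ε, ← adj_mul h.isUnit, hr])
      (by rw [← h.involutive ε, ← adj_mul h.isUnit, hl])
    rcases h1 with h1 | h1
    · left; rw [← h.involutive f, h1, adj_zero]
    · right; rw [← h1, h.involutive f]

/-- The graded division algebra `ε R ε` of a primitive idempotent `ε` is a fine component in a
suitable basis. The involution `φ` maps it to the isomorphic algebra `φ(ε) R φ(ε)`. An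
isomorphism between the two, the conjugation by homogeneous elements `u` and `v` of inverse
degrees, turns it into a degree-preserving antiautomorphism of `ε R ε`. -/
theorem exists_isFineComponent_corner [Fintype G] [IsAlgClosed F] (h2 : (2 : F) ≠ 0)
    (hgr : IsGrading 𝒜) (h : IsGradedInvolution 𝒜 Φ) {ε : Matrix ν ν F}
    (hε : IsPrimitive 𝒜 ε) :
    ∃ (d : ℕ) (J : Matrix ν (Fin d) F) (K : Matrix (Fin d) ν F), K * J = 1 ∧ J * K = ε ∧
      IsFineComponent (hε.support hgr) (corner 𝒜 J K) := by
  obtain ⟨d, J, K, hKJ, hJK⟩ := exists_factorization_of_idempotent hε.mul_self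
  have H := hε.isDivisionGrading_corner hgr hKJ hJK
  obtain ⟨g, u, hu, hu0, hul, hur⟩ := hε.exists_homogeneous hgr (hε.adj h)
  obtain ⟨v, hv, hvl, hvr, huv, hvu⟩ := hε.exists_inverse hgr (hε.adj h) hu hu0 hul hur
  have hΦ : Φ * Φ⁻¹ = 1 := Matrix.mul_nonsing_inv _ ((Matrix.isUnit_iff_isUnit_det Φ).1 h.isUnit)
  have hinv : (J.transpose * Φ * v * J) * (K * u * Φ⁻¹ * K.transpose) = 1 := by
    calc _ = J.transpose * Φ * v * (J * K) * u * Φ⁻¹ * K.transpose := by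
          simp only [Matrix.mul_assoc]
      _ = J.transpose * (Φ * GradedMatrix.adj Φ ε) * Φ⁻¹ * K.transpose := by
          rw [hJK, Matrix.mul_assoc _ v ε, hvr, Matrix.mul_assoc _ v u, hvu,
            Matrix.mul_assoc J.transpose]
      _ = (K * (J * K) * J).transpose := by
          rw [mul_adj h.isUnit, ← Matrix.mul_assoc, Matrix.mul_assoc _ Φ, hΦ, Matrix.mul_one,
            hJK, Matrix.transpose_mul, Matrix.transpose_mul, Matrix.mul_assoc]
      _ = 1 := by
          rw [← Matrix.mul_assoc, hKJ, Matrix.one_mul, hKJ, Matrix.transpose_one]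
  have hΨ : IsUnit (J.transpose * Φ * v * J) := IsUnit.of_mul_eq_one _ hinv
  obtain ⟨hT, Ψ, hΨu, hsymm, hpm⟩ := H.exists_symmetric h2 hΨ (by
    intro t Y hY
    rw [Matrix.inv_eq_right_inv hinv, mem_corner]
    have : J * (K * u * Φ⁻¹ * K.transpose * Y.transpose * (J.transpose * Φ * v * J)) * K =
        u * GradedMatrix.adj Φ (J * Y * K) * v := by
      calc _ = (J * K) * u * (Φ⁻¹ * (J * Y * K).transpose * Φ) * (v * (J * K)) := by
            simp only [Matrix.transpose_mul, Matrix.mul_assoc]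
        _ = _ := by rw [hJK, hul, hvr, GradedMatrix.adj]
    rw [this]
    have := hgr.mul_mem _ _ _ (hgr.mul_mem _ _ _ hu _ (h.adj_mem hY)) _ hv
    rwa [mul_comm g t, mul_inv_cancel_right] at this)
  obtain ⟨A, hA, hAΨ⟩ := exists_transpose_mul_mul_eq_one h2 hΨu hsymm
  have hAdet := (Matrix.isUnit_iff_isUnit_det A).1 hA
  have hAi : A * A⁻¹ = 1 := Matrix.mul_nonsing_inv _ hAdet
  have hiA : A⁻¹ * A = 1 := Matrix.nonsing_inv_mul _ hAdet
  have hKJ' : (A⁻¹ * K) * (J * A) = 1 := by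
    rw [Matrix.mul_assoc, ← Matrix.mul_assoc K, hKJ, Matrix.one_mul, hiA]
  have hJK' : (J * A) * (A⁻¹ * K) = ε := by
    rw [Matrix.mul_assoc, ← Matrix.mul_assoc A, hAi, Matrix.one_mul, hJK]
  have H' := hε.isDivisionGrading_corner hgr hKJ' hJK'
  refine ⟨d, J * A, A⁻¹ * K, hKJ', hJK', H'.isGrading, H'.support, H'.fine, hT, ?_⟩
  intro t _ Y hY
  have hY' : A * Y * A⁻¹ ∈ corner 𝒜 J K t := by
    rw [mem_corner]
    have : J * (A * Y * A⁻¹) * K = J * A * Y * (A⁻¹ * K) := by simp only [Matrix.mul_assoc]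
    rwa [this]
  -- `ᵗA Ψ A = 1` turns `Ψ` into the identity matrix
  have hl : A.transpose * ((A * Y * A⁻¹).transpose * Ψ) * A = Y.transpose := by
    calc _ = (A⁻¹ * (A * Y * A⁻¹) * A).transpose * (A.transpose * Ψ * A) := by
          have h3 : A⁻¹.transpose * A.transpose = 1 := by
            rw [← Matrix.transpose_mul, hAi, Matrix.transpose_one]
          rw [Matrix.transpose_mul _ A, Matrix.transpose_mul A⁻¹]
          simp only [mul_assoc]
          rw [← mul_assoc A⁻¹.transpose, h3, one_mul]
      _ = Y.transpose := by
          rw [hAΨ, mul_one]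
          congr 1
          rw [mul_assoc, mul_assoc (A * Y), hiA, mul_one, ← mul_assoc, hiA, one_mul]
  have hr : A.transpose * (Ψ * (A * Y * A⁻¹)) * A = Y := by
    calc _ = (A.transpose * Ψ * A) * Y * (A⁻¹ * A) := by simp only [mul_assoc]
      _ = Y := by rw [hAΨ, hiA, one_mul, mul_one]
  rcases hpm t _ hY' with h1 | h1
  · left; rw [← hl, h1, hr]
  · right; rw [← hl, h1, mul_neg, neg_mul, hr]

end Adj

/-! ### Decomposition of a graded matrix algebra into a tensor product -/

/-- The field, as an algebra of `1 × 1` matrices, with the trivial grading. -/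
theorem isFineComponent_trivial {F G : Type*} [Field F] [CommGroup G] [DecidableEq G] :
    IsFineComponent (⊥ : Subgroup G)
      (fun g : G => if g = 1 then (⊤ : Submodule F (Matrix (Fin 1) (Fin 1) F)) else ⊥) where
  isGrading := by
    refine ⟨fun g => ?_, ?_, fun g h a ha b hb => ?_⟩
    · by_cases hg : g = 1
      · have : ⨆ j, ⨆ (_ : j ≠ g), (if j = 1 then (⊤ : Submodule F (Matrix (Fin 1) (Fin 1) F))
            else ⊥) = ⊥ := by
          simp only [iSup_eq_bot]
          intro j hj
          rw [if_neg (hg ▸ hj)]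
        simp only [this]
        exact disjoint_bot_right
      · simp only [if_neg hg]
        exact disjoint_bot_left
    · exact eq_top_iff.2 (le_iSup_of_le 1 (by simp))
    · by_cases hg : g = 1 <;> by_cases hh : h = 1 <;> simp_all
  support g := by
    rw [Subgroup.mem_bot]
    by_cases hg : g = 1 <;> simp [hg]
  fine g hg := by
    rw [Subgroup.mem_bot] at hg
    rw [if_pos hg, finrank_top, Module.finrank_matrix]
    simp
  elementaryAbelian t ht := by
    rw [Subgroup.mem_bot] at ht
    simp [ht]
  symm_or_skew _ _ Y _ := Or.inl (by ext i j; rw [Subsingleton.elim i j, Matrix.transpose_apply])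

/-- If `1 = ∑ ε_i` with primitive idempotents `ε_i`, and `u_i` and `v_i` are mutually inverse
homogeneous elements of `ε R ε_i` and `ε_i R ε`, then `R` is the direct sum of the subspaces
`v_i (ε R ε) u_j`, which correspond to the subspaces `E_ij ⊗ D`. -/
theorem exists_isGradedConj {F G : Type*} [Field F] [IsAlgClosed F] (h2 : (2 : F) ≠ 0)
    [CommGroup G] [Finite G] {n : ℕ} {𝒜 : G → Submodule F (Matrix (Fin n) (Fin n) F)}
    {Φ : Matrix (Fin n) (Fin n) F} (hgr : IsGrading 𝒜) (h : IsGradedInvolution 𝒜 Φ) :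
    ∃ (d m : ℕ) (T : Subgroup G) (𝒟 : G → Submodule F (Matrix (Fin d) (Fin d) F))
      (γ : Fin m → G) (P : Matrix (Fin n) (Fin m × Fin d) F)
      (Q : Matrix (Fin m × Fin d) (Fin n) F),
      IsFineComponent T 𝒟 ∧ MeetsTrivially γ T ∧ IsGradedConj 𝒜 γ 𝒟 P Q := by
  classical
  have := Fintype.ofFinite G
  obtain ⟨s, hs, hso, hss, hsl⟩ := exists_sum_primitive 𝒜 1 hgr.one_mem (one_mul 1)
  rcases s.eq_empty_or_nonempty with rfl | ⟨ε, hεs⟩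
  · -- the algebra is zero, `n = 0`
    have h10 : (1 : Matrix (Fin n) (Fin n) F) = 0 := hss.symm
    have hX : ∀ X : Matrix (Fin n) (Fin n) F, X = 0 := fun X => by rw [← mul_one X, h10, mul_zero]
    refine ⟨1, 0, ⊥, _, Fin.elim0, 0, 0, isFineComponent_trivial, fun i => i.elim0, ?_, ?_, ?_⟩
    · rw [h10]; exact hX _
    · exact Subsingleton.elim _ _
    · intro g X
      rw [hX X]
      simp
  have hε := hs ε hεs
  obtain ⟨d, J, K, hKJ, hJK, hfine⟩ := exists_isFineComponent_corner h2 hgr h hε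
  set T := hε.support hgr
  let e := s.equivFin.symm
  let E : Fin s.card → Matrix (Fin n) (Fin n) F := fun i => e i
  have hE : ∀ i, IsPrimitive 𝒜 (E i) := fun i => hs _ (e i).2
  have hEE : ∀ i j, i ≠ j → E i * E j = 0 := fun i j hij =>
    hso _ (e i).2 _ (e j).2 fun h => hij (e.injective (Subtype.ext h))
  have hEsum : ∑ i, E i = 1 := by
    rw [← hss, ← Finset.sum_coe_sort s]
    exact Fintype.sum_equiv e _ _ fun i => rfl
  choose g₀ x₀ hx₀ hx₀0 hx₀l hx₀r using fun i => hε.exists_homogeneous hgr (hE i)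
  -- the degrees of `ε R ε_i` form a coset of `T`, of which a fixed representative is taken
  let γ : Fin s.card → G := fun i => (QuotientGroup.mk (g₀ i) : G ⧸ T).out
  have hγ : ∀ i, (QuotientGroup.mk (γ i) : G ⧸ T) = QuotientGroup.mk (g₀ i) :=
    fun i => Quotient.out_eq _
  have hu : ∀ i, ∃ u ∈ 𝒜 (γ i), u ≠ 0 ∧ ε * u = u ∧ u * E i = u := by
    intro i
    obtain ⟨⟨t, ht⟩, hgt⟩ := QuotientGroup.mk_out_eq_mul T (g₀ i)
    obtain ⟨x, hx, hx0, hxl, hxr⟩ := (hε.mem_support hgr).1 ht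
    refine ⟨x * x₀ i, ?_, fun h0 => ?_, by rw [← mul_assoc, hxl], by rw [mul_assoc, hx₀r]⟩
    · have h3 : γ i = t * g₀ i := by rw [mul_comm]; exact hgt
      rw [h3]
      exact hgr.mul_mem _ _ _ hx _ (hx₀ i)
    · obtain ⟨z, -, -, -, -, hzx⟩ := hε.exists_inverse hgr hε hx hx0 hxl hxr
      apply hx₀0 i
      rw [← hx₀l i, ← hzx, mul_assoc, h0, mul_zero]
  choose u hu hu0 hul hur using hu
  choose v hv hvl hvr huv hvu using fun i =>
    hε.exists_inverse hgr (hE i) (hu i) (hu0 i) (hul i) (hur i)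
  have huvij : ∀ i j, u i * v j = if i = j then ε else 0 := by
    intro i j
    split_ifs with hij
    · rw [hij, huv]
    · rw [← hur i, ← hvl j, mul_assoc, ← mul_assoc (E i), hEE i j hij, zero_mul, mul_zero]
  let P : Matrix (Fin n) (Fin s.card × Fin d) F := Matrix.of fun x p => (v p.1 * J) x p.2
  let Q : Matrix (Fin s.card × Fin d) (Fin n) F := Matrix.of fun p x => (K * u p.1) p.2 x
  have hblock : ∀ (X : Matrix (Fin n) (Fin n) F) i j, block (Q * X * P) i j = (K * u i) * X * (v j * J) := fun X i j => rfl
  have hcorner : ∀ (X : Matrix (Fin n) (Fin n) F) i j, J * ((K * u i) * X * (v j * J)) * K = u i * X * v j := by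
    intro X i j
    calc _ = (J * K) * u i * X * (v j * (J * K)) := by simp only [Matrix.mul_assoc]
      _ = _ := by rw [hJK, hul, hvr]
  refine ⟨d, s.card, T, corner 𝒜 J K, γ, P, Q, hfine, ?_, ?_, ?_, ?_⟩
  · intro i j hij
    rw [inv_mul_eq_one]
    have h3 : (QuotientGroup.mk (γ i) : G ⧸ T) = QuotientGroup.mk (γ j) := QuotientGroup.eq.2 hij
    rw [hγ, hγ] at h3
    exact congrArg Quotient.out h3
  · calc P * Q = ∑ i, (v i * J) * (K * u i) := by
          ext x y
          rw [Matrix.mul_apply, Fintype.sum_prod_type, Matrix.sum_apply]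
          rfl
      _ = 1 := by
          rw [← hEsum]
          refine Finset.sum_congr rfl fun i _ => ?_
          rw [Matrix.mul_assoc, ← Matrix.mul_assoc J, hJK, hul, hvu]
  · refine ext_block fun i j => ?_
    have h3 : block (Q * P) i j = K * (u i * v j) * J := by
      have := hblock 1 i j
      rw [Matrix.mul_one, Matrix.mul_one] at this
      rw [this]
      simp only [Matrix.mul_assoc]
    rw [h3, huvij, block_one]
    split_ifs
    · rw [← hJK, ← Matrix.mul_assoc, hKJ, Matrix.one_mul, hKJ]
    · rw [Matrix.mul_zero, Matrix.zero_mul]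
  · intro g X
    rw [tensorGrading_eq, mem_blockGrading]
    simp only [hblock, mem_corner, hcorner]
    constructor
    · intro hX i j
      exact hgr.mul_mem _ _ _ (hgr.mul_mem _ _ _ (hu i) _ hX) _ (hv j)
    · intro hX
      have h3 : X = ∑ i, ∑ j, v i * (u i * X * v j) * u j := by
        calc X = (∑ i, E i) * X * ∑ j, E j := by rw [hEsum, one_mul, mul_one]
          _ = _ := by
            rw [Finset.sum_mul, Finset.sum_mul]
            refine Finset.sum_congr rfl fun i _ => ?_
            rw [Finset.mul_sum]
            refine Finset.sum_congr rfl fun j _ => ?_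
            rw [← hvu i, ← hvu j]
            simp only [mul_assoc]
      rw [h3]
      refine Submodule.sum_mem _ fun i _ => Submodule.sum_mem _ fun j _ => ?_
      have h4 := hgr.mul_mem _ _ _ (hgr.mul_mem _ _ _ (hv i) _ (hX i j)) _ (hu j)
      have h5 : (γ i)⁻¹ * (γ i * g * (γ j)⁻¹) * γ j = g := by group
      rwa [h5] at h4

/-! ### The matrix of a graded involution is homogeneous -/

section Homogeneous

variable {F G ι δ : Type*} [Field F] [CommGroup G] [Fintype ι] [DecidableEq ι] [Fintype δ]
  [DecidableEq δ] {𝒟 : G → Submodule F (Matrix δ δ F)} {γ : ι → G}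

/-- The components `Φ_h` of the form `Φ` satisfy the same equations `ᵗX Φ_h = Φ_h φ(X)` as `Φ`
itself. Hence `Φ_h Φ⁻¹` commutes with all matrices, and `Φ_h` is a multiple of `Φ`. -/
theorem exists_mem_blockGrading [Finite G] (h : IsGrading 𝒟)
    (hT : ∀ t, ∀ Y ∈ 𝒟 t, Y.transpose ∈ 𝒟 t) {Φ : Matrix (ι × δ) (ι × δ) F} (hΦ : IsUnit Φ)
    (hgr : ∀ g, ∀ X ∈ tensorGrading γ 𝒟 g, ∃ Y ∈ tensorGrading γ 𝒟 g, X.transpose * Φ = Φ * Y) :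
    ∃ k, Φ ∈ blockGrading (fun i => (γ i)⁻¹) γ 𝒟 k := by
  have := Fintype.ofFinite G
  by_cases hΦ0 : Φ = 0
  · exact ⟨1, hΦ0 ▸ Submodule.zero_mem _⟩
  have hi : Φ * Φ⁻¹ = 1 := Matrix.mul_nonsing_inv _ ((Matrix.isUnit_iff_isUnit_det Φ).1 hΦ)
  have hi' : Φ⁻¹ * Φ = 1 := Matrix.nonsing_inv_mul _ ((Matrix.isUnit_iff_isUnit_det Φ).1 hΦ)
  obtain ⟨f, hf, hsum⟩ := blockGrading_exists_sum_eq (α := fun i => (γ i)⁻¹) (β := γ) h Φ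
  have hcomp : ∀ g, ∀ X ∈ tensorGrading γ 𝒟 g, ∀ Y ∈ tensorGrading γ 𝒟 g,
      X.transpose * Φ = Φ * Y → ∀ k, X.transpose * f k = f k * Y := by
    intro g X hX Y hY hXY k
    rw [tensorGrading_eq] at hX hY
    have h1 := blockGrading_eq_zero_of_sum_eq_zero h (α := fun i => (γ i)⁻¹) (β := γ)
      (f := fun l => X.transpose * f (l * g⁻¹) - f (l * g⁻¹) * Y) (fun l => ?_) ?_ (k * g)
    · simpa [sub_eq_zero] using h1
    · refine Submodule.sub_mem _ ?_ ?_
      · have := blockGrading_mul h (blockGrading_transpose hT hX) (hf (l * g⁻¹))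
        rwa [mul_comm g, inv_mul_cancel_right] at this
      · have := blockGrading_mul h (hf (l * g⁻¹)) hY
        rwa [inv_mul_cancel_right] at this
    · have h3 : ∑ l, f (l * g⁻¹) = Φ := by
        rw [← hsum]
        exact Fintype.sum_equiv (Equiv.mulRight g⁻¹) _ _ fun l => rfl
      rw [Finset.sum_sub_distrib, ← Matrix.mul_sum, ← Matrix.sum_mul, h3, hXY, sub_self]
  have hscalar : ∀ k, ∃ c : F, f k = c • Φ := by
    intro k
    have h1 : ∀ g, ∀ X ∈ tensorGrading γ 𝒟 g,
        X.transpose * (f k * Φ⁻¹) = f k * Φ⁻¹ * X.transpose := by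
      intro g X hX
      obtain ⟨Y, hY, hXY⟩ := hgr g X hX
      have h3 : Φ⁻¹ * X.transpose = Y * Φ⁻¹ := by
        calc Φ⁻¹ * X.transpose = Φ⁻¹ * (X.transpose * Φ) * Φ⁻¹ := by
              rw [mul_assoc, mul_assoc X.transpose, hi, mul_one]
          _ = Y * Φ⁻¹ := by rw [hXY, ← mul_assoc, hi', one_mul]
      rw [← mul_assoc, hcomp g X hX Y hY hXY, mul_assoc, mul_assoc, h3]
    have h3 : f k = f k * Φ⁻¹ * Φ := by rw [mul_assoc, hi', mul_one]
    generalize f k * Φ⁻¹ = M at h1 h3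
    have h4 := (isGrading_tensorGrading h).linearMap_eq_zero
      ((LinearMap.mulRight F M - LinearMap.mulLeft F M).comp
        (Matrix.transposeLinearEquiv _ _ F F).toLinearMap)
      (fun g X hX => by simpa [sub_eq_zero] using h1 g X hX)
    obtain ⟨c, rfl⟩ := exists_eq_smul_one_of_commute (M := M) fun X => by
      simpa [sub_eq_zero] using LinearMap.congr_fun h4 X.transpose
    exact ⟨c, by rw [h3, smul_one_mul]⟩
  obtain ⟨k, hk⟩ : ∃ k, f k ≠ 0 := by
    by_contra! hcon
    exact hΦ0 (by rw [← hsum, Finset.sum_eq_zero fun k _ => hcon k])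
  obtain ⟨c, hc⟩ := hscalar k
  have hc0 : c ≠ 0 := by
    rintro rfl
    exact hk (by rw [hc, zero_smul])
  refine ⟨k, ?_⟩
  rw [← inv_smul_smul₀ hc0 Φ, ← hc]
  exact Submodule.smul_mem _ _ (hf k)

theorem IsFineComponent.transpose_mem {d : ℕ} {T : Subgroup G}
    {𝒟 : G → Submodule F (Matrix (Fin d) (Fin d) F)} (h : IsFineComponent T 𝒟) (t : G)
    (Y : Matrix (Fin d) (Fin d) F) (hY : Y ∈ 𝒟 t) : Y.transpose ∈ 𝒟 t := by
  by_cases ht : t ∈ T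
  · rcases h.symm_or_skew t ht Y hY with h1 | h1 <;> rw [h1]
    · exact hY
    · exact Submodule.neg_mem _ hY
  · rw [h.isDivisionGrading.eq_zero_of_notMem hY ht, Matrix.transpose_zero]
    exact Submodule.zero_mem _

end Homogeneous

/-! ### Changes of the identification with a tensor product -/

section Conj

variable {F G ν ι : Type*} [Field F] [CommGroup G] [Fintype ν] [DecidableEq ν] [Fintype ι]
  [DecidableEq ι] {d : ℕ} {𝒜 : G → Submodule F (Matrix ν ν F)} {γ : ι → G}
  {𝒟 : G → Submodule F (Matrix (Fin d) (Fin d) F)} {P : Matrix ν (ι × Fin d) F}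
  {Q : Matrix (ι × Fin d) ν F} {Φ : Matrix ν ν F}

theorem IsGradedConj.isUnit (h : IsGradedConj 𝒜 γ 𝒟 P Q) (hΦ : IsUnit Φ) :
    IsUnit (P.transpose * Φ * P) := by
  refine IsUnit.of_mul_eq_one (Q * Φ⁻¹ * Q.transpose) ?_
  calc _ = P.transpose * (Φ * (P * Q) * Φ⁻¹) * Q.transpose := by simp only [Matrix.mul_assoc]
    _ = 1 := by
      rw [h.mul_eq_one, mul_one,
        Matrix.mul_nonsing_inv _ ((Matrix.isUnit_iff_isUnit_det Φ).1 hΦ), Matrix.mul_one,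
        ← Matrix.transpose_mul, h.mul_eq_one', Matrix.transpose_one]

theorem IsGradedConj.exists_mem_blockGrading [Finite G] (h : IsGradedConj 𝒜 γ 𝒟 P Q)
    {T : Subgroup G} (hD : IsFineComponent T 𝒟) (hΦ : IsGradedInvolution 𝒜 Φ) :
    ∃ k, P.transpose * Φ * P ∈ blockGrading (fun i => (γ i)⁻¹) γ 𝒟 k := by
  refine GradedMatrix.exists_mem_blockGrading hD.isGrading hD.transpose_mem (h.isUnit hΦ.isUnit) ?_
  intro g X hX
  have hX' : P * X * Q ∈ 𝒜 g := by
    rw [h.mem_iff]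
    have : Q * (P * X * Q) * P = (Q * P) * X * (Q * P) := by simp only [Matrix.mul_assoc]
    rwa [this, h.mul_eq_one', one_mul, mul_one]
  refine ⟨Q * adj Φ (P * X * Q) * P, (h.mem_iff _ _).1 (hΦ.adj_mem hX'), ?_⟩
  symm
  calc _ = P.transpose * Φ * (P * Q) * adj Φ (P * X * Q) * P := by simp only [Matrix.mul_assoc]
    _ = P.transpose * (P * X * Q).transpose * Φ * P := by
      rw [h.mul_eq_one, Matrix.mul_one, Matrix.mul_assoc P.transpose, mul_adj hΦ.isUnit,
        ← Matrix.mul_assoc]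
    _ = (P * X * (Q * P)).transpose * Φ * P := by
      rw [← Matrix.transpose_mul, Matrix.mul_assoc (P * X)]
    _ = _ := by rw [h.mul_eq_one', Matrix.mul_one, Matrix.transpose_mul]; simp only [Matrix.mul_assoc]

theorem IsGradedConj.reindex {κ : Type*} [Fintype κ] [DecidableEq κ]
    (h : IsGradedConj 𝒜 γ 𝒟 P Q) (σ : κ ≃ ι) :
    IsGradedConj 𝒜 (γ ∘ σ) 𝒟 (P.submatrix id (σ.prodCongr (Equiv.refl (Fin d))))
      (Q.submatrix (σ.prodCongr (Equiv.refl (Fin d))) id) where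
  mul_eq_one := by rw [Matrix.submatrix_mul_equiv, h.mul_eq_one, Matrix.submatrix_id_id]
  mul_eq_one' := by
    rw [← Matrix.submatrix_mul _ _ _ _ _ Function.bijective_id, h.mul_eq_one',
      Matrix.submatrix_one_equiv]
  mem_iff g X := by
    have h1 : Q.submatrix (σ.prodCongr (Equiv.refl (Fin d))) id * X *
        P.submatrix id (σ.prodCongr (Equiv.refl (Fin d))) =
          (Q * X * P).submatrix (σ.prodCongr (Equiv.refl (Fin d)))
            (σ.prodCongr (Equiv.refl (Fin d))) := rfl
    rw [h.mem_iff, h1, tensorGrading_eq, tensorGrading_eq, mem_blockGrading, mem_blockGrading]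
    refine ⟨fun hM i j => hM (σ i) (σ j), fun hM i j => ?_⟩
    have := hM (σ.symm i) (σ.symm j)
    rw [Function.comp_apply, Function.comp_apply, σ.apply_symm_apply, σ.apply_symm_apply] at this
    have h3 : ∀ M : Matrix (ι × Fin d) (ι × Fin d) F,
        block (M.submatrix (σ.prodCongr (Equiv.refl (Fin d))) (σ.prodCongr (Equiv.refl (Fin d))))
          (σ.symm i) (σ.symm j) = block M i j := by
      intro M
      ext a b
      simp [block]
    rwa [h3] at this

/-- A conjugation by a homogeneous element of degree `1` preserves the grading. -/
theorem IsGradedConj.mul (h : IsGradedConj 𝒜 γ 𝒟 P Q) (hD : IsGrading 𝒟)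
    {A A' : Matrix (ι × Fin d) (ι × Fin d) F} (hA : A ∈ blockGrading γ γ 𝒟 1)
    (hA' : A' ∈ blockGrading γ γ 𝒟 1) (hAA' : A * A' = 1) (hA'A : A' * A = 1) :
    IsGradedConj 𝒜 γ 𝒟 (P * A) (A' * Q) where
  mul_eq_one := by
    rw [Matrix.mul_assoc, ← Matrix.mul_assoc A, hAA', Matrix.one_mul, h.mul_eq_one]
  mul_eq_one' := by
    rw [Matrix.mul_assoc, ← Matrix.mul_assoc Q, h.mul_eq_one', Matrix.one_mul, hA'A]
  mem_iff g X := by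
    have h1 : A' * Q * X * (P * A) = A' * (Q * X * P) * A := by simp only [Matrix.mul_assoc]
    have h3 : A * (A' * (Q * X * P) * A) * A' = Q * X * P := by
      calc _ = (A * A') * (Q * X * P) * (A * A') := by simp only [Matrix.mul_assoc]
        _ = _ := by rw [hAA', one_mul, mul_one]
    rw [h.mem_iff, h1, tensorGrading_eq]
    constructor
    · intro hM
      simpa using blockGrading_mul hD (blockGrading_mul hD hA' hM) hA
    · intro hM
      have := blockGrading_mul hD (blockGrading_mul hD hA hM) hA'
      rw [h3] at this
      simpa using this

end Conj

/-! ### Block diagonal forms -/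

namespace BlockTuple

variable {F G : Type*} [Field F] (B : BlockTuple G) {d : ℕ}
  (S S' : (b : B.Block) → Matrix (Fin (B.size b)) (Fin (B.size b)) F)
  (X X' : B.Block → Matrix (Fin d) (Fin d) F)

theorem block_form_same (b : B.Block) (a a' : Fin (B.size b)) :
    block (B.form S X) ⟨b, a⟩ ⟨b, a'⟩ = S b a a' • X b := by
  rw [form, block_sum, Finset.sum_eq_single b]
  · rw [block_kronecker, Matrix.blockDiagonal'_apply_eq, Pi.single_eq_same]
  · intro c _ hc
    rw [block_kronecker, Matrix.blockDiagonal'_apply_eq, Pi.single_eq_of_ne hc.symm]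
    simp
  · simp

theorem block_form_ne {b b' : B.Block} (hb : b ≠ b') (a : Fin (B.size b)) (a' : Fin (B.size b')) :
    block (B.form S X) ⟨b, a⟩ ⟨b', a'⟩ = 0 := by
  rw [form, block_sum]
  refine Finset.sum_eq_zero fun c _ => ?_
  rw [block_kronecker, Matrix.blockDiagonal'_apply_ne _ _ _ hb, zero_smul]

theorem form_mul : B.form S X * B.form S' X' = B.form (fun b => S b * S' b) fun b => X b * X' b := by
  refine ext_block ?_
  rintro ⟨b, a⟩ ⟨b', a'⟩
  rw [block_mul, Fintype.sum_sigma, Finset.sum_eq_single b]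
  · rcases eq_or_ne b b' with rfl | hb
    · simp only [block_form_same, Matrix.mul_apply, Finset.sum_smul, Matrix.smul_mul,
        Matrix.mul_smul, smul_smul, mul_comm]
    · simp only [block_form_ne _ _ _ hb, mul_zero, Finset.sum_const_zero]
  · intro c _ hc
    simp only [block_form_ne _ _ _ hc.symm, zero_mul, Finset.sum_const_zero]
  · simp

theorem form_one : B.form (fun _ => (1 : Matrix _ _ F)) (fun _ => (1 : Matrix (Fin d) (Fin d) F)) =
    1 := by
  refine ext_block ?_
  rintro ⟨b, a⟩ ⟨b', a'⟩
  rw [block_one]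
  rcases eq_or_ne b b' with rfl | hb
  · rw [block_form_same, Matrix.one_apply]
    by_cases ha : a = a' <;> simp [ha]
  · rw [block_form_ne _ _ _ hb, if_neg]
    simp [hb]

theorem form_transpose : (B.form S X).transpose =
    B.form (fun b => (S b).transpose) fun b => (X b).transpose := by
  refine ext_block ?_
  rintro ⟨b, a⟩ ⟨b', a'⟩
  rw [block_transpose]
  rcases eq_or_ne b b' with rfl | hb
  · rw [block_form_same, block_form_same, Matrix.transpose_smul, Matrix.transpose_apply]
  · rw [block_form_ne _ _ _ hb, block_form_ne _ _ _ hb.symm, Matrix.transpose_zero]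

end BlockTuple

/-! ### Arrangement of a tuple into blocks -/

section Partner

variable {F G ι : Type*} [Field F] [CommGroup G] [Fintype ι] [DecidableEq ι] {d : ℕ}
  {T : Subgroup G} {𝒟 : G → Submodule F (Matrix (Fin d) (Fin d) F)} {γ : ι → G}
  {Φ : Matrix (ι × Fin d) (ι × Fin d) F} {k : G}

/-- For a nondegenerate homogeneous form `Φ` of degree `k`, each entry `γ_i` of the tuple
determines the entry `s(γ_i)` that is paired with it, because `γ_i⁻¹ k γ_j⁻¹ ∈ T` fixes the coset of
`γ_j` modulo `T`, which contains only one entry of the tuple. -/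
theorem exists_partner (hD : IsDivisionGrading T 𝒟) (hγ : MeetsTrivially γ T) (hu : IsUnit Φ)
    (hΦ : Φ ∈ blockGrading (fun i => (γ i)⁻¹) γ 𝒟 k) :
    ∃ s : G → G, (∀ i, ∃ j, γ j = s (γ i)) ∧
      ∀ i j, (γ i)⁻¹ * k * (γ j)⁻¹ ∈ T ↔ γ j = s (γ i) := by
  have hd := hD.nonempty
  have hex : ∀ i, ∃ j, (γ i)⁻¹ * k * (γ j)⁻¹ ∈ T := by
    intro i
    by_contra! hcon
    have h1 : block (Φ * Φ⁻¹) i i = 0 := by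
      rw [block_mul]
      refine Finset.sum_eq_zero fun j _ => ?_
      rw [hD.eq_zero_of_notMem (hΦ i j) (hcon j), zero_mul]
    rw [Matrix.mul_nonsing_inv _ ((Matrix.isUnit_iff_isUnit_det Φ).1 hu), block_one,
      if_pos rfl] at h1
    exact one_ne_zero h1
  have huniq : ∀ i j j', (γ i)⁻¹ * k * (γ j)⁻¹ ∈ T → (γ i)⁻¹ * k * (γ j')⁻¹ ∈ T → γ j = γ j' := by
    intro i j j' h1 h3
    have h4 := T.mul_mem h1 (T.inv_mem h3)
    have h5 : (γ i)⁻¹ * k * (γ j)⁻¹ * ((γ i)⁻¹ * k * (γ j')⁻¹)⁻¹ = (γ j)⁻¹ * γ j' := by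
      rw [mul_inv, mul_inv, inv_inv, inv_inv]
      calc _ = ((γ i)⁻¹ * γ i) * (k * k⁻¹) * ((γ j)⁻¹ * γ j') := by ac_rfl
        _ = _ := by simp
    rw [h5] at h4
    exact inv_mul_eq_one.1 (hγ j j' h4)
  have hG : ∀ a : G, ∃ b : G, ∀ i, γ i = a → ∃ j, γ j = b ∧ (γ i)⁻¹ * k * (γ j)⁻¹ ∈ T := by
    intro a
    by_cases ha : ∃ i, γ i = a
    · obtain ⟨i, rfl⟩ := ha
      obtain ⟨j, hj⟩ := hex i
      exact ⟨γ j, fun i' hi' => ⟨j, rfl, hi' ▸ hj⟩⟩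
    · exact ⟨1, fun i hi => absurd ⟨i, hi⟩ ha⟩
  choose s hs using hG
  refine ⟨s, fun i => ?_, fun i j => ⟨fun hij => ?_, fun hij => ?_⟩⟩
  · obtain ⟨j, hj, -⟩ := hs (γ i) i rfl
    exact ⟨j, hj⟩
  · obtain ⟨j', hj', h1⟩ := hs (γ i) i rfl
    rw [← hj']
    exact huniq i j j' hij h1
  · obtain ⟨j', hj', h1⟩ := hs (γ i) i rfl
    rwa [hij, ← hj']

/-- The blocks of `Φ` for two paired entries of the tuple are multiples `s_ij X` of the same invertible
matrix `X`, and the matrix `(s_ij)` has a right inverse, because `Φ` does. -/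
theorem card_fiber_le_card_fiber [Finite G] [DecidableEq G] (hD : IsDivisionGrading T 𝒟)
    (hu : IsUnit Φ)
    (hΦ : Φ ∈ blockGrading (fun i => (γ i)⁻¹) γ 𝒟 k) {s : G → G}
    (hex : ∀ i, ∃ j, γ j = s (γ i))
    (hs : ∀ i j, (γ i)⁻¹ * k * (γ j)⁻¹ ∈ T ↔ γ j = s (γ i)) (i₀ : ι) :
    Fintype.card {j // γ j = γ i₀} ≤ Fintype.card {j // γ j = s (γ i₀)} := by
  have := Fintype.ofFinite G
  have hd := hD.nonempty
  obtain ⟨j₀, hj₀⟩ := hex i₀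
  obtain ⟨X, hX, hX0⟩ := hD.exists_ne_zero ((hs i₀ j₀).2 hj₀)
  obtain ⟨Z, -, hXZ, hZX⟩ := hD.exists_inverse hX hX0
  obtain ⟨p, q, hpq⟩ : ∃ p q, Z p q ≠ 0 := by
    by_contra! hcon
    have hZ0 : Z = 0 := Matrix.ext hcon
    rw [hZ0, mul_zero] at hXZ
    exact zero_ne_one hXZ
  have hc : ∀ (i : {j // γ j = γ i₀}) (j : {j // γ j = s (γ i₀)}),
      ∃ c : F, c • X = block Φ i j := by
    intro i j
    have : block Φ i j ∈ 𝒟 ((γ i)⁻¹ * k * (γ j)⁻¹) := hΦ i j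
    rw [i.2, j.2.trans hj₀.symm, hD.eq_span hX hX0] at this
    exact Submodule.mem_span_singleton.1 this
  choose c hc using hc
  refine card_le_of_mul_eq_smul_one (A := Matrix.of c)
    (B := Matrix.of fun j l => block Φ⁻¹ j l p q) hpq ?_
  ext i l
  have h1 : block (Φ * Φ⁻¹) i l = if i = l then 1 else 0 := by
    rw [Matrix.mul_nonsing_inv _ ((Matrix.isUnit_iff_isUnit_det Φ).1 hu), block_one]
    simp only [Subtype.ext_iff]
  rw [block_mul, ← Finset.sum_subset (Finset.subset_univ
    (Finset.univ.filter fun j => γ j = s (γ i₀))), Finset.sum_subtype (p := fun j => γ j = s (γ i₀))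
      _ (by simp)] at h1
  · have h3 := congrArg (fun M => (Z * M) p q) h1
    simp only [← hc, Finset.mul_sum, Matrix.smul_mul, Matrix.mul_smul, ← mul_assoc, hZX, one_mul,
      mul_ite, mul_one, mul_zero, Matrix.sum_apply, Matrix.smul_apply, smul_eq_mul] at h3
    rw [Matrix.mul_apply]
    simp only [Matrix.of_apply]
    rw [h3, Matrix.smul_apply, Matrix.one_apply, smul_eq_mul]
    split_ifs <;> simp
  · intro j _ hj
    have hj' : ¬ γ j = s (γ i₀) := by simpa using hj
    have h3 : block Φ i j = 0 := by
      refine hD.eq_zero_of_notMem (hΦ i j) fun h => hj' ?_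
      rw [← i.2]
      exact (hs i j).1 h
    rw [h3, zero_mul]

end Partner

namespace BlockTuple

variable {G : Type*} (B : BlockTuple G)

theorem tuple_inl (j : Fin B.l) (a : Fin (B.size (Sum.inl j))) :
    B.tuple ⟨Sum.inl j, a⟩ = B.g j := rfl

theorem tuple_castAdd (j : Fin B.m) (a : Fin (B.p (Sum.inr j))) :
    B.tuple ⟨Sum.inr j, Fin.castAdd _ a⟩ = B.g' j := if_pos a.2

theorem tuple_natAdd (j : Fin B.m) (a : Fin (B.p (Sum.inr j))) :
    B.tuple ⟨Sum.inr j, Fin.natAdd _ a⟩ = B.g'' j := if_neg (by simp)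

/-- A case distinction by the block and, in the blocks with two different entries, by the half. -/
theorem index_cases {motive : B.Index → Prop} (inl : ∀ j a, motive ⟨Sum.inl j, a⟩)
    (castAdd : ∀ j (a : Fin (B.p (Sum.inr j))), motive ⟨Sum.inr j, Fin.castAdd _ a⟩)
    (natAdd : ∀ j (a : Fin (B.p (Sum.inr j))), motive ⟨Sum.inr j, Fin.natAdd _ a⟩) :
    ∀ x, motive x := by
  rintro ⟨j | j, a⟩
  · exact inl j a
  · exact Fin.addCases (motive := fun a => motive ⟨Sum.inr j, a⟩) (castAdd j) (natAdd j) a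

variable {B}

theorem Distinct.g_inj (hB : B.Distinct) {i j} (h : B.g i = B.g j) : i = j :=
  Sum.inl_injective (@hB (Sum.inl i) (Sum.inl j) h)

theorem Distinct.g'_inj (hB : B.Distinct) {i j} (h : B.g' i = B.g' j) : i = j := by
  simpa using @hB (Sum.inr (Sum.inl i)) (Sum.inr (Sum.inl j)) h

theorem Distinct.g''_inj (hB : B.Distinct) {i j} (h : B.g'' i = B.g'' j) : i = j := by
  simpa using @hB (Sum.inr (Sum.inr i)) (Sum.inr (Sum.inr j)) h

theorem Distinct.g_ne_g' (hB : B.Distinct) (i j) : B.g i ≠ B.g' j := fun h => by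
  simpa using @hB (Sum.inl i) (Sum.inr (Sum.inl j)) h

theorem Distinct.g_ne_g'' (hB : B.Distinct) (i j) : B.g i ≠ B.g'' j := fun h => by
  simpa using @hB (Sum.inl i) (Sum.inr (Sum.inr j)) h

theorem Distinct.g'_ne_g'' (hB : B.Distinct) (i j) : B.g' i ≠ B.g'' j := fun h => by
  simpa using @hB (Sum.inr (Sum.inl i)) (Sum.inr (Sum.inr j)) h

variable (B)

theorem exists_index_equiv [DecidableEq G] {ι : Type*} [Fintype ι] {γ : ι → G}
    (hB : B.Distinct)
    (hcov : ∀ i, (∃ j, γ i = B.g j) ∨ (∃ j, γ i = B.g' j) ∨ ∃ j, γ i = B.g'' j)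
    (hp : ∀ j, Fintype.card {i // γ i = B.g j} = B.p (Sum.inl j))
    (hp' : ∀ j, Fintype.card {i // γ i = B.g' j} = B.p (Sum.inr j))
    (hp'' : ∀ j, Fintype.card {i // γ i = B.g'' j} = B.p (Sum.inr j)) :
    ∃ σ : B.Index ≃ ι, ∀ x, γ (σ x) = B.tuple x := by
  let e : ∀ j, Fin (B.p (Sum.inl j)) ≃ {i // γ i = B.g j} :=
    fun j => (Fintype.equivFinOfCardEq (hp j)).symm
  let e' : ∀ j, Fin (B.p (Sum.inr j)) ≃ {i // γ i = B.g' j} :=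
    fun j => (Fintype.equivFinOfCardEq (hp' j)).symm
  let e'' : ∀ j, Fin (B.p (Sum.inr j)) ≃ {i // γ i = B.g'' j} :=
    fun j => (Fintype.equivFinOfCardEq (hp'' j)).symm
  let f : B.Index → ι := fun x => match x with
    | ⟨Sum.inl j, a⟩ => e j a
    | ⟨Sum.inr j, a⟩ => if ha : a.val < B.p (Sum.inr j) then e' j ⟨a, ha⟩
        else e'' j ⟨a - B.p (Sum.inr j), by
          have : a.val < B.p (Sum.inr j) + B.p (Sum.inr j) := a.2
          omega⟩
  have hfl : ∀ j a, f ⟨Sum.inl j, a⟩ = e j a := fun _ _ => rfl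
  have hf' : ∀ j (a : Fin (B.p (Sum.inr j))), f ⟨Sum.inr j, Fin.castAdd _ a⟩ = e' j a := by
    intro j a
    exact dif_pos a.2
  have hf'' : ∀ j (a : Fin (B.p (Sum.inr j))), f ⟨Sum.inr j, Fin.natAdd _ a⟩ = e'' j a := by
    intro j a
    refine (dif_neg (by simp)).trans ?_
    congr 2
    simp
  have hft : ∀ x, γ (f x) = B.tuple x := by
    refine B.index_cases (fun j a => ?_) (fun j a => ?_) fun j a => ?_
    · exact (e j a).2
    · rw [hf', (e' j a).2, tuple_castAdd]
    · rw [hf'', (e'' j a).2, tuple_natAdd]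
  have hinj : Function.Injective f := by
    intro x y hxy
    have ht : B.tuple x = B.tuple y := by rw [← hft, ← hft, hxy]
    revert x y
    refine B.index_cases (fun j a => ?_) (fun j a => ?_) fun j a => ?_ <;>
      refine B.index_cases (fun i c => ?_) (fun i c => ?_) fun i c => ?_ <;> intro hxy ht <;>
      simp only [tuple_inl, tuple_castAdd, tuple_natAdd] at ht
    · obtain rfl := hB.g_inj ht
      rw [(e j).injective (Subtype.ext hxy)]
    · exact absurd ht (hB.g_ne_g' _ _)
    · exact absurd ht (hB.g_ne_g'' _ _)
    · exact absurd ht.symm (hB.g_ne_g' _ _)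
    · obtain rfl := hB.g'_inj ht
      rw [hf', hf'] at hxy
      rw [(e' j).injective (Subtype.ext hxy)]
    · exact absurd ht (hB.g'_ne_g'' _ _)
    · exact absurd ht.symm (hB.g_ne_g'' _ _)
    · exact absurd ht.symm (hB.g'_ne_g'' _ _)
    · obtain rfl := hB.g''_inj ht
      rw [hf'', hf''] at hxy
      rw [(e'' j).injective (Subtype.ext hxy)]
  have hsurj : Function.Surjective f := by
    intro i
    rcases hcov i with ⟨j, hj⟩ | ⟨j, hj⟩ | ⟨j, hj⟩
    · exact ⟨⟨Sum.inl j, (e j).symm ⟨i, hj⟩⟩, (hfl j _).trans (by rw [Equiv.apply_symm_apply])⟩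
    · exact ⟨⟨Sum.inr j, Fin.castAdd _ ((e' j).symm ⟨i, hj⟩)⟩, by rw [hf']; simp⟩
    · exact ⟨⟨Sum.inr j, Fin.natAdd _ ((e'' j).symm ⟨i, hj⟩)⟩, by rw [hf'']; simp⟩
  exact ⟨Equiv.ofBijective f ⟨hinj, hsurj⟩, hft⟩

end BlockTuple

/-- The entries of the tuple which are their own partners give the first `l` blocks. The other
entries are arranged in pairs; an enumeration of the group selects the first entry of each. -/
theorem exists_blockTuple {G ι : Type*} [Finite G] [DecidableEq G] [Fintype ι] {γ : ι → G}
    {s : G → G} (hex : ∀ i, ∃ j, γ j = s (γ i)) (hss : ∀ i, s (s (γ i)) = γ i)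
    (hcard : ∀ i, Fintype.card {j // γ j = γ i} = Fintype.card {j // γ j = s (γ i)}) :
    ∃ (B : BlockTuple G) (σ : B.Index ≃ ι), (∀ x, γ (σ x) = B.tuple x) ∧ B.Distinct ∧
      (∀ i, s (B.g i) = B.g i) ∧ ∀ j, s (B.g' j) = B.g'' j ∧ s (B.g'' j) = B.g' j := by
  let r : G ≃ Fin (Nat.card G) := Finite.equivFin G
  let R := Finset.univ.image γ
  let R₁ := R.filter fun a => s a = a
  let R₂ := R.filter fun a => r a < r (s a)
  have hR : ∀ {a}, a ∈ R → ∃ i, γ i = a := fun ha => by simpa [R] using ha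
  have hRγ : ∀ i, γ i ∈ R := fun i => Finset.mem_image_of_mem γ (Finset.mem_univ i)
  let g : Fin R₁.card → G := fun i => R₁.equivFin.symm i
  let g' : Fin R₂.card → G := fun j => R₂.equivFin.symm j
  have hg : ∀ i, g i ∈ R ∧ s (g i) = g i := fun i =>
    (Finset.mem_filter (p := fun a => s a = a)).1 (R₁.equivFin.symm i).2
  have hg' : ∀ i, g' i ∈ R ∧ r (g' i) < r (s (g' i)) := fun i =>
    Finset.mem_filter.1 (R₂.equivFin.symm i).2
  have hginj : Function.Injective g := Subtype.val_injective.comp R₁.equivFin.symm.injective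
  have hg'inj : Function.Injective g' := Subtype.val_injective.comp R₂.equivFin.symm.injective
  have hsR : ∀ {a}, a ∈ R → s (s a) = a := fun ha => by
    obtain ⟨i, rfl⟩ := hR ha
    exact hss i
  have hpos : ∀ {a}, a ∈ R → 0 < Fintype.card {j // γ j = a} := fun ha => by
    obtain ⟨i, hi⟩ := hR ha
    exact Fintype.card_pos_iff.2 ⟨⟨i, hi⟩⟩
  let B : BlockTuple G :=
    { l := R₁.card
      m := R₂.card
      p := Sum.elim (fun i => Fintype.card {j // γ j = g i}) fun i => Fintype.card {j // γ j = g' i}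
      p_pos := by
        rintro (i | i)
        · exact hpos (hg i).1
        · exact hpos (hg' i).1
      g := g
      g' := g'
      g'' := fun j => s (g' j) }
  have hB : B.Distinct := by
    have h1 : ∀ i j, g i ≠ g' j := fun i j h => by
      have h3 := (hg' j).2
      rw [← h, (hg i).2] at h3
      exact lt_irrefl _ h3
    have h3 : ∀ i j, g i ≠ s (g' j) := fun i j h => by
      have h4 := (hg i).2
      rw [h, hsR (hg' j).1] at h4
      have h5 := (hg' j).2
      rw [← h4] at h5
      exact lt_irrefl _ h5
    have h4 : ∀ i j, g' i ≠ s (g' j) := fun i j h => by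
      have h5 := (hg' i).2
      rw [h, hsR (hg' j).1] at h5
      exact lt_asymm h5 (hg' j).2
    rintro (i | i | i) (j | j | j) hij
    · exact congrArg _ (hginj hij)
    · exact absurd hij (h1 i j)
    · exact absurd hij (h3 i j)
    · exact absurd hij.symm (h1 j i)
    · exact congrArg _ (congrArg _ (hg'inj hij))
    · exact absurd hij (h4 i j)
    · exact absurd hij.symm (h3 j i)
    · exact absurd hij.symm (h4 j i)
    · have h5 : s (g' i) = s (g' j) := hij
      have h6 : g' i = g' j := by rw [← hsR (hg' i).1, h5, hsR (hg' j).1]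
      exact congrArg _ (congrArg _ (hg'inj h6))
  have hcov : ∀ i, (∃ j, γ i = B.g j) ∨ (∃ j, γ i = B.g' j) ∨ ∃ j, γ i = B.g'' j := by
    intro i
    rcases lt_trichotomy (r (γ i)) (r (s (γ i))) with h | h | h
    · right; left
      have : γ i ∈ R₂ := Finset.mem_filter.2 ⟨hRγ i, h⟩
      exact ⟨R₂.equivFin ⟨γ i, this⟩, by simp [B, g']⟩
    · left
      have : γ i ∈ R₁ := Finset.mem_filter.2 ⟨hRγ i, (r.injective h).symm⟩
      exact ⟨R₁.equivFin ⟨γ i, this⟩, by simp [B, g]⟩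
    · right; right
      obtain ⟨k, hk⟩ := hex i
      have : s (γ i) ∈ R₂ := Finset.mem_filter.2 ⟨hk ▸ hRγ k, by rwa [hss]⟩
      exact ⟨R₂.equivFin ⟨s (γ i), this⟩, by simp [B, g', hss]⟩
  obtain ⟨σ, hσ⟩ := B.exists_index_equiv hB hcov (fun j => rfl) (fun j => rfl) (fun j => by
    obtain ⟨i, hi⟩ := hR (hg' j).1
    have h1 := hcard i
    rw [hi] at h1
    exact h1.symm)
  exact ⟨B, σ, hσ, hB, fun i => (hg i).2, fun j => ⟨rfl, hsR (hg' j).1⟩⟩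

/-! ### The canonical form -/

namespace BlockTuple

variable {F G : Type*} [Field F] (B : BlockTuple G) {d : ℕ}

theorem size_pos (b : B.Block) : 0 < B.size b := by
  rcases b with i | j
  · exact B.p_pos _
  · exact Nat.add_pos_left (B.p_pos _) _

/-- The blocks of a nondegenerate block diagonal form are nondegenerate. -/
theorem isUnit_of_isUnit_form [Nonempty (Fin d)]
    {S : (b : B.Block) → Matrix (Fin (B.size b)) (Fin (B.size b)) F}
    {X : B.Block → Matrix (Fin d) (Fin d) F} (hu : IsUnit (B.form S X)) (hX : ∀ b, IsUnit (X b))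
    (b : B.Block) : IsUnit (S b) := by
  obtain ⟨Z, hZX⟩ := (hX b).exists_left_inv
  obtain ⟨p, q, hpq⟩ : ∃ p q, Z p q ≠ 0 := by
    by_contra! hcon
    have hZ0 : Z = 0 := Matrix.ext hcon
    rw [hZ0, zero_mul] at hZX
    exact zero_ne_one hZX
  obtain ⟨M, hM⟩ := hu.exists_right_inv
  refine IsUnit.of_mul_eq_one ((Z p q)⁻¹ • Matrix.of fun a a' => block M ⟨b, a⟩ ⟨b, a'⟩ p q) ?_
  ext a a'
  have h1 : block (B.form S X * M) ⟨b, a⟩ ⟨b, a'⟩ = if a = a' then 1 else 0 := by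
    rw [hM, block_one]
    by_cases ha : a = a' <;> simp [ha]
  rw [block_mul, Fintype.sum_sigma, Finset.sum_eq_single b
    (fun c _ hc => by simp only [B.block_form_ne S X hc.symm, zero_mul, Finset.sum_const_zero])
    (by simp)] at h1
  have h3 := congrArg (fun M => (Z * M) p q) h1
  simp only [block_form_same, Finset.mul_sum, Matrix.smul_mul, Matrix.mul_smul, ← mul_assoc, hZX,
    one_mul, mul_ite, mul_one, mul_zero, Matrix.sum_apply, Matrix.smul_apply, smul_eq_mul] at h3
  rw [Matrix.mul_smul, Matrix.smul_apply, Matrix.mul_apply]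
  simp only [Matrix.of_apply]
  rw [h3, Matrix.one_apply]
  split_ifs <;> simp [hpq]

theorem form_one_mem_blockGrading [CommGroup G]
    {𝒟 : G → Submodule F (Matrix (Fin d) (Fin d) F)}
    (h1 : (1 : Matrix (Fin d) (Fin d) F) ∈ 𝒟 1)
    {A : (b : B.Block) → Matrix (Fin (B.size b)) (Fin (B.size b)) F}
    (hA : ∀ b a a', B.tuple ⟨b, a⟩ ≠ B.tuple ⟨b, a'⟩ → A b a a' = 0) :
    B.form A (fun _ => 1) ∈ blockGrading B.tuple B.tuple 𝒟 1 := by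
  rintro ⟨b, a⟩ ⟨b', a'⟩
  rcases eq_or_ne b b' with rfl | hb
  · rw [block_form_same]
    by_cases ht : B.tuple ⟨b, a⟩ = B.tuple ⟨b, a'⟩
    · rw [ht, mul_one, mul_inv_cancel]
      exact Submodule.smul_mem _ _ h1
    · rw [hA b a a' ht, zero_smul]
      exact Submodule.zero_mem _
  · rw [block_form_ne _ _ _ hb]
    exact Submodule.zero_mem _

end BlockTuple

/-- A symmetric or skew-symmetric matrix `[[0, N], [c ᵗN, 0]]` is congruent to `[[0, I], [c I, 0]]`
by means of the block diagonal matrix `diag(I, N⁻¹)`. -/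
theorem exists_congruence_isOffDiag {F : Type*} [Field F] {p : ℕ} {c : F}
    {S : Matrix (Fin (p + p)) (Fin (p + p)) F} (hS : IsUnit S) (hST : S.transpose = c • S)
    (h₁ : ∀ i j, S (Fin.castAdd p i) (Fin.castAdd p j) = 0)
    (h₂ : ∀ i j, S (Fin.natAdd p i) (Fin.natAdd p j) = 0) :
    ∃ A A' : Matrix (Fin (p + p)) (Fin (p + p)) F, A * A' = 1 ∧ A' * A = 1 ∧
      (∀ i j, A (Fin.castAdd p i) (Fin.natAdd p j) = 0 ∧
        A' (Fin.castAdd p i) (Fin.natAdd p j) = 0) ∧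
      (∀ i j, A (Fin.natAdd p i) (Fin.castAdd p j) = 0 ∧
        A' (Fin.natAdd p i) (Fin.castAdd p j) = 0) ∧ IsOffDiag c (A.transpose * S * A) := by
  let e : Fin p ⊕ Fin p ≃ Fin (p + p) := finSumFinEquiv
  let N : Matrix (Fin p) (Fin p) F := S.submatrix (Fin.castAdd p) (Fin.natAdd p)
  have hSN : S.submatrix e e = Matrix.fromBlocks 0 N (c • N.transpose) 0 := by
    ext (i | i) (j | j)
    · exact h₁ i j
    · rfl
    · exact congrFun (congrFun hST (Fin.castAdd p j)) (Fin.natAdd p i)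
    · exact h₂ i j
  have hN : IsUnit N := by
    obtain ⟨M, hM⟩ := hS.exists_right_inv
    have h3 : S.submatrix e e * M.submatrix e e = 1 := by
      rw [Matrix.submatrix_mul_equiv, hM, Matrix.submatrix_one_equiv]
    rw [hSN, ← Matrix.fromBlocks_toBlocks (M.submatrix e e), Matrix.fromBlocks_multiply,
      ← Matrix.fromBlocks_one, Matrix.fromBlocks_inj] at h3
    have h4 := h3.1
    rw [zero_mul, zero_add] at h4
    exact IsUnit.of_mul_eq_one _ h4
  have hdet := (Matrix.isUnit_iff_isUnit_det N).1 hN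
  have hi : N * N⁻¹ = 1 := Matrix.mul_nonsing_inv _ hdet
  have hi' : N⁻¹ * N = 1 := Matrix.nonsing_inv_mul _ hdet
  let A : Matrix (Fin p ⊕ Fin p) (Fin p ⊕ Fin p) F := Matrix.fromBlocks 1 0 0 N⁻¹
  let A' : Matrix (Fin p ⊕ Fin p) (Fin p ⊕ Fin p) F := Matrix.fromBlocks 1 0 0 N
  have hmul : ∀ M M' : Matrix (Fin p ⊕ Fin p) (Fin p ⊕ Fin p) F,
      M.submatrix e.symm e.symm * M'.submatrix e.symm e.symm = (M * M').submatrix e.symm e.symm :=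
    fun M M' => Matrix.submatrix_mul_equiv _ _ _ _ _
  refine ⟨A.submatrix e.symm e.symm, A'.submatrix e.symm e.symm, ?_, ?_, ?_, ?_, p, rfl, ?_⟩
  · rw [hmul, Matrix.fromBlocks_multiply]
    simp [hi', Matrix.submatrix_one_equiv]
  · rw [hmul, Matrix.fromBlocks_multiply]
    simp [hi, Matrix.submatrix_one_equiv]
  · intro i j
    simp only [Matrix.submatrix_apply, e, finSumFinEquiv_symm_apply_castAdd,
      finSumFinEquiv_symm_apply_natAdd, A, A', Matrix.fromBlocks_apply₁₂, Matrix.zero_apply,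
      and_self]
  · intro i j
    simp only [Matrix.submatrix_apply, e, finSumFinEquiv_symm_apply_castAdd,
      finSumFinEquiv_symm_apply_natAdd, A, A', Matrix.fromBlocks_apply₂₁, Matrix.zero_apply,
      and_self]
  · have h3 : S = (S.submatrix e e).submatrix e.symm e.symm := by simp
    rw [Matrix.transpose_submatrix, h3, hmul, hmul, hSN]
    have h4 : A.transpose * Matrix.fromBlocks 0 N (c • N.transpose) 0 * A =
        Matrix.fromBlocks 0 1 (c • 1) 0 := by
      rw [Matrix.fromBlocks_transpose, Matrix.fromBlocks_multiply, Matrix.fromBlocks_multiply]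
      simp [hi, ← Matrix.transpose_mul]
    rw [h4]
    rfl

theorem transpose_eq_iff {F α : Type*} [Field F] {M : Matrix α α F}
    (hM : M ≠ 0) {c : F} (hc : M.transpose = c • M) :
    (M.transpose = M ↔ c = 1) ∧ (M.transpose = -M ↔ c = -1) := by
  constructor
  · rw [hc]
    refine ⟨fun h => ?_, fun h => by rw [h, one_smul]⟩
    have h3 : (c - 1) • M = 0 := by rw [sub_smul, h, one_smul, sub_self]
    exact sub_eq_zero.1 ((smul_eq_zero.1 h3).resolve_right hM)
  · rw [hc]
    refine ⟨fun h => ?_, fun h => by rw [h, neg_smul, one_smul]⟩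
    have h3 : (c + 1) • M = 0 := by rw [add_smul, h, one_smul, neg_add_cancel]
    exact eq_neg_of_add_eq_zero_left ((smul_eq_zero.1 h3).resolve_right hM)

/-- The matrix of a homogeneous form for a tuple arranged in blocks is a block diagonal form
`∑ S_b ⊗ X_b`. In a block with two different entries of the tuple, `S_b` pairs the first half with
the second. -/
theorem exists_eq_form {F G : Type*} [Field F] [CommGroup G] {d : ℕ} {T : Subgroup G}
    {𝒟 : G → Submodule F (Matrix (Fin d) (Fin d) F)} (hD : IsDivisionGrading T 𝒟)
    {B : BlockTuple G} (hB : B.Distinct) {s : G → G} (hsg : ∀ i, s (B.g i) = B.g i)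
    (hsg' : ∀ j, s (B.g' j) = B.g'' j ∧ s (B.g'' j) = B.g' j) {k : G}
    {Φ : Matrix (B.Index × Fin d) (B.Index × Fin d) F}
    (hΦ : Φ ∈ blockGrading (fun x => (B.tuple x)⁻¹) B.tuple 𝒟 k)
    (hs : ∀ x y, (B.tuple x)⁻¹ * k * (B.tuple y)⁻¹ ∈ T ↔ B.tuple y = s (B.tuple x)) :
    ∃ (t : B.Block → G) (S : (b : B.Block) → Matrix (Fin (B.size b)) (Fin (B.size b)) F)
      (X : B.Block → Matrix (Fin d) (Fin d) F),
      (∀ b, t b ∈ T) ∧ (∀ b, B.weight t b = k) ∧ (∀ b, X b ∈ 𝒟 (t b)) ∧ (∀ b, X b ≠ 0) ∧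
      Φ = B.form S X ∧
      (∀ j a a', S (Sum.inr j) (Fin.castAdd _ a) (Fin.castAdd _ a') = 0) ∧
      ∀ j a a', S (Sum.inr j) (Fin.natAdd _ a) (Fin.natAdd _ a') = 0 := by
  let t : B.Block → G := Sum.elim (fun i => (B.g i)⁻¹ * k * (B.g i)⁻¹)
    fun j => (B.g' j)⁻¹ * k * (B.g'' j)⁻¹
  have ht : ∀ b, t b ∈ T := by
    rintro (i | j)
    · exact (hs ⟨Sum.inl i, ⟨0, B.p_pos _⟩⟩ ⟨Sum.inl i, ⟨0, B.p_pos _⟩⟩).2 (hsg i).symm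
    · have := (hs ⟨Sum.inr j, Fin.castAdd _ ⟨0, B.p_pos _⟩⟩
        ⟨Sum.inr j, Fin.natAdd _ ⟨0, B.p_pos _⟩⟩).2
      rw [B.tuple_castAdd, B.tuple_natAdd] at this
      exact this (hsg' j).1.symm
  choose X hX hX0 using fun b => hD.exists_ne_zero (ht b)
  have hpair : ∀ x y, block Φ x y ≠ 0 → B.tuple y = s (B.tuple x) := fun x y hxy =>
    (hs x y).1 (hD.mem_of_ne_zero (hΦ x y) hxy)
  have hblock : ∀ x y, B.tuple y = s (B.tuple x) →
      x.1 = y.1 ∧ (B.tuple x)⁻¹ * k * (B.tuple y)⁻¹ = t x.1 := by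
    refine B.index_cases (fun j a => ?_) (fun j a => ?_) fun j a => ?_ <;>
      refine B.index_cases (fun i c => ?_) (fun i c => ?_) fun i c => ?_ <;>
      simp only [B.tuple_inl, B.tuple_castAdd, B.tuple_natAdd, hsg, hsg'] <;> intro h
    · exact ⟨by rw [hB.g_inj h], by rw [h]; rfl⟩
    · exact absurd h.symm (hB.g_ne_g' _ _)
    · exact absurd h.symm (hB.g_ne_g'' _ _)
    · exact absurd h (hB.g_ne_g'' _ _)
    · exact absurd h (hB.g'_ne_g'' _ _)
    · exact ⟨by rw [hB.g''_inj h], by rw [h]; rfl⟩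
    · exact absurd h (hB.g_ne_g' _ _)
    · refine ⟨by rw [hB.g'_inj h], ?_⟩
      rw [h]
      change (B.g'' j)⁻¹ * k * (B.g' j)⁻¹ = (B.g' j)⁻¹ * k * (B.g'' j)⁻¹
      ac_rfl
    · exact absurd h.symm (hB.g'_ne_g'' _ _)
  have hcoef : ∀ (b : B.Block) (a a' : Fin (B.size b)), ∃ c : F,
      c • X b = block Φ ⟨b, a⟩ ⟨b, a'⟩ := by
    intro b a a'
    by_cases h0 : block Φ ⟨b, a⟩ ⟨b, a'⟩ = 0
    · exact ⟨0, by rw [h0, zero_smul]⟩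
    · have h1 : block Φ ⟨b, a⟩ ⟨b, a'⟩ ∈ 𝒟 ((B.tuple ⟨b, a⟩)⁻¹ * k * (B.tuple ⟨b, a'⟩)⁻¹) :=
        hΦ _ _
      rw [(hblock _ _ (hpair _ _ h0)).2, hD.eq_span (hX b) (hX0 b)] at h1
      exact Submodule.mem_span_singleton.1 h1
  choose S hS using hcoef
  refine ⟨t, fun b => Matrix.of (S b), X, ht, ?_, hX, hX0, ?_, fun j a a' => ?_,
    fun j a a' => ?_⟩
  · rintro (i | j)
    · change B.g i ^ 2 * ((B.g i)⁻¹ * k * (B.g i)⁻¹) = k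
      rw [pow_two]
      calc _ = (B.g i * (B.g i)⁻¹) * (B.g i * (B.g i)⁻¹) * k := by ac_rfl
        _ = k := by simp
    · change B.g' j * B.g'' j * ((B.g' j)⁻¹ * k * (B.g'' j)⁻¹) = k
      calc _ = (B.g' j * (B.g' j)⁻¹) * (B.g'' j * (B.g'' j)⁻¹) * k := by ac_rfl
        _ = k := by simp
  · refine ext_block ?_
    rintro ⟨b, a⟩ ⟨b', a'⟩
    rcases eq_or_ne b b' with rfl | hb
    · rw [B.block_form_same, Matrix.of_apply, hS]
    · rw [B.block_form_ne _ _ hb]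
      by_contra h0
      exact hb (hblock _ _ (hpair _ _ h0)).1
  · refine (smul_eq_zero.1 ((hS (Sum.inr j) (Fin.castAdd _ a) (Fin.castAdd _ a')).trans ?_)
      ).resolve_right (hX0 _)
    by_contra h0
    have h1 := hpair _ _ h0
    rw [B.tuple_castAdd, B.tuple_castAdd, (hsg' j).1] at h1
    exact hB.g'_ne_g'' _ _ h1
  · refine (smul_eq_zero.1 ((hS (Sum.inr j) (Fin.natAdd _ a) (Fin.natAdd _ a')).trans ?_)
      ).resolve_right (hX0 _)
    by_contra h0
    have h1 := hpair _ _ h0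
    rw [B.tuple_natAdd, B.tuple_natAdd, (hsg' j).2] at h1
    exact hB.g'_ne_g'' _ _ h1.symm

/-- The normal form of a single block. The congruence respects the identity component of the
elementary grading: it does not mix positions with different entries of the tuple. -/
theorem exists_block_congruence {F G : Type*} [Field F] [IsAlgClosed F] (h2 : (2 : F) ≠ 0)
    (B : BlockTuple G) (b : B.Block) {S : Matrix (Fin (B.size b)) (Fin (B.size b)) F}
    (hS : IsUnit S) {c : F} (hc : c = 1 ∨ c = -1) (hST : S.transpose = c • S)
    (h₁ : ∀ x y : Fin (B.size b), b.isRight → B.tuple ⟨b, x⟩ = B.tuple ⟨b, y⟩ → S x y = 0) :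
    ∃ A A' S' : Matrix (Fin (B.size b)) (Fin (B.size b)) F, A * A' = 1 ∧ A' * A = 1 ∧
      (∀ x y, B.tuple ⟨b, x⟩ ≠ B.tuple ⟨b, y⟩ → A x y = 0) ∧
      (∀ x y, B.tuple ⟨b, x⟩ ≠ B.tuple ⟨b, y⟩ → A' x y = 0) ∧
      A.transpose * S * A = S' ∧
      (b.isLeft ∧ S' = 1 ∨ b.isRight ∧ IsOffDiag 1 S' ∨ IsOffDiag (-1) S') := by
  rcases b with i | j
  · have hconst : ∀ x y, B.tuple ⟨Sum.inl i, x⟩ = B.tuple ⟨Sum.inl i, y⟩ := fun _ _ => rfl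
    rcases hc with rfl | rfl
    · rw [one_smul] at hST
      obtain ⟨A, hA, hAS⟩ := exists_transpose_mul_mul_eq_one h2 hS hST
      have hdet := (Matrix.isUnit_iff_isUnit_det A).1 hA
      exact ⟨A, A⁻¹, _, Matrix.mul_nonsing_inv _ hdet, Matrix.nonsing_inv_mul _ hdet,
        fun x y h => absurd (hconst x y) h, fun x y h => absurd (hconst x y) h, rfl,
        Or.inl ⟨rfl, hAS⟩⟩
    · rw [neg_smul, one_smul] at hST
      obtain ⟨A, hA, hAS⟩ := exists_transpose_mul_mul_isOffDiag h2 hS hST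
      have hdet := (Matrix.isUnit_iff_isUnit_det A).1 hA
      exact ⟨A, A⁻¹, _, Matrix.mul_nonsing_inv _ hdet, Matrix.nonsing_inv_mul _ hdet,
        fun x y h => absurd (hconst x y) h, fun x y h => absurd (hconst x y) h, rfl,
        Or.inr (Or.inr hAS)⟩
  · obtain ⟨A, A', hAA', hA'A, hcn, hnc, hoff⟩ := exists_congruence_isOffDiag
      (p := B.p (Sum.inr j)) hS hST
      (fun x y => h₁ _ _ rfl (by rw [B.tuple_castAdd, B.tuple_castAdd]))
      (fun x y => h₁ _ _ rfl (by rw [B.tuple_natAdd, B.tuple_natAdd]))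
    have hAA : ∀ x y : Fin (B.p (Sum.inr j) + B.p (Sum.inr j)),
        B.tuple ⟨Sum.inr j, x⟩ ≠ B.tuple ⟨Sum.inr j, y⟩ → A x y = 0 ∧ A' x y = 0 := by
      intro x y
      refine Fin.addCases (fun x => ?_) (fun x => ?_) x <;>
        refine Fin.addCases (fun y => ?_) (fun y => ?_) y <;> intro h
      · exact absurd (by rw [B.tuple_castAdd, B.tuple_castAdd]) h
      · exact hcn x y
      · exact hnc x y
      · exact absurd (by rw [B.tuple_natAdd, B.tuple_natAdd]) h
    refine ⟨A, A', _, hAA', hA'A, fun x y h => (hAA x y h).1, fun x y h => (hAA x y h).2, rfl,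
      Or.inr ?_⟩
    rcases hc with rfl | rfl
    · exact Or.inl ⟨rfl, hoff⟩
    · exact Or.inr hoff

/-- The homogeneous form `Φ` is block diagonal after a permutation of the tuple, and the congruences
that normalize its blocks preserve the grading. -/
theorem exists_canonical_form {F G : Type*} [Field F] [IsAlgClosed F] (h2 : (2 : F) ≠ 0)
    [CommGroup G] [Finite G] {ν ι : Type*} [Fintype ν] [DecidableEq ν] [Fintype ι] [DecidableEq ι]
    {𝒜 : G → Submodule F (Matrix ν ν F)} {Φ : Matrix ν ν F} (h : IsGradedInvolution 𝒜 Φ) {d : ℕ}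
    {T : Subgroup G} {𝒟 : G → Submodule F (Matrix (Fin d) (Fin d) F)} {γ : ι → G}
    {P₀ : Matrix ν (ι × Fin d) F} {Q₀ : Matrix (ι × Fin d) ν F} (hF : IsFineComponent T 𝒟)
    (hγ : MeetsTrivially γ T) (hP₀ : IsGradedConj 𝒜 γ 𝒟 P₀ Q₀) :
    ∃ (B : BlockTuple G) (σ : B.Index ≃ ι) (t : B.Block → G)
      (S : (b : B.Block) → Matrix (Fin (B.size b)) (Fin (B.size b)) F)
      (X : B.Block → Matrix (Fin d) (Fin d) F)
      (P : Matrix ν (B.Index × Fin d) F) (Q : Matrix (B.Index × Fin d) ν F),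
      (∀ a, γ (σ a) = B.tuple a) ∧ B.Distinct ∧ IsCanonical T 𝒟 B t S X ∧
      (∀ i : Fin B.l, S (Sum.inl i) = 1 ∨ IsOffDiag (-1) (S (Sum.inl i))) ∧
      IsGradedConj 𝒜 B.tuple 𝒟 P Q ∧
      P.transpose * Φ * P = B.form S X ∧
      ((Φ.transpose = Φ ∧ ∀ b, SameSymmetry (S b) (X b)) ∨
        (Φ.transpose = -Φ ∧ ∀ b, OppositeSymmetry (S b) (X b))) := by
  classical
  have := Fintype.ofFinite G
  have hD := hF.isDivisionGrading
  have hd := hD.nonempty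
  obtain ⟨k, hk⟩ := hP₀.exists_mem_blockGrading hF h
  have hu₀ := hP₀.isUnit h.isUnit
  obtain ⟨s, hex, hs⟩ := exists_partner hD hγ hu₀ hk
  have hss : ∀ i, s (s (γ i)) = γ i := by
    intro i
    obtain ⟨j, hj⟩ := hex i
    have h1 := (hs i j).2 hj
    rw [← hj]
    have h3 : (γ j)⁻¹ * k * (γ i)⁻¹ = (γ i)⁻¹ * k * (γ j)⁻¹ := by ac_rfl
    exact ((hs j i).1 (h3 ▸ h1)).symm
  have hcard : ∀ i, Fintype.card {j // γ j = γ i} = Fintype.card {j // γ j = s (γ i)} := by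
    intro i
    refine le_antisymm (card_fiber_le_card_fiber hD hu₀ hk hex hs i) ?_
    obtain ⟨j, hj⟩ := hex i
    have h1 := card_fiber_le_card_fiber hD hu₀ hk hex hs j
    simpa only [hj, hss] using h1
  obtain ⟨B, σ, hσ, hB, hsg, hsg'⟩ := exists_blockTuple hex hss hcard
  have hP₁ := hP₀.reindex σ
  have hγσ : γ ∘ σ = B.tuple := funext hσ
  rw [hγσ] at hP₁
  set P₁ := P₀.submatrix id (σ.prodCongr (Equiv.refl (Fin d)))
  set Q₁ := Q₀.submatrix (σ.prodCongr (Equiv.refl (Fin d))) id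
  have hu := hP₁.isUnit h.isUnit
  have hΦ₁ : P₁.transpose * Φ * P₁ ∈ blockGrading (fun x => (B.tuple x)⁻¹) B.tuple 𝒟 k := by
    intro x y
    have := hk (σ x) (σ y)
    simp only [hσ] at this
    exact this
  obtain ⟨t, S₀, X, ht, hw, hX, hX0, hform, hcc, hnn⟩ := exists_eq_form hD hB hsg hsg' hΦ₁
    fun x y => by simpa only [hσ] using hs (σ x) (σ y)
  have hXu : ∀ b, IsUnit (X b) := fun b => hD.isUnit (hX b) (hX0 b)
  have hS₀u := B.isUnit_of_isUnit_form (hform ▸ hu) hXu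
  obtain ⟨ε, hε, hΦε⟩ : ∃ ε : F, (ε = 1 ∨ ε = -1) ∧ Φ.transpose = ε • Φ := by
    rcases h.transpose_eq with h1 | h1
    · exact ⟨1, Or.inl rfl, by rw [h1, one_smul]⟩
    · exact ⟨-1, Or.inr rfl, by rw [h1, neg_smul, one_smul]⟩
  have hη : ∀ b, ∃ η : F, (η = 1 ∨ η = -1) ∧ (X b).transpose = η • X b := by
    intro b
    rcases hF.symm_or_skew _ (ht b) _ (hX b) with h1 | h1
    · exact ⟨1, Or.inl rfl, by rw [h1, one_smul]⟩
    · exact ⟨-1, Or.inr rfl, by rw [h1, neg_smul, one_smul]⟩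
  choose η hη hXη using hη
  have hηη : ∀ b, η b * η b = 1 := fun b => by rcases hη b with h1 | h1 <;> simp [h1]
  have hS₀T : ∀ b, (S₀ b).transpose = (ε * η b) • S₀ b := by
    intro b
    have h1 : (B.form S₀ X).transpose = ε • B.form S₀ X := by
      rw [← hform, Matrix.transpose_mul, Matrix.transpose_mul, Matrix.transpose_transpose, hΦε,
        Matrix.smul_mul, Matrix.mul_smul, Matrix.mul_assoc]
    rw [B.form_transpose] at h1
    ext a a'
    have h3 : block (B.form (fun b => (S₀ b).transpose) fun b => (X b).transpose) ⟨b, a⟩ ⟨b, a'⟩ =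
        ε • block (B.form S₀ X) ⟨b, a⟩ ⟨b, a'⟩ := by rw [h1]; rfl
    rw [B.block_form_same, B.block_form_same, hXη, smul_smul, smul_smul] at h3
    have h4 := smul_left_injective F (hX0 b) h3
    rw [Matrix.smul_apply, smul_eq_mul]
    linear_combination (η b) * h4 - (S₀ b).transpose a a' * hηη b
  have hεη : ∀ b, ε * η b = 1 ∨ ε * η b = -1 := by
    intro b
    rcases hε with h1 | h1 <;> rcases hη b with h3 | h3 <;> simp [h1, h3]
  have hnorm := fun b => exists_block_congruence h2 B b (hS₀u b) (hεη b) (hS₀T b) (by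
    rcases b with i | j
    · intro x y hb
      exact absurd hb (by simp)
    · intro x y _
      change Fin (B.p (Sum.inr j) + B.p (Sum.inr j)) at x y
      refine Fin.addCases (fun x => ?_) (fun x => ?_) x <;>
        refine Fin.addCases (fun y => ?_) (fun y => ?_) y <;> intro hxy
      · exact hcc j x y
      · rw [B.tuple_castAdd, B.tuple_natAdd] at hxy
        exact absurd hxy (hB.g'_ne_g'' _ _)
      · rw [B.tuple_castAdd, B.tuple_natAdd] at hxy
        exact absurd hxy.symm (hB.g'_ne_g'' _ _)
      · exact hnn j x y)
  choose A A' S hAA' hA'A hA hA' hAS hSform using hnorm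
  have hST : ∀ b, (S b).transpose = (ε * η b) • S b := by
    intro b
    rw [← hAS b, Matrix.transpose_mul, Matrix.transpose_mul, Matrix.transpose_transpose, hS₀T,
      Matrix.smul_mul, Matrix.mul_smul, Matrix.mul_assoc]
  have hS0 : ∀ b, S b ≠ 0 := by
    intro b
    have : Nonempty (Fin (B.size b)) := ⟨⟨0, B.size_pos b⟩⟩
    have hAu : IsUnit (A b) := IsUnit.of_mul_eq_one _ (hAA' b)
    rw [← hAS b]
    exact ((((Matrix.isUnit_transpose _).2 hAu).mul (hS₀u b)).mul hAu).ne_zero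
  have hone := hD.isGrading.one_mem
  have hmul : ∀ C C' : (b : B.Block) → Matrix (Fin (B.size b)) (Fin (B.size b)) F,
      (∀ b, C b * C' b = 1) → B.form C (fun _ => (1 : Matrix (Fin d) (Fin d) F)) *
        B.form C' (fun _ => 1) = 1 := by
    intro C C' hC
    rw [B.form_mul, ← B.form_one]
    simp only [hC, mul_one]
  refine ⟨B, σ, t, S, X, _, _, hσ, hB, ⟨ht, fun b => hD.eq_span (hX b) (hX0 b), ?_, ?_, ?_⟩, ?_,
    hP₁.mul hD.isGrading (B.form_one_mem_blockGrading hone hA)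
      (B.form_one_mem_blockGrading hone hA') (hmul A A' hAA') (hmul A' A hA'A), ?_, ?_⟩
  · intro i
    rcases hSform (Sum.inl i) with h1 | h1 | h1
    · exact Or.inl h1.2
    · exact Or.inr (Or.inl h1.2)
    · exact Or.inr (Or.inr h1)
  · intro j
    rcases hSform (Sum.inr j) with h1 | h1 | h1
    · exact absurd h1.1 (by simp)
    · exact Or.inl h1.2
    · exact Or.inr h1
  · intro b b'
    rw [hw, hw]
  · intro i
    rcases hSform (Sum.inl i) with h1 | h1 | h1
    · exact Or.inl h1.2
    · exact absurd h1.1 (by simp)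
    · exact Or.inr h1
  · calc _ = (B.form A fun _ => 1).transpose * (P₁.transpose * Φ * P₁) * B.form A fun _ => 1 := by
          rw [Matrix.transpose_mul]; simp only [Matrix.mul_assoc]
      _ = B.form S X := by
          rw [hform, B.form_transpose, B.form_mul, B.form_mul]
          simp only [Matrix.transpose_one, one_mul, mul_one, hAS]
  · have hSiff := fun b => transpose_eq_iff (hS0 b) (hST b)
    have hXiff := fun b => transpose_eq_iff (hX0 b) (hXη b)
    rcases hε with rfl | rfl
    · left
      refine ⟨by rw [hΦε, one_smul], fun b => ?_⟩
      have h1 := hSiff b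
      rw [one_mul] at h1
      exact ⟨h1.1.trans (hXiff b).1.symm, h1.2.trans (hXiff b).2.symm⟩
    · right
      refine ⟨by rw [hΦε, neg_smul, one_smul], fun b => ?_⟩
      have h1 := hSiff b
      rw [neg_one_mul] at h1
      exact ⟨h1.1.trans (neg_eq_iff_eq_neg.trans (hXiff b).2.symm),
        h1.2.trans (neg_inj.trans (hXiff b).1.symm)⟩

/-! ### Graded involutions defined by canonical forms -/

theorem isOffDiag_iff {F : Type*} [Field F] {ε : F} {p : ℕ}
    {S : Matrix (Fin (p + p)) (Fin (p + p)) F} : IsOffDiag ε S ↔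
      S = (Matrix.fromBlocks 0 1 (ε • 1) 0 :
        Matrix (Fin p ⊕ Fin p) (Fin p ⊕ Fin p) F).submatrix finSumFinEquiv.symm
          finSumFinEquiv.symm := by
  constructor
  · rintro ⟨h, e, rfl⟩
    obtain rfl : h = p := by omega
    rfl
  · intro h
    exact ⟨p, rfl, h⟩

theorem IsOffDiag.transpose_eq_and_isUnit {F : Type*} [Field F] {ε : F} {N : ℕ}
    {S : Matrix (Fin N) (Fin N) F} (hS : IsOffDiag ε S) (hε : ε * ε = 1) :
    S.transpose = ε • S ∧ IsUnit S := by
  obtain ⟨p, rfl, -⟩ := id hS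
  rw [isOffDiag_iff] at hS
  have hT : S.transpose = ε • S := by
    have h1 : (Matrix.fromBlocks 0 1 (ε • 1) 0 :
        Matrix (Fin p ⊕ Fin p) (Fin p ⊕ Fin p) F).transpose =
          ε • Matrix.fromBlocks 0 1 (ε • 1) 0 := by
      rw [Matrix.fromBlocks_transpose, Matrix.fromBlocks_smul]
      simp [smul_smul, hε]
    rw [hS, Matrix.transpose_submatrix, h1]
    rfl
  refine ⟨hT, IsUnit.of_mul_eq_one S.transpose ?_⟩
  rw [hS, Matrix.transpose_submatrix, Matrix.fromBlocks_transpose, Matrix.submatrix_mul_equiv,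
    Matrix.fromBlocks_multiply]
  simp [smul_smul, hε, Matrix.submatrix_one_equiv]

theorem isGradedInvolution_of_mem_blockGrading {F G ι δ : Type*} [Field F] [CommGroup G]
    [Finite G] [Fintype ι] [DecidableEq ι] [Fintype δ] [DecidableEq δ]
    {𝒟 : G → Submodule F (Matrix δ δ F)} {γ : ι → G} (h : IsGrading 𝒟)
    (hT : ∀ t, ∀ Y ∈ 𝒟 t, Y.transpose ∈ 𝒟 t) {Φ : Matrix (ι × δ) (ι × δ) F} (hu : IsUnit Φ)
    (hsymm : Φ.transpose = Φ ∨ Φ.transpose = -Φ) {k : G}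
    (hΦ : Φ ∈ blockGrading (fun i => (γ i)⁻¹) γ 𝒟 k) :
    IsGradedInvolution (tensorGrading γ 𝒟) Φ := by
  have := Fintype.ofFinite G
  have hinv : Function.Involutive (adj Φ) := by
    intro X
    refine hu.mul_left_cancel ?_
    rw [mul_adj hu]
    have h1 := congrArg Matrix.transpose (mul_adj hu X)
    rw [Matrix.transpose_mul, Matrix.transpose_mul, Matrix.transpose_transpose] at h1
    rcases hsymm with h3 | h3
    · rwa [h3] at h1
    · rw [h3, mul_neg, neg_mul] at h1
      exact neg_injective h1
  -- the identity `Φ φ(X) = ᵗX Φ` shows that `φ` preserves degrees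
  have hmem : ∀ g, ∀ X ∈ tensorGrading γ 𝒟 g, adj Φ X ∈ tensorGrading γ 𝒟 g := by
    intro g X hX
    obtain ⟨f, hf, hsum⟩ := blockGrading_exists_sum_eq (α := γ) (β := γ) h (adj Φ X)
    rw [tensorGrading_eq] at hX ⊢
    have h1 : ∑ l, Φ * f (k⁻¹ * l) = X.transpose * Φ := by
      rw [← Matrix.mul_sum, ← mul_adj hu, ← hsum]
      congr 1
      exact Fintype.sum_equiv (Equiv.mulLeft k⁻¹) _ _ fun l => rfl
    have h3 : ∀ l, l ≠ g → f l = 0 := by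
      intro l hl
      have h4 := apply_eq_zero_of_sum_mem (ℳ := blockGrading (fun i => (γ i)⁻¹) γ 𝒟)
        (fun f hf => blockGrading_eq_zero_of_sum_eq_zero h hf)
        (f := fun l => Φ * f (k⁻¹ * l)) (k := k * g) (g := k * l) (fun l => ?_) ?_ (by simpa using hl)
      · rw [inv_mul_cancel_left] at h4
        exact hu.mul_left_cancel (h4.trans (mul_zero Φ).symm)
      · have := blockGrading_mul h hΦ (hf (k⁻¹ * l))
        rwa [mul_inv_cancel_left] at this
      · rw [h1, mul_comm]
        exact blockGrading_mul h (blockGrading_transpose hT hX) hΦ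
    rw [← hsum, Finset.sum_eq_single g (fun l _ hl => h3 l hl) (by simp)]
    exact hf g
  refine ⟨hu, hinv, fun g => Set.Subset.antisymm ?_ fun X hX => ?_⟩
  · rintro _ ⟨X, hX, rfl⟩
    exact hmem g X hX
  · exact ⟨adj Φ X, hmem g X hX, hinv X⟩

/-- The condition that all blocks have the same weight means that the form is homogeneous. -/
theorem IsCanonical.exists_mem_blockGrading {F G : Type*} [Field F] [CommGroup G] {d : ℕ}
    {T : Subgroup G} {𝒟 : G → Submodule F (Matrix (Fin d) (Fin d) F)} {B : BlockTuple G}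
    {t : B.Block → G} {S : (b : B.Block) → Matrix (Fin (B.size b)) (Fin (B.size b)) F}
    {X : B.Block → Matrix (Fin d) (Fin d) F} (h : IsCanonical T 𝒟 B t S X) :
    ∃ k, B.form S X ∈ blockGrading (fun x => (B.tuple x)⁻¹) B.tuple 𝒟 k := by
  obtain ⟨k, hk⟩ : ∃ k, ∀ b, B.weight t b = k := by
    by_cases hB : Nonempty B.Block
    · exact ⟨B.weight t hB.some, fun b => h.weight_eq b _⟩
    · exact ⟨1, fun b => absurd ⟨b⟩ hB⟩
  have hX : ∀ b, X b ∈ 𝒟 (t b) := fun b => by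
    rw [h.span_eq]
    exact Submodule.mem_span_singleton_self _
  refine ⟨k, ?_⟩
  rintro ⟨b, a⟩ ⟨b', a'⟩
  rcases eq_or_ne b b' with rfl | hb
  swap
  · rw [B.block_form_ne _ _ hb]
    exact Submodule.zero_mem _
  rw [B.block_form_same]
  by_cases h0 : S b a a' = 0
  · rw [h0, zero_smul]
    exact Submodule.zero_mem _
  suffices hdeg : (B.tuple ⟨b, a⟩)⁻¹ * k * (B.tuple ⟨b, a'⟩)⁻¹ = t b by
    have h1 := Submodule.smul_mem _ (S b a a') (hX b)
    rw [← hdeg] at h1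
    exact h1
  rw [← hk b]
  rcases b with i | j
  · change (B.g i)⁻¹ * (B.g i ^ 2 * t (Sum.inl i)) * (B.g i)⁻¹ = t (Sum.inl i)
    rw [pow_two]
    calc _ = ((B.g i)⁻¹ * B.g i) * ((B.g i)⁻¹ * B.g i) * t (Sum.inl i) := by ac_rfl
      _ = _ := by simp
  · have hcc : ∀ x y : Fin (B.p (Sum.inr j)),
        S (Sum.inr j) (Fin.castAdd _ x) (Fin.castAdd _ y) = 0 := by
      intro x y
      rcases h.right_form j with h1 | h1 <;> rw [isOffDiag_iff.1 h1, Matrix.submatrix_apply,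
        finSumFinEquiv_symm_apply_castAdd, finSumFinEquiv_symm_apply_castAdd] <;> rfl
    have hnn : ∀ x y : Fin (B.p (Sum.inr j)),
        S (Sum.inr j) (Fin.natAdd _ x) (Fin.natAdd _ y) = 0 := by
      intro x y
      rcases h.right_form j with h1 | h1 <;> rw [isOffDiag_iff.1 h1, Matrix.submatrix_apply,
        finSumFinEquiv_symm_apply_natAdd, finSumFinEquiv_symm_apply_natAdd] <;> rfl
    change Fin (B.p (Sum.inr j) + B.p (Sum.inr j)) at a a'
    change _ * (B.g' j * B.g'' j * t (Sum.inr j)) * _ = _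
    revert h0
    refine Fin.addCases (fun a => ?_) (fun a => ?_) a <;>
      refine Fin.addCases (fun a' => ?_) (fun a' => ?_) a' <;> intro h0
    · exact absurd (hcc a a') h0
    · rw [B.tuple_castAdd, B.tuple_natAdd]
      calc _ = ((B.g' j)⁻¹ * B.g' j) * ((B.g'' j)⁻¹ * B.g'' j) * t (Sum.inr j) := by ac_rfl
        _ = _ := by simp
    · rw [B.tuple_castAdd, B.tuple_natAdd]
      calc _ = ((B.g' j)⁻¹ * B.g' j) * ((B.g'' j)⁻¹ * B.g'' j) * t (Sum.inr j) := by ac_rfl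
        _ = _ := by simp
    · exact absurd (hnn a a') h0

theorem IsCanonical.transpose_eq_or_and_isUnit {F G : Type*} [Field F] [CommGroup G] {d : ℕ}
    {T : Subgroup G} {𝒟 : G → Submodule F (Matrix (Fin d) (Fin d) F)} {B : BlockTuple G}
    {t : B.Block → G} {S : (b : B.Block) → Matrix (Fin (B.size b)) (Fin (B.size b)) F}
    {X : B.Block → Matrix (Fin d) (Fin d) F} (h : IsCanonical T 𝒟 B t S X) (b : B.Block) :
    ((S b).transpose = S b ∨ (S b).transpose = -S b) ∧ IsUnit (S b) := by
  have h1 : S b = 1 ∨ IsOffDiag 1 (S b) ∨ IsOffDiag (-1) (S b) := by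
    rcases b with i | j
    · exact h.left_form i
    · exact Or.inr (h.right_form j)
  rcases h1 with h1 | h1 | h1
  · rw [h1]
    exact ⟨Or.inl Matrix.transpose_one, isUnit_one⟩
  · have h3 := h1.transpose_eq_and_isUnit (one_mul 1)
    rw [one_smul] at h3
    exact ⟨Or.inl h3.1, h3.2⟩
  · have h3 := h1.transpose_eq_and_isUnit (by ring)
    rw [neg_smul, one_smul] at h3
    exact ⟨Or.inr h3.1, h3.2⟩

theorem IsCanonical.isGradedInvolution {F G : Type*} [Field F] [CommGroup G] [Finite G] {d : ℕ}
    {T : Subgroup G} {𝒟 : G → Submodule F (Matrix (Fin d) (Fin d) F)} {B : BlockTuple G}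
    {t : B.Block → G} {S : (b : B.Block) → Matrix (Fin (B.size b)) (Fin (B.size b)) F}
    {X : B.Block → Matrix (Fin d) (Fin d) F} (h : IsCanonical T 𝒟 B t S X)
    (hF : IsFineComponent T 𝒟)
    (hsymm : (B.form S X).transpose = B.form S X ∨ (B.form S X).transpose = -B.form S X) :
    IsGradedInvolution (tensorGrading B.tuple 𝒟) (B.form S X) := by
  have := Fintype.ofFinite G
  have hX : ∀ b, X b ∈ 𝒟 (t b) := fun b => by
    rw [h.span_eq]
    exact Submodule.mem_span_singleton_self _
  have hX0 : ∀ b, X b ≠ 0 := fun b h0 => (hF.support _).2 (h.t_mem b) (by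
    rw [h.span_eq, h0, Submodule.span_zero_singleton])
  choose X' hX' using fun b => (hF.isDivisionGrading.isUnit (hX b) (hX0 b)).exists_right_inv
  choose S' hS' using fun b => (h.transpose_eq_or_and_isUnit b).2.exists_right_inv
  have hu : IsUnit (B.form S X) := IsUnit.of_mul_eq_one (B.form S' X') (by
    rw [B.form_mul, ← B.form_one]
    simp only [hX', hS'])
  obtain ⟨k, hk⟩ := h.exists_mem_blockGrading
  exact isGradedInvolution_of_mem_blockGrading hF.isGrading hF.transpose_mem hu hsymm hk

theorem IsCanonical.form_transpose_eq {F G : Type*} [Field F] [CommGroup G] {d : ℕ}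
    {T : Subgroup G} {𝒟 : G → Submodule F (Matrix (Fin d) (Fin d) F)} {B : BlockTuple G}
    {t : B.Block → G} {S : (b : B.Block) → Matrix (Fin (B.size b)) (Fin (B.size b)) F}
    {X : B.Block → Matrix (Fin d) (Fin d) F} (h : IsCanonical T 𝒟 B t S X)
    (hsame : ∀ b, SameSymmetry (S b) (X b)) : (B.form S X).transpose = B.form S X := by
  rw [B.form_transpose]
  refine ext_block ?_
  rintro ⟨b, a⟩ ⟨b', a'⟩
  rcases eq_or_ne b b' with rfl | hb
  · rw [B.block_form_same, B.block_form_same]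
    rcases (h.transpose_eq_or_and_isUnit b).1 with h1 | h1
    · rw [h1, (hsame b).1.1 h1]
    · rw [h1, (hsame b).2.1 h1, Matrix.neg_apply, neg_smul, smul_neg, neg_neg]
  · rw [B.block_form_ne _ _ hb, B.block_form_ne _ _ hb]

theorem IsCanonical.form_transpose_eq_neg {F G : Type*} [Field F] [CommGroup G] {d : ℕ}
    {T : Subgroup G} {𝒟 : G → Submodule F (Matrix (Fin d) (Fin d) F)} {B : BlockTuple G}
    {t : B.Block → G} {S : (b : B.Block) → Matrix (Fin (B.size b)) (Fin (B.size b)) F}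
    {X : B.Block → Matrix (Fin d) (Fin d) F} (h : IsCanonical T 𝒟 B t S X)
    (hopp : ∀ b, OppositeSymmetry (S b) (X b)) : (B.form S X).transpose = -B.form S X := by
  have hneg : ∀ x y, block (-B.form S X) x y = -block (B.form S X) x y := fun _ _ => rfl
  rw [B.form_transpose]
  refine ext_block ?_
  rintro ⟨b, a⟩ ⟨b', a'⟩
  rw [hneg]
  rcases eq_or_ne b b' with rfl | hb
  · rw [B.block_form_same, B.block_form_same]
    rcases (h.transpose_eq_or_and_isUnit b).1 with h1 | h1
    · rw [h1, (hopp b).1.1 h1, smul_neg]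
    · rw [h1, (hopp b).2.1 h1, Matrix.neg_apply, neg_smul]
  · rw [B.block_form_ne _ _ hb, B.block_form_ne _ _ hb, neg_zero]

end GradedMatrix

theorem theorem3 {F : Type*} [Field F] [IsAlgClosed F] (hF : ringChar F ≠ 2)
    {G : Type*} [CommGroup G] [Finite G] :
    (∀ (n : ℕ) (𝒜 : G → Submodule F (Matrix (Fin n) (Fin n) F)) (Φ : Matrix (Fin n) (Fin n) F),
      GradedMatrix.IsGrading 𝒜 → GradedMatrix.IsGradedInvolution 𝒜 Φ →
      -- the graded algebra is a tensor product `C ⊗ D`, up to conjugation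
      (∃ (d m : ℕ) (T : Subgroup G) (𝒟 : G → Submodule F (Matrix (Fin d) (Fin d) F))
        (γ : Fin m → G) (P : Matrix (Fin n) (Fin m × Fin d) F)
        (Q : Matrix (Fin m × Fin d) (Fin n) F),
        GradedMatrix.IsFineComponent T 𝒟 ∧ GradedMatrix.MeetsTrivially γ T ∧
          GradedMatrix.IsGradedConj 𝒜 γ 𝒟 P Q) ∧
      -- in each such realization, `Φ` has the canonical form after a further conjugation
      (∀ (d m : ℕ) (T : Subgroup G) (𝒟 : G → Submodule F (Matrix (Fin d) (Fin d) F))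
        (γ : Fin m → G) (P₀ : Matrix (Fin n) (Fin m × Fin d) F)
        (Q₀ : Matrix (Fin m × Fin d) (Fin n) F),
        GradedMatrix.IsFineComponent T 𝒟 → GradedMatrix.MeetsTrivially γ T →
        GradedMatrix.IsGradedConj 𝒜 γ 𝒟 P₀ Q₀ →
        ∃ (B : GradedMatrix.BlockTuple G) (σ : B.Index ≃ Fin m) (t : B.Block → G)
          (S : (b : B.Block) → Matrix (Fin (B.size b)) (Fin (B.size b)) F)
          (X : B.Block → Matrix (Fin d) (Fin d) F)
          (P : Matrix (Fin n) (B.Index × Fin d) F) (Q : Matrix (B.Index × Fin d) (Fin n) F),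
          (∀ a, γ (σ a) = B.tuple a) ∧ B.Distinct ∧
          GradedMatrix.IsCanonical T 𝒟 B t S X ∧
          (∀ i : Fin B.l, S (Sum.inl i) = 1 ∨ GradedMatrix.IsOffDiag (-1) (S (Sum.inl i))) ∧
          GradedMatrix.IsGradedConj 𝒜 B.tuple 𝒟 P Q ∧
          P.transpose * Φ * P = B.form S X ∧
          ((Φ.transpose = Φ ∧ ∀ b, GradedMatrix.SameSymmetry (S b) (X b)) ∨
            (Φ.transpose = -Φ ∧ ∀ b, GradedMatrix.OppositeSymmetry (S b) (X b))))) ∧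
    -- the converse
    (∀ (d : ℕ) (T : Subgroup G) (𝒟 : G → Submodule F (Matrix (Fin d) (Fin d) F))
      (B : GradedMatrix.BlockTuple G) (t : B.Block → G)
      (S : (b : B.Block) → Matrix (Fin (B.size b)) (Fin (B.size b)) F)
      (X : B.Block → Matrix (Fin d) (Fin d) F),
      GradedMatrix.IsFineComponent T 𝒟 → GradedMatrix.IsCanonical T 𝒟 B t S X →
      ((∀ b, GradedMatrix.SameSymmetry (S b) (X b)) ∨
        (∀ b, GradedMatrix.OppositeSymmetry (S b) (X b))) →
      GradedMatrix.IsGrading (GradedMatrix.tensorGrading B.tuple 𝒟) ∧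
      GradedMatrix.IsGradedInvolution (GradedMatrix.tensorGrading B.tuple 𝒟) (B.form S X) ∧
      ((∀ b, GradedMatrix.SameSymmetry (S b) (X b)) →
        (B.form S X).transpose = B.form S X) ∧
      ((∀ b, GradedMatrix.OppositeSymmetry (S b) (X b)) →
        (B.form S X).transpose = -B.form S X)) := by
  have h2 : (2 : F) ≠ 0 := Ring.two_ne_zero hF
  refine ⟨fun n 𝒜 Φ hgr hΦ => ⟨GradedMatrix.exists_isGradedConj h2 hgr hΦ,
    fun d m T 𝒟 γ P₀ Q₀ hD hγ hP₀ => GradedMatrix.exists_canonical_form h2 hΦ hD hγ hP₀⟩, ?_⟩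
  intro d T 𝒟 B t S X hD hcan hsymm
  exact ⟨GradedMatrix.isGrading_tensorGrading hD.isGrading,
    hcan.isGradedInvolution hD (hsymm.imp hcan.form_transpose_eq hcan.form_transpose_eq_neg),
    hcan.form_transpose_eq, hcan.form_transpose_eq_neg⟩
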